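/- Let $\mathcal C$ be a site, let $A$ be a sheaf of abelian groups on $\mathcal C$, and let $n$ be a positive integer such that the multiplication map $n_A\colon A\to A$ is surjective (an epimorphism of sheaves). Write $A[n]=\ker(n_A)$. For a sheaf of abelian groups $G$ on $\mathcal C$, let $\mathrm B G$ denote the category, fibred over $\mathcal C$, of pairs $(S,T)$ where $S$ is an object of $\mathcal C$ and $T$ is a $G$-torsor over $S$, that is, a sheaf of sets on $\mathcal C/S$ which locally has sections and carries a free and transitive action of $G|_S$; its morphisms $(S,T)\to(S',T')$ over $f\colon S\to S'$ are the $G$-equivariant maps $T\to f^*T'$ (these are automatically isomorphisms). For an $A$-torsor $T$, let $T^n$ denote its $n$-fold contraction power, the quotient sheaf of $T\times\cdots\times T$ ($n$ factors) by the relation $(t_1,\dots,t_n)\sim(a_1t_1,\dots,a_nt_n)$ for local sections $a_i$ of $A$ with $a_1\cdots a_n=1$. Let $\mathrm B_nA$ denote the category, fibred over $\mathcal C$, of triples $(S,T,\lambda)$ where $T$ is an $A$-torsor over $S$ and $\lambda$ is a global section of $T^n$ over $S$; its morphisms are the morphisms $T\to f^*T'$ of $\mathrm BA$ such that the induced map $T^n\to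 f^*T'^n$ takes $\lambda$ to $f^*\lambda'$. If $T$ is an $A[n]$-torsor over $S$, then $T^n$ has a canonical global section $\kappa$, whose restriction is $(t,\dots,t)$ for every local section $t$ of $T$. Let $T'=A\times^{A[n]}T$ be the contraction product, that is, the $A$-torsor that is the quotient sheaf of $A\times T$ by the relation $(ah,t)\sim(a,ht)$ for $h$ in $A[n]$, and let $(1,\kappa)$ be the image of $\kappa$ under the map $T^n\to T'^n$ induced by $t\mapsto(1,t)$. The natural map $$\mathrm B A[n]\to \mathrm B_nA,\qquad (S,T)\mapsto (S,\;A\times^{A[n]}T,\;(1,\kappa))$$ is a functor over $\mathcal C$. Then $\mathrm B A[n]$ and $\mathrm B_nA$ are stacks in groupoids over $\mathcal C$, and the natural map $\mathrm B A[n]\to\mathrm B_nA$ is an equivalence of stacks, i.e. it has an inverse functor over $\mathcal C$ up to natural isomorphisms over $\mathcal C$. -/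

import Mathlib

open CategoryTheory Opposite

universe w v' u' v u

namespace TorsorStack

section Sections

variable {D : Type u'} [Category.{v'} D] {K : GrothendieckTopology D}

/-- Sections of a sheaf that agree locally are equal. -/
theorem sheaf_ext {F : Dᵒᵖ ⥤ Type w} (hF : Presheaf.IsSheaf K F) {X : D}
    {s t : F.obj (op X)} {R : Sieve X} (hR : R ∈ K X)
    (h : ∀ ⦃Y : D⦄ (f : Y ⟶ X), R f → F.map f.op s = F.map f.op t) : s = t :=
  (((isSheaf_iff_isSheaf_of_type K F).1 hF).isSeparated R hR).ext h

/-- If sections with a property `P` stable under restriction are unique, and exist locally, they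
glue to a section. -/
theorem sheaf_glue {F : Dᵒᵖ ⥤ Type w} (hF : Presheaf.IsSheaf K F) {X : D}
    (P : ∀ ⦃Y : D⦄, (Y ⟶ X) → F.obj (op Y) → Prop)
    (hres : ∀ ⦃Y Z : D⦄ (f : Y ⟶ X) (g : Z ⟶ Y) (t : F.obj (op Y)),
      P f t → P (g ≫ f) (F.map g.op t))
    (huniq : ∀ ⦃Y : D⦄ (f : Y ⟶ X) (t t' : F.obj (op Y)), P f t → P f t' → t = t')
    {R : Sieve X} (hR : R ∈ K X)
    (hex : ∀ ⦃Y : D⦄ (f : Y ⟶ X), R f → ∃ t : F.obj (op Y), P f t) :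
    ∃ s : F.obj (op X), ∀ ⦃Y : D⦄ (f : Y ⟶ X) (t : F.obj (op Y)), P f t → F.map f.op s = t := by
  choose x hx using hex
  have hc : Presieve.FamilyOfElements.SieveCompatible (P := F) (fun Y f hf => x f hf) := by
    intro Y Z f g hf
    exact huniq _ _ _ (hx _ _) (hres _ _ _ (hx _ _))
  obtain ⟨s, hs, -⟩ := ((isSheaf_iff_isSheaf_of_type K F).1 hF) R hR _
    ((Presieve.compatible_iff_sieveCompatible _).2 hc)
  refine ⟨s, fun Y f t ht => ?_⟩
  refine sheaf_ext hF (K.pullback_stable f hR) fun Z g hg => ?_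
  have := hs (g ≫ f) hg
  rw [← ConcreteCategory.comp_apply, ← F.map_comp, ← op_comp, this]
  exact huniq _ _ _ (hx _ _) (hres _ _ _ ht)

end Sections

section Sheafification

variable {D : Type (max u v)} [Category.{v} D] {K : GrothendieckTopology D}

theorem sheafify_locally_mk (Q : Dᵒᵖ ⥤ Type (max u v)) {X : D}
    (s : (sheafify K Q).obj (op X)) :
    ∃ R ∈ K X, ∀ ⦃Y : D⦄ (f : Y ⟶ X), R f →
      ∃ q : Q.obj (op Y), (toSheafify K Q).app (op Y) q = (sheafify K Q).map f.op s :=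
  ⟨_, Presheaf.imageSieve_mem K (toSheafify K Q) s, fun _ _ h => by exact h⟩

theorem sheafify_locally_eq (Q : Dᵒᵖ ⥤ Type (max u v)) {X : D} {q q' : Q.obj (op X)}
    (h : (toSheafify K Q).app (op X) q = (toSheafify K Q).app (op X) q') :
    ∃ R ∈ K X, ∀ ⦃Y : D⦄ (f : Y ⟶ X), R f → Q.map f.op q = Q.map f.op q' :=
  ⟨_, Presheaf.equalizerSieve_mem K (toSheafify K Q) q q' h, fun _ _ h => by exact h⟩

end Sheafification

variable {C : Type u} [Category.{v} C] {J : GrothendieckTopology C}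


theorem isSheaf_forget (A : Sheaf J AddCommGrpCat.{max u v}) :
    Presheaf.IsSheaf J (A.obj ⋙ forget AddCommGrpCat.{max u v}) :=
  GrothendieckTopology.HasSheafCompose.isSheaf _ A.property

/-- The group of sections `A(U)`. -/
abbrev Grp (A : Sheaf J AddCommGrpCat.{max u v}) (U : C) : Type (max u v) := A.obj.obj (op U)

/-- The `n`-torsion subsheaf `A[n]`, the kernel of multiplication by `n`:
`A[n](U) = {a ∈ A(U) | n • a = 0}`. -/
def torsion (A : Sheaf J AddCommGrpCat.{max u v}) (n : ℕ) : Sheaf J AddCommGrpCat.{max u v} where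
  obj :=
    { obj := fun U => AddCommGrpCat.of (nsmulAddMonoidHom (α := A.obj.obj U) n).ker
      map := fun f => AddCommGrpCat.ofHom
        (((A.obj.map f).hom.comp (AddSubgroup.subtype _)).codRestrict _ (by
          rintro ⟨a, ha⟩
          have ha' : n • a = 0 := ha
          change n • (A.obj.map f a) = 0
          rw [← map_nsmul, ha', map_zero]))
      map_id := fun U => by
        ext ⟨a, ha⟩
        exact ConcreteCategory.congr_hom (A.obj.map_id U) a
      map_comp := fun f g => by
        ext ⟨a, ha⟩
        exact ConcreteCategory.congr_hom (A.obj.map_comp f g) a }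
  property := by
    rw [Presheaf.isSheaf_iff_isSheaf_forget J _ (forget AddCommGrpCat.{max u v}),
      isSheaf_iff_isSheaf_of_type]
    intro X R hR x hx
    have hA := (isSheaf_iff_isSheaf_of_type _ _).1 (isSheaf_forget A)
    obtain ⟨s, hs, hu⟩ := hA R hR (fun Y f hf => (x f hf).1)
      (fun Y₁ Y₂ Z g₁ g₂ f₁ f₂ h₁ h₂ e => congrArg Subtype.val (hx g₁ g₂ h₁ h₂ e))
    have h0 : n • (show Grp A X from s) = 0 := by
      refine sheaf_ext (isSheaf_forget A) hR fun Y f hf => ?_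
      change A.obj.map f.op (n • (show Grp A X from s)) = A.obj.map f.op 0
      rw [map_nsmul, map_zero]
      exact (congrArg (fun z : Grp A Y => n • z) (hs f hf)).trans (x f hf).2
    refine ⟨⟨s, h0⟩, fun Y f hf => Subtype.ext (hs f hf), fun t ht => Subtype.ext ?_⟩
    exact hu t.1 fun Y f hf => congrArg Subtype.val (ht f hf)

/-- The inclusion `A[n] → A`. -/
def torsionIncl (A : Sheaf J AddCommGrpCat.{max u v}) (n : ℕ) : torsion A n ⟶ A :=
  ObjectProperty.homMk
    { app := fun U => AddCommGrpCat.ofHom (AddSubgroup.subtype _)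
      naturality := fun U V f => by ext; rfl }

theorem nsmul_torsion (A : Sheaf J AddCommGrpCat.{max u v}) (n : ℕ) (U : C)
    (a : Grp (torsion A n) U) : n • a = 0 := Subtype.ext a.2

theorem map_eq_map_map {S : C} (F : (Over S)ᵒᵖ ⥤ Type (max u v)) {X Y Z : Over S}
    {f : Y ⟶ X} {g : Z ⟶ Y} {h : Z ⟶ X} (e : h.left = g.left ≫ f.left) (s : F.obj (op X)) :
    F.map h.op s = F.map g.op (F.map f.op s) := by
  obtain rfl : h = g ≫ f := by ext; exact e
  simp

theorem map_map_eq_map_map {S : C} (F : (Over S)ᵒᵖ ⥤ Type (max u v)) {X Y Y' Z : Over S}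
    {f : Y ⟶ X} {g : Z ⟶ Y} {f' : Y' ⟶ X} {g' : Z ⟶ Y'}
    (e : g.left ≫ f.left = g'.left ≫ f'.left) (s : F.obj (op X)) :
    F.map g.op (F.map f.op s) = F.map g'.op (F.map f'.op s) := by
  rw [← map_eq_map_map F (h := g ≫ f) (by simp), map_eq_map_map F (f := f') (g := g')]
  simpa using e

/-- The morphism from `X → S` to the terminal object `S = S` of `Over S`. -/
def toTop {S : C} (X : Over S) : X ⟶ Over.mk (𝟙 S) := Over.homMk X.hom

theorem toTop_left {S : C} (X : Over S) : (toTop X).left = X.hom := rfl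

theorem map_toTop {S : C} (F : (Over S)ᵒᵖ ⥤ Type (max u v)) {X Y : Over S} (f : Y ⟶ X)
    (s : F.obj (op (Over.mk (𝟙 S)))) :
    F.map f.op (F.map (toTop X).op s) = F.map (toTop Y).op s :=
  (map_eq_map_map F (by simp [toTop_left]) s).symm

/-- An `A`-torsor over `S`: a sheaf of sets `T` on the localised site `Over S`, with an action of
`A` restricted to `Over S`, such that `A × T → T × T`, `(a, t) ↦ (t, a + t)` is an isomorphism and
such that `T` locally has sections, i.e. `T → *` is a local epimorphism. -/
structure Torsor (A : Sheaf J AddCommGrpCat.{max u v}) (S : C) where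
  sheaf : Sheaf (J.over S) (Type (max u v))
  [act : ∀ X : Over S, AddAction (Grp A X.left) (sheaf.obj.obj (op X))]
  map_vadd : ∀ ⦃X Y : Over S⦄ (f : Y ⟶ X) (a : Grp A X.left) (t : sheaf.obj.obj (op X)),
    sheaf.obj.map f.op (a +ᵥ t) = A.obj.map f.left.op a +ᵥ sheaf.obj.map f.op t
  simply_transitive : ∀ X : Over S, Function.Bijective
    (fun p : Grp A X.left × sheaf.obj.obj (op X) => (p.2, p.1 +ᵥ p.2))
  locally_nonempty : ∀ X : Over S, ∃ R ∈ (J.over S) X, ∀ ⦃Y : Over S⦄ (f : Y ⟶ X), R f →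
    Nonempty (sheaf.obj.obj (op Y))

attribute [instance] Torsor.act

namespace Torsor

variable {A H : Sheaf J AddCommGrpCat.{max u v}} {S : C}

/-- The set of sections `T(X)`, for `X` over `S`. -/
abbrev Sec (T : Torsor A S) (X : Over S) : Type (max u v) := T.sheaf.obj.obj (op X)

theorem vadd_cancel (T : Torsor A S) {X : Over S} {a b : Grp A X.left} {t : T.Sec X}
    (h : a +ᵥ t = b +ᵥ t) : a = b :=
  congrArg Prod.fst ((T.simply_transitive X).1 (a₁ := (a, t)) (a₂ := (b, t)) (by simp [h]))

theorem exists_vadd_eq (T : Torsor A S) {X : Over S} (t t' : T.Sec X) :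
    ∃ a : Grp A X.left, a +ᵥ t = t' := by
  obtain ⟨⟨a, s⟩, h⟩ := (T.simply_transitive X).2 (t, t')
  obtain ⟨rfl, rfl⟩ := Prod.mk.inj h
  exact ⟨a, rfl⟩

/-- The relation on `n`-tuples of sections of `T` whose quotient is the `n`-fold contraction product:
`(t_i) ~ (a_i + t_i)` whenever `∑ a_i = 0`. As `A` is commutative, this is the equivalence relation
generated by `(…, a + t_i, …, t_j, …) ~ (…, t_i, …, a + t_j, …)`. -/
def powerSetoid (T : Torsor A S) (n : ℕ) (X : Over S) : Setoid (Fin n → T.Sec X) where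
  r x y := ∃ a : Fin n → Grp A X.left, ∑ i, a i = 0 ∧ y = fun i => a i +ᵥ x i
  iseqv :=
    { refl := fun x => ⟨0, by simp, by simp⟩
      symm := by
        rintro x _ ⟨a, ha, rfl⟩
        exact ⟨-a, by simp [ha], by simp⟩
      trans := by
        rintro x _ _ ⟨a, ha, rfl⟩ ⟨b, hb, rfl⟩
        exact ⟨b + a, by simp [Finset.sum_add_distrib, ha, hb], by simp [add_vadd]⟩ }

/-- The presheaf of `n`-tuples of sections of `T` modulo `powerSetoid`. -/
def powerPresheaf (T : Torsor A S) (n : ℕ) : (Over S)ᵒᵖ ⥤ Type (max u v) where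
  obj X := Quotient (T.powerSetoid n X.unop)
  map f := TypeCat.ofHom (Quotient.map (fun x i => T.sheaf.obj.map f (x i)) (by
    rintro x _ ⟨a, ha, rfl⟩
    refine ⟨fun i => A.obj.map f.unop.left.op (a i), ?_, funext fun i => T.map_vadd f.unop _ _⟩
    rw [← map_sum, ha, map_zero]))
  map_id X := by
    ext x
    induction x using Quotient.inductionOn
    exact congrArg (Quotient.mk _) (by simp)
  map_comp f g := by
    ext x
    induction x using Quotient.inductionOn
    exact congrArg (Quotient.mk _) (by simp)

/-- The `n`-th contraction power `T^n`: the quotient sheaf of `T × ⋯ × T` by the contraction relation. -/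
noncomputable def power (T : Torsor A S) (n : ℕ) : Sheaf (J.over S) (Type (max u v)) :=
  (presheafToSheaf (J.over S) (Type (max u v))).obj (T.powerPresheaf n)

/-- The section of `T^n` given by an `n`-tuple of sections of `T`. For a constant tuple `(t, …, t)`
this is the map `T → T^n`, `t ↦ t^n`. -/
noncomputable def powerMk (T : Torsor A S) (n : ℕ) {X : Over S} (x : Fin n → T.Sec X) :
    (T.power n).obj.obj (op X) :=
  (toSheafify (J.over S) (T.powerPresheaf n)).app (op X) (Quotient.mk _ x)

theorem powerMk_map (T : Torsor A S) (n : ℕ) {X Y : Over S} (f : Y ⟶ X) (x : Fin n → T.Sec X) :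
    (T.power n).obj.map f.op (T.powerMk n x) = T.powerMk n fun i => T.sheaf.obj.map f.op (x i) :=
  (NatTrans.naturality_apply (toSheafify (J.over S) (T.powerPresheaf n)) f.op
    (Quotient.mk _ x)).symm

theorem powerMk_vadd (T : Torsor A S) (n : ℕ) {X : Over S} (a : Fin n → Grp A X.left)
    (ha : ∑ i, a i = 0) (x : Fin n → T.Sec X) :
    T.powerMk n (fun i => a i +ᵥ x i) = T.powerMk n x :=
  congrArg ((toSheafify (J.over S) (T.powerPresheaf n)).app (op X))
    (Quotient.sound (s := T.powerSetoid n X) (a := x) ⟨a, ha, rfl⟩).symm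

theorem power_locally_mk (T : Torsor A S) (n : ℕ) {X : Over S} (s : (T.power n).obj.obj (op X)) :
    ∃ R ∈ (J.over S) X, ∀ ⦃Y : Over S⦄ (f : Y ⟶ X), R f →
      ∃ x : Fin n → T.Sec Y, (T.power n).obj.map f.op s = T.powerMk n x := by
  obtain ⟨R, hR, h⟩ := sheafify_locally_mk (K := J.over S) (T.powerPresheaf n) s
  refine ⟨R, hR, fun Y f hf => ?_⟩
  obtain ⟨q, hq⟩ := h f hf
  obtain ⟨x, rfl⟩ := Quotient.exists_rep q
  exact ⟨x, hq.symm⟩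

/-- A map out of `T^n` is given by a natural map on tuples that respects the contraction relation. -/
noncomputable def powerLift (T : Torsor A S) (n : ℕ) {G : (Over S)ᵒᵖ ⥤ Type (max u v)}
    (hG : Presheaf.IsSheaf (J.over S) G)
    (φ : ∀ X : Over S, (Fin n → T.Sec X) → G.obj (op X))
    (hnat : ∀ ⦃X Y : Over S⦄ (f : Y ⟶ X) (x : Fin n → T.Sec X),
      G.map f.op (φ X x) = φ Y fun i => T.sheaf.obj.map f.op (x i))
    (hinv : ∀ (X : Over S) (a : Fin n → Grp A X.left) (x : Fin n → T.Sec X), ∑ i, a i = 0 →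
      φ X (fun i => a i +ᵥ x i) = φ X x) :
    (T.power n).obj ⟶ G :=
  sheafifyLift (J.over S)
    (P := T.powerPresheaf n) (Q := G)
    { app := fun X => TypeCat.ofHom (Quotient.lift (φ X.unop) (by
        rintro x _ ⟨a, ha, rfl⟩
        exact (hinv _ a x ha).symm))
      naturality := fun X Y f => by
        ext x
        induction x using Quotient.inductionOn
        exact (hnat f.unop _).symm } hG

theorem powerLift_mk (T : Torsor A S) (n : ℕ) {G : (Over S)ᵒᵖ ⥤ Type (max u v)}
    (hG : Presheaf.IsSheaf (J.over S) G)
    (φ : ∀ X : Over S, (Fin n → T.Sec X) → G.obj (op X)) (hnat) (hinv) {X : Over S}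
    (x : Fin n → T.Sec X) :
    (T.powerLift n hG φ hnat hinv).app (op X) (T.powerMk n x) = φ X x := by
  have := ConcreteCategory.congr_hom (NatTrans.congr_app
    (toSheafify_sheafifyLift (J.over S) (P := T.powerPresheaf n) (Q := G)
      { app := fun X => TypeCat.ofHom (Quotient.lift (φ X.unop) (by
          rintro x _ ⟨a, ha, rfl⟩
          exact (hinv _ a x ha).symm))
        naturality := fun X Y f => by
          ext x
          induction x using Quotient.inductionOn
          exact (hnat f.unop _).symm } hG) (op X)) (Quotient.mk _ x)
  exact this

theorem power_hom_ext (T : Torsor A S) (n : ℕ) {G : (Over S)ᵒᵖ ⥤ Type (max u v)}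
    (hG : Presheaf.IsSheaf (J.over S) G) {α β : (T.power n).obj ⟶ G}
    (h : ∀ (X : Over S) (x : Fin n → T.Sec X),
      α.app (op X) (T.powerMk n x) = β.app (op X) (T.powerMk n x)) : α = β := by
  refine sheafify_hom_ext (J.over S) (P := T.powerPresheaf n) α β hG ?_
  ext X q
  obtain ⟨x, rfl⟩ := Quotient.exists_rep q
  exact h X.unop x

/-- If `A` is an `n`-torsion group, `T^n` has a global section that is locally `(t, …, t)` for any
local section `t` of `T`. -/
theorem exists_canonicalSection (T : Torsor A S) (n : ℕ)
    (hA : ∀ (U : C) (a : Grp A U), n • a = 0) :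
    ∃ κ : (T.power n).obj.obj (op (Over.mk (𝟙 S))),
      ∀ (X : Over S) (t : T.Sec X),
        (T.power n).obj.map (toTop X).op κ = T.powerMk n fun _ => t := by
  obtain ⟨R, hR, hne⟩ := T.locally_nonempty (Over.mk (𝟙 S))
  obtain ⟨κ, hκ⟩ := sheaf_glue (F := (T.power n).obj) (T.power n).property (X := Over.mk (𝟙 S))
    (fun Y _ s => ∃ t : T.Sec Y, s = T.powerMk n fun _ => t)
    (fun Y Z f g s h => by
      obtain ⟨t, rfl⟩ := h
      exact ⟨_, T.powerMk_map n g _⟩)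
    (fun Y f s s' h h' => by
      obtain ⟨t, rfl⟩ := h
      obtain ⟨t', rfl⟩ := h'
      obtain ⟨a, rfl⟩ := T.exists_vadd_eq t t'
      exact (T.powerMk_vadd n (fun _ => a) (by simp [hA]) _).symm)
    hR
    (fun Y f hf => ⟨_, (hne f hf).some, rfl⟩)
  exact ⟨κ, fun X t => hκ _ _ ⟨t, rfl⟩⟩

/-- The canonical global section `κ` of `T^n`, for a torsor `T` under an `n`-torsion group: the unique
one that restricts to `(t, …, t)` for every local section `t` of `T`. -/
noncomputable def canonicalSection (T : Torsor A S) (n : ℕ)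
    (hA : ∀ (U : C) (a : Grp A U), n • a = 0) : (T.power n).obj.obj (op (Over.mk (𝟙 S))) :=
  (T.exists_canonicalSection n hA).choose

theorem canonicalSection_map (T : Torsor A S) (n : ℕ)
    (hA : ∀ (U : C) (a : Grp A U), n • a = 0) {X : Over S} (t : T.Sec X) :
    (T.power n).obj.map (toTop X).op (T.canonicalSection n hA) =
      T.powerMk n fun _ => t :=
  (T.exists_canonicalSection n hA).choose_spec X t

end Torsor

/-- The objects of the classifying stack `B A`: pairs of an object `S` of the site and an `A`-torsor
over `S`. -/
structure BObj (A : Sheaf J AddCommGrpCat.{max u v}) where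
  base : C
  torsor : Torsor A base

namespace BObj

variable {A : Sheaf J AddCommGrpCat.{max u v}}

/-- A morphism of `B A` over `f : S ⟶ S'`: an `A`-equivariant map of sheaves from `T` to the pullback
of `T'` along `f` (necessarily an isomorphism). -/
structure Hom (P Q : BObj A) where
  base : P.base ⟶ Q.base
  app : ∀ X : Over P.base, P.torsor.Sec X → Q.torsor.Sec ((Over.map base).obj X)
  naturality : ∀ ⦃X Y : Over P.base⦄ (f : Y ⟶ X) (t : P.torsor.Sec X),
    app Y (P.torsor.sheaf.obj.map f.op t) =
      Q.torsor.sheaf.obj.map ((Over.map base).map f).op (app X t)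
  map_vadd : ∀ (X : Over P.base) (a : Grp A X.left) (t : P.torsor.Sec X),
    app X (a +ᵥ t) = (show Grp A ((Over.map base).obj X).left from a) +ᵥ app X t

theorem Hom.ext' {P Q : BObj A} {φ ψ : Hom P Q} (h : φ.base = ψ.base)
    (h' : ∀ (X : Over P.base) (t : P.torsor.Sec X)
      (e : (Over.map φ.base).obj X ⟶ (Over.map ψ.base).obj X), e.left = 𝟙 X.left →
      Q.torsor.sheaf.obj.map e.op (ψ.app X t) = φ.app X t) :
    φ = ψ := by
  obtain ⟨f, φ, _, _⟩ := φ
  obtain ⟨g, ψ, _, _⟩ := ψ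
  obtain rfl : f = g := h
  congr
  funext X t
  refine (h' X t (𝟙 _) rfl).symm.trans ?_
  simp

def Hom.id (P : BObj A) : Hom P P where
  base := 𝟙 P.base
  app X t := P.torsor.sheaf.obj.map
    (Over.homMk (𝟙 X.left) (by simp) : (Over.map (𝟙 P.base)).obj X ⟶ X).op t
  naturality X Y f t := map_map_eq_map_map _ (by simp) t
  map_vadd X a t := by
    refine (P.torsor.map_vadd _ a t).trans ?_
    congr 1
    exact ConcreteCategory.congr_hom (A.obj.map_id _) a

def Hom.comp {P Q R : BObj A} (φ : Hom P Q) (ψ : Hom Q R) : Hom P R where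
  base := φ.base ≫ ψ.base
  app X t := R.torsor.sheaf.obj.map
    (Over.homMk (𝟙 X.left) (by simp) : (Over.map (φ.base ≫ ψ.base)).obj X ⟶
      (Over.map ψ.base).obj ((Over.map φ.base).obj X)).op (ψ.app _ (φ.app X t))
  naturality X Y f t := by
    rw [φ.naturality, ψ.naturality]
    exact map_map_eq_map_map _ (by simp) _
  map_vadd X a t := by
    rw [φ.map_vadd, ψ.map_vadd]
    refine (R.torsor.map_vadd _ _ _).trans ?_
    congr 1
    exact ConcreteCategory.congr_hom (A.obj.map_id _) a

instance : Category (BObj A) where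
  Hom := Hom
  id := Hom.id
  comp := Hom.comp
  id_comp {P Q} φ := by
    refine Hom.ext' (Category.id_comp φ.base) fun X t e he => ?_
    refine Eq.trans ?_ (congrArg (Q.torsor.sheaf.obj.map _)
      (φ.naturality (Over.homMk (𝟙 X.left) (by simp) : (Over.map (𝟙 P.base)).obj X ⟶ X) t).symm)
    refine map_eq_map_map _ ?_ _
    simp [he]
  comp_id {P Q} φ := by
    refine Hom.ext' (Category.comp_id φ.base) fun X t e he => ?_
    refine map_eq_map_map _ ?_ _
    simp [he]
  assoc {P Q R W} φ ψ χ := by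
    refine Hom.ext' (Category.assoc φ.base ψ.base χ.base) fun X t e he => ?_
    refine Eq.trans ?_ (congrArg (W.torsor.sheaf.obj.map _) (χ.naturality
      (Over.homMk (𝟙 X.left) (by simp) : (Over.map (φ.base ≫ ψ.base)).obj X ⟶
        (Over.map ψ.base).obj ((Over.map φ.base).obj X)) (ψ.app _ (φ.app X t))).symm)
    refine (congrArg (W.torsor.sheaf.obj.map e.op) ?_).trans
      (map_map_eq_map_map (f := (Over.homMk (𝟙 X.left) (by simp) :
        (Over.map (φ.base ≫ ψ.base ≫ χ.base)).obj X ⟶ (Over.map χ.base).obj ((Over.map ψ.base).obj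
          ((Over.map φ.base).obj X)))) _ ?_ _)
    · exact (map_eq_map_map _ (by simp) _).symm
    · simp [he]

/-- The projection of `B A` to the site. -/
def proj (A : Sheaf J AddCommGrpCat.{max u v}) : BObj A ⥤ C where
  obj P := P.base
  map φ := φ.base

end BObj

namespace BObj

variable {A : Sheaf J AddCommGrpCat.{max u v}}

theorem isSheaf_pullback {S S' : C} (f : S ⟶ S') (F : Sheaf (J.over S') (Type (max u v))) :
    Presheaf.IsSheaf (J.over S) ((Over.map f).op ⋙ F.obj) :=
  ((J.overMapPullback (Type (max u v)) f).obj F).property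

/-- The map `T^n → f^*(T'^n)` induced by a morphism `T → T'` of `B A` over `f`. -/
noncomputable def powerMap {P Q : BObj A} (φ : P ⟶ Q) (n : ℕ) :
    (P.torsor.power n).obj ⟶ (Over.map (Hom.base φ)).op ⋙ (Q.torsor.power n).obj :=
  P.torsor.powerLift n (isSheaf_pullback _ _)
    (fun X x => Q.torsor.powerMk n fun i => Hom.app φ X (x i))
    (fun X Y f x => by
      refine (Q.torsor.powerMk_map n _ _).trans ?_
      exact congrArg _ (funext fun i => (Hom.naturality φ f (x i)).symm))
    (fun X a x ha => by
      simp only [Hom.map_vadd φ]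
      exact Q.torsor.powerMk_vadd n _ ha _)

theorem powerMap_mk {P Q : BObj A} (φ : P ⟶ Q) (n : ℕ) {X : Over P.base}
    (x : Fin n → P.torsor.Sec X) :
    (powerMap φ n).app (op X) (P.torsor.powerMk n x) =
      Q.torsor.powerMk n fun i => Hom.app φ X (x i) :=
  P.torsor.powerLift_mk n _ _ _ _ x

theorem powerMap_id (P : BObj A) (n : ℕ) {X : Over P.base}
    (s : (P.torsor.power n).obj.obj (op X)) :
    (powerMap (𝟙 P) n).app (op X) s = (P.torsor.power n).obj.map
      (Over.homMk (𝟙 X.left) (by simp) : (Over.map (𝟙 P.base)).obj X ⟶ X).op s := by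
  obtain ⟨R, hR, h⟩ := P.torsor.power_locally_mk n s
  refine sheaf_ext (isSheaf_pullback (𝟙 P.base) (P.torsor.power n)) hR fun Y f hf => ?_
  obtain ⟨x, hx⟩ := h f hf
  refine (NatTrans.naturality_apply (powerMap (𝟙 P) n) f.op s).symm.trans ?_
  rw [hx, powerMap_mk]
  have hx' : (P.torsor.power n).obj.map
      (Over.homMk (𝟙 Y.left) (by simp) : (Over.map (𝟙 P.base)).obj Y ⟶ Y).op
        ((P.torsor.power n).obj.map f.op s) = _ :=
    (congrArg _ hx).trans (P.torsor.powerMk_map n _ x)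
  exact hx'.symm.trans (map_map_eq_map_map _ (by simp) s)

theorem powerMap_comp {P Q R : BObj A} (φ : P ⟶ Q) (ψ : Q ⟶ R) (n : ℕ) {X : Over P.base}
    (s : (P.torsor.power n).obj.obj (op X)) :
    (powerMap (φ ≫ ψ) n).app (op X) s = (R.torsor.power n).obj.map
      (Over.homMk (𝟙 X.left) (by simp) :
        (Over.map (Hom.base φ ≫ Hom.base ψ)).obj X ⟶
          (Over.map (Hom.base ψ)).obj ((Over.map (Hom.base φ)).obj X)).op
      ((powerMap ψ n).app (op ((Over.map (Hom.base φ)).obj X)) ((powerMap φ n).app (op X) s)) := by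
  obtain ⟨T, hT, h⟩ := P.torsor.power_locally_mk n s
  refine sheaf_ext (isSheaf_pullback (Hom.base φ ≫ Hom.base ψ) (R.torsor.power n)) hT
    fun Y f hf => ?_
  obtain ⟨x, hx⟩ := h f hf
  refine (NatTrans.naturality_apply (powerMap (φ ≫ ψ) n) f.op s).symm.trans ?_
  rw [hx, powerMap_mk]
  have h1 : (Q.torsor.power n).obj.map ((Over.map (Hom.base φ)).map f).op
      ((powerMap φ n).app (op X) s) = Q.torsor.powerMk n fun i => Hom.app φ Y (x i) :=
    (NatTrans.naturality_apply (powerMap φ n) f.op s).symm.trans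
      ((congrArg _ hx).trans (powerMap_mk φ n x))
  have h2 : (R.torsor.power n).obj.map
      ((Over.map (Hom.base ψ)).map ((Over.map (Hom.base φ)).map f)).op
        ((powerMap ψ n).app (op ((Over.map (Hom.base φ)).obj X)) ((powerMap φ n).app (op X) s)) =
      R.torsor.powerMk n fun i => Hom.app ψ _ (Hom.app φ Y (x i)) :=
    (NatTrans.naturality_apply (powerMap ψ n) ((Over.map (Hom.base φ)).map f).op _).symm.trans
      ((congrArg _ h1).trans (powerMap_mk ψ n _))
  have h3 := (congrArg ((R.torsor.power n).obj.map (Over.homMk (𝟙 Y.left) (by simp) :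
        (Over.map (Hom.base φ ≫ Hom.base ψ)).obj Y ⟶
          (Over.map (Hom.base ψ)).obj ((Over.map (Hom.base φ)).obj Y)).op) h2).trans
    (R.torsor.powerMk_map n _ _)
  exact h3.symm.trans (map_map_eq_map_map _ (by simp) _)

end BObj

/-- The objects of `B_n A`: an `A`-torsor `T` over an object `S` of the site, and a global section of
`T^n`, i.e. a section over the terminal object of `Over S`. -/
structure BPowObj (A : Sheaf J AddCommGrpCat.{max u v}) (n : ℕ) extends BObj A where
  sec : (torsor.power n).obj.obj (op (Over.mk (𝟙 base)))

namespace BPowObj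

variable {A : Sheaf J AddCommGrpCat.{max u v}} {n : ℕ}

/-- A morphism `T → T'` of `B A` over `f : S ⟶ S'` is compatible with given global sections of `T^n`
and `T'^n`: the induced map `T^n → f^*(T'^n)` takes the first to the pullback of the second. -/
def PreservesSec {P Q : BPowObj A n} (φ : P.toBObj ⟶ Q.toBObj) : Prop :=
  (BObj.powerMap φ n).app (op (Over.mk (𝟙 P.base))) P.sec =
    (Q.torsor.power n).obj.map
      (toTop ((Over.map (BObj.Hom.base φ)).obj (Over.mk (𝟙 P.base)))).op Q.sec

theorem PreservesSec.id (P : BPowObj A n) : PreservesSec (P := P) (Q := P) (𝟙 P.toBObj) := by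
  refine (BObj.powerMap_id _ _ _).trans ?_
  refine congrArg (fun f => (P.torsor.power n).obj.map (Quiver.Hom.op f) P.sec) ?_
  ext
  exact (Category.id_comp (𝟙 P.base)).symm

theorem PreservesSec.comp {P Q R : BPowObj A n} {φ : P.toBObj ⟶ Q.toBObj}
    {ψ : Q.toBObj ⟶ R.toBObj} (h : PreservesSec φ) (h' : PreservesSec ψ) :
    PreservesSec (P := P) (Q := R) (φ ≫ ψ) := by
  refine (BObj.powerMap_comp φ ψ n _).trans ?_
  have h1 : (BObj.powerMap ψ n).app (op ((Over.map (BObj.Hom.base φ)).obj (Over.mk (𝟙 P.base))))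
      ((BObj.powerMap φ n).app (op (Over.mk (𝟙 P.base))) P.sec) = (R.torsor.power n).obj.map
      (toTop ((Over.map (BObj.Hom.base ψ)).obj ((Over.map (BObj.Hom.base φ)).obj
        (Over.mk (𝟙 P.base))))).op R.sec := by
    refine (congrArg _ h).trans ((NatTrans.naturality_apply (BObj.powerMap ψ n) _ Q.sec).trans
      ((congrArg (fun z => ((Over.map (BObj.Hom.base ψ)).op ⋙ (R.torsor.power n).obj).map
        (toTop ((Over.map (BObj.Hom.base φ)).obj (Over.mk (𝟙 P.base)))).op z) h').trans ?_))
    exact map_toTop (R.torsor.power n).obj _ _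
  exact (congrArg _ h1).trans (map_toTop (R.torsor.power n).obj _ _)

/-- Morphisms of `B_n A`: morphisms of torsors respecting the global sections. -/
@[ext]
structure Hom (P Q : BPowObj A n) where
  hom : P.toBObj ⟶ Q.toBObj
  preservesSec : PreservesSec hom

instance : Category (BPowObj A n) where
  Hom := Hom
  id P := ⟨𝟙 P.toBObj, .id P⟩
  comp φ ψ := ⟨φ.hom ≫ ψ.hom, φ.preservesSec.comp ψ.preservesSec⟩

/-- The projection of `B_n A` to the site. -/
def proj (A : Sheaf J AddCommGrpCat.{max u v}) (n : ℕ) : BPowObj A n ⥤ C where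
  obj P := P.base
  map φ := BObj.Hom.base (Hom.hom φ)

end BPowObj


namespace Torsor

variable {A H : Sheaf J AddCommGrpCat.{max u v}} {S : C} (i : H ⟶ A) (T : Torsor H S)

/-- The homomorphism `H(U) → A(U)` on sections given by `i : H ⟶ A`. -/
abbrev grpMap {A H : Sheaf J AddCommGrpCat.{max u v}} (i : H ⟶ A) {U : C} (h : Grp H U) : Grp A U :=
  i.hom.app (op U) h

theorem grpMap_map {A H : Sheaf J AddCommGrpCat.{max u v}} (i : H ⟶ A) {U V : C} (f : V ⟶ U)
    (h : Grp H U) : A.obj.map f.op (grpMap i h) = grpMap i (H.obj.map f.op h) :=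
  (NatTrans.naturality_apply i.hom f.op h).symm

/-- The contraction relation `(a + i h, t) ~ (a, h + t)` on `A × T`, for `h` in `H`. -/
def contractSetoid (X : Over S) : Setoid (Grp A X.left × T.Sec X) where
  r p q := ∃ h : Grp H X.left, p.1 = q.1 + grpMap i h ∧ q.2 = h +ᵥ p.2
  iseqv :=
    { refl := fun p => ⟨0, by simp, by simp⟩
      symm := by
        rintro ⟨a, t⟩ ⟨b, s⟩ ⟨h, h1, h2⟩
        dsimp only at h1 h2
        exact ⟨-h, by simp [h1], by simp [h2]⟩
      trans := by
        rintro ⟨a, t⟩ ⟨b, s⟩ ⟨c, r⟩ ⟨h, h1, h2⟩ ⟨k, h3, h4⟩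
        dsimp only at h1 h2 h3 h4
        exact ⟨k + h, by simp [h1, h3, add_assoc], by simp [h2, h4, add_vadd]⟩ }

/-- The presheaf quotient of `A × T` by the contraction relation. -/
def contractPresheaf : (Over S)ᵒᵖ ⥤ Type (max u v) where
  obj X := Quotient (contractSetoid i T X.unop)
  map f := TypeCat.ofHom (Quotient.map
    (fun p => (A.obj.map f.unop.left.op p.1, T.sheaf.obj.map f p.2)) (by
      rintro ⟨a, t⟩ ⟨b, s⟩ ⟨h, h1, h2⟩
      refine ⟨H.obj.map f.unop.left.op h, ?_,
        (congrArg (T.sheaf.obj.map f) h2).trans (T.map_vadd f.unop h t)⟩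
      rw [← grpMap_map, ← map_add]
      exact congrArg _ h1))
  map_id X := by
    ext x
    induction x using Quotient.inductionOn
    exact congrArg (Quotient.mk _) (by simp)
  map_comp f g := by
    ext x
    induction x using Quotient.inductionOn
    exact congrArg (Quotient.mk _) (by simp)

/-- The sheaf of sets underlying the contraction product of `A` and `T` over `H`. -/
noncomputable def contractSheaf : Sheaf (J.over S) (Type (max u v)) :=
  (presheafToSheaf (J.over S) (Type (max u v))).obj (contractPresheaf i T)

/-- The section `(a, t)` of the contraction product. -/
noncomputable def contractMk {X : Over S} (a : Grp A X.left) (t : T.Sec X) :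
    (contractSheaf i T).obj.obj (op X) :=
  (toSheafify (J.over S) (contractPresheaf i T)).app (op X) (Quotient.mk _ (a, t))

theorem contractMk_map {X Y : Over S} (f : Y ⟶ X) (a : Grp A X.left) (t : T.Sec X) :
    (contractSheaf i T).obj.map f.op (contractMk i T a t) =
      contractMk i T (A.obj.map f.left.op a) (T.sheaf.obj.map f.op t) :=
  (NatTrans.naturality_apply (toSheafify (J.over S) (contractPresheaf i T)) f.op
    (Quotient.mk _ (a, t))).symm

theorem contractMk_rel {X : Over S} (a : Grp A X.left) (h : Grp H X.left) (t : T.Sec X) :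
    contractMk i T (a + grpMap i h) t = contractMk i T a (h +ᵥ t) :=
  congrArg ((toSheafify (J.over S) (contractPresheaf i T)).app (op X))
    (Quotient.sound (s := contractSetoid i T X) ⟨h, rfl, rfl⟩)

theorem contract_locally_mk {X : Over S} (s : (contractSheaf i T).obj.obj (op X)) :
    ∃ R ∈ (J.over S) X, ∀ ⦃Y : Over S⦄ (f : Y ⟶ X), R f →
      ∃ (a : Grp A Y.left) (t : T.Sec Y),
        (contractSheaf i T).obj.map f.op s = contractMk i T a t := by
  obtain ⟨R, hR, h⟩ := sheafify_locally_mk (K := J.over S) (contractPresheaf i T) s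
  refine ⟨R, hR, fun Y f hf => ?_⟩
  obtain ⟨q, hq⟩ := h f hf
  obtain ⟨⟨a, t⟩, rfl⟩ := Quotient.exists_rep q
  exact ⟨a, t, hq.symm⟩

theorem contract_locally_eq {X : Over S} {a b : Grp A X.left} {t r : T.Sec X}
    (e : contractMk i T a t = contractMk i T b r) :
    ∃ R ∈ (J.over S) X, ∀ ⦃Y : Over S⦄ (f : Y ⟶ X), R f → ∃ h : Grp H Y.left,
      A.obj.map f.left.op a = A.obj.map f.left.op b + grpMap i h ∧
        T.sheaf.obj.map f.op r = h +ᵥ T.sheaf.obj.map f.op t := by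
  obtain ⟨R, hR, h⟩ := sheafify_locally_eq (K := J.over S) (contractPresheaf i T) e
  exact ⟨R, hR, fun Y f hf => Quotient.exact (s := contractSetoid i T Y) (h f hf)⟩

theorem contractMk_vadd_congr {X : Over S} (c : Grp A X.left) {a b : Grp A X.left} {t r : T.Sec X}
    (e : contractMk i T a t = contractMk i T b r) :
    contractMk i T (c + a) t = contractMk i T (c + b) r := by
  obtain ⟨R, hR, h⟩ := contract_locally_eq i T e
  refine sheaf_ext (contractSheaf i T).property hR fun Y f hf => ?_
  obtain ⟨h, h1, h2⟩ := h f hf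
  refine (contractMk_map i T f _ _).trans (Eq.trans ?_ (contractMk_map i T f _ _).symm)
  rw [map_add, map_add, h1, h2, ← add_assoc, contractMk_rel]

theorem grp_ext {X : Over S} {R : Sieve X} (hR : R ∈ (J.over S) X) {a b : Grp A X.left}
    (h : ∀ ⦃Y : Over S⦄ (f : Y ⟶ X), R f → A.obj.map f.left.op a = A.obj.map f.left.op b) :
    a = b :=
  sheaf_ext (F := (Over.forget S).op ⋙ A.obj ⋙ forget AddCommGrpCat.{max u v})
    ((J.overPullback (Type (max u v)) S).obj ⟨_, isSheaf_forget A⟩).property hR h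

theorem contractMk_cancel {X : Over S} {a b : Grp A X.left} {t : T.Sec X}
    (e : contractMk i T a t = contractMk i T b t) : a = b := by
  obtain ⟨R, hR, h⟩ := contract_locally_eq i T e
  refine grp_ext hR fun Y f hf => ?_
  obtain ⟨h, h1, h2⟩ := h f hf
  have h0 : h = 0 := T.vadd_cancel (h2.symm.trans (zero_vadd _ _).symm)
  simpa [h0] using h1

theorem exists_contractVadd {X : Over S} (c : Grp A X.left)
    (s : (contractSheaf i T).obj.obj (op X)) :
    ∃ r : (contractSheaf i T).obj.obj (op X), ∀ ⦃Y : Over S⦄ (f : Y ⟶ X) (a : Grp A Y.left)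
      (t : T.Sec Y), (contractSheaf i T).obj.map f.op s = contractMk i T a t →
        (contractSheaf i T).obj.map f.op r = contractMk i T (A.obj.map f.left.op c + a) t := by
  obtain ⟨R, hR, h⟩ := contract_locally_mk i T s
  obtain ⟨r, hr⟩ := sheaf_glue (F := (contractSheaf i T).obj) (contractSheaf i T).property (X := X)
    (fun Y f r => ∃ (a : Grp A Y.left) (t : T.Sec Y),
      (contractSheaf i T).obj.map f.op s = contractMk i T a t ∧
        r = contractMk i T (A.obj.map f.left.op c + a) t)
    (fun Y Z f g r h => by
      obtain ⟨a, t, h1, rfl⟩ := h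
      refine ⟨A.obj.map g.left.op a, T.sheaf.obj.map g.op t, ?_, ?_⟩
      · rw [← contractMk_map, ← h1]
        simp
      · rw [contractMk_map, map_add]
        simp)
    (fun Y f r r' h h' => by
      obtain ⟨a, t, h1, rfl⟩ := h
      obtain ⟨b, u, h2, rfl⟩ := h'
      exact contractMk_vadd_congr i T _ (h1.symm.trans h2))
    hR
    (fun Y f hf => by
      obtain ⟨a, t, h1⟩ := h f hf
      exact ⟨_, a, t, h1, rfl⟩)
  exact ⟨r, fun Y f a t h => hr f _ ⟨a, t, h, rfl⟩⟩

/-- The action of `A` on the contraction product: locally `c + (a, t) = (c + a, t)`,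
see `contractVadd_mk`. -/
noncomputable def contractVadd {X : Over S} (c : Grp A X.left)
    (s : (contractSheaf i T).obj.obj (op X)) : (contractSheaf i T).obj.obj (op X) :=
  (exists_contractVadd i T c s).choose

theorem contractVadd_mk {X : Over S} (c a : Grp A X.left) (t : T.Sec X) :
    contractVadd i T c (contractMk i T a t) = contractMk i T (c + a) t := by
  have := (exists_contractVadd i T c (contractMk i T a t)).choose_spec (𝟙 X) a t (by simp)
  simpa [contractVadd] using this

theorem contractVadd_map {X Y : Over S} (f : Y ⟶ X) (c : Grp A X.left)
    (s : (contractSheaf i T).obj.obj (op X)) :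
    (contractSheaf i T).obj.map f.op (contractVadd i T c s) =
      contractVadd i T (A.obj.map f.left.op c) ((contractSheaf i T).obj.map f.op s) := by
  obtain ⟨R, hR, h⟩ := contract_locally_mk i T ((contractSheaf i T).obj.map f.op s)
  refine sheaf_ext (contractSheaf i T).property hR fun Z g hg => ?_
  obtain ⟨a, t, e⟩ := h g hg
  have h1 := (exists_contractVadd i T c s).choose_spec (g ≫ f) a t (by simpa using e)
  have h2 := (exists_contractVadd i T (A.obj.map f.left.op c)
    ((contractSheaf i T).obj.map f.op s)).choose_spec g a t e
  refine Eq.trans ?_ (h1.trans (Eq.trans ?_ h2.symm))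
  · simp [contractVadd]
  · simp

theorem contract_induction {X : Over S} {s r : (contractSheaf i T).obj.obj (op X)}
    (h : ∀ ⦃Y : Over S⦄ (f : Y ⟶ X) (a : Grp A Y.left) (t : T.Sec Y),
      (contractSheaf i T).obj.map f.op s = contractMk i T a t →
        (contractSheaf i T).obj.map f.op r = contractMk i T a t) : s = r := by
  obtain ⟨R, hR, h'⟩ := contract_locally_mk i T s
  refine sheaf_ext (contractSheaf i T).property hR fun Y f hf => ?_
  obtain ⟨a, t, e⟩ := h' f hf
  exact e.trans (h f a t e).symm

theorem contractVadd_cancel {X : Over S} {c d : Grp A X.left}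
    {s : (contractSheaf i T).obj.obj (op X)}
    (h : contractVadd i T c s = contractVadd i T d s) : c = d := by
  obtain ⟨R, hR, h'⟩ := contract_locally_mk i T s
  refine grp_ext hR fun Y f hf => ?_
  obtain ⟨a, t, e⟩ := h' f hf
  have h3 := congrArg ((contractSheaf i T).obj.map f.op) h
  have h4 := (contractVadd_map i T f c s).symm.trans (h3.trans (contractVadd_map i T f d s))
  rw [e, contractVadd_mk, contractVadd_mk] at h4
  exact add_right_cancel (contractMk_cancel i T h4)

theorem exists_contractVadd_eq {X : Over S} (s r : (contractSheaf i T).obj.obj (op X)) :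
    ∃ c : Grp A X.left, contractVadd i T c s = r := by
  obtain ⟨R, hR, h⟩ := contract_locally_mk i T s
  obtain ⟨R', hR', h'⟩ := contract_locally_mk i T r
  have hex : ∀ ⦃Y : Over S⦄ (f : Y ⟶ X), (R ⊓ R') f → ∃ c : Grp A Y.left,
      contractVadd i T c ((contractSheaf i T).obj.map f.op s) =
        (contractSheaf i T).obj.map f.op r := by
    rintro Y f ⟨hf, hf'⟩
    obtain ⟨a, t, e⟩ := h f hf
    obtain ⟨b, u, e'⟩ := h' f hf'
    obtain ⟨k, rfl⟩ := T.exists_vadd_eq t u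
    refine ⟨b + grpMap i k - a, ?_⟩
    rw [e, e', contractVadd_mk, sub_add_cancel, contractMk_rel]
  have hRR := (J.over S).intersection_covering hR hR'
  obtain ⟨c, hc⟩ := sheaf_glue (F := (Over.forget S).op ⋙ A.obj ⋙ forget AddCommGrpCat.{max u v})
    ((J.overPullback (Type (max u v)) S).obj ⟨_, isSheaf_forget A⟩).property (X := X)
    (fun Y f c => contractVadd i T (show Grp A Y.left from c)
      ((contractSheaf i T).obj.map f.op s) = (contractSheaf i T).obj.map f.op r)
    (fun Y Z f g c h => by
      have h1 := (contractVadd_map i T g c _).symm.trans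
        (congrArg ((contractSheaf i T).obj.map g.op) h)
      have h2 : contractVadd i T (A.obj.map g.left.op (show Grp A Y.left from c))
          ((contractSheaf i T).obj.map (g ≫ f).op s) =
            (contractSheaf i T).obj.map (g ≫ f).op r := by
        simpa using h1
      exact h2)
    (fun Y f c c' h h' => contractVadd_cancel i T (h.trans h'.symm))
    hRR hex
  refine ⟨c, sheaf_ext (contractSheaf i T).property hRR fun Y f hf => ?_⟩
  obtain ⟨d, hd⟩ := hex f hf
  refine (contractVadd_map i T f c s).trans (Eq.trans ?_ hd)
  exact congrArg (fun d => contractVadd i T d _) (hc f d hd)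

/-- The contraction product of `A` with an `H`-torsor `T` along `i : H ⟶ A`, as an `A`-torsor. -/
noncomputable def contract : Torsor A S where
  sheaf := contractSheaf i T
  act X :=
    { vadd := contractVadd i T
      zero_vadd := fun s => (contract_induction i T fun Y f a t e => by
        refine (contractVadd_map i T f _ _).trans ?_
        rw [e, contractVadd_mk, map_zero, zero_add]).symm
      add_vadd := fun c d s => by
        obtain ⟨R, hR, h⟩ := contract_locally_mk i T s
        refine sheaf_ext (contractSheaf i T).property hR fun Y f hf => ?_
        obtain ⟨a, t, e⟩ := h f hf
        change _ = (contractSheaf i T).obj.map f.op (contractVadd i T c (contractVadd i T d s))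
        refine (contractVadd_map i T f _ _).trans ?_
        rw [contractVadd_map, contractVadd_map, e, contractVadd_mk, contractVadd_mk,
          contractVadd_mk, map_add, add_assoc] }
  map_vadd X Y f a s := contractVadd_map i T f a s
  simply_transitive X := by
    constructor
    · rintro ⟨c, s⟩ ⟨d, r⟩ h
      obtain ⟨rfl, h2⟩ := Prod.mk.inj h
      exact Prod.ext (contractVadd_cancel i T h2) rfl
    · rintro ⟨s, r⟩
      obtain ⟨c, rfl⟩ := exists_contractVadd_eq i T s r
      exact ⟨(c, s), rfl⟩
  locally_nonempty X := by
    obtain ⟨R, hR, h⟩ := T.locally_nonempty X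
    exact ⟨R, hR, fun Y f hf => ⟨contractMk i T 0 (h f hf).some⟩⟩

theorem contractMk_eq_vadd {X : Over S} (a : Grp A X.left) (t : T.Sec X) :
    contractMk i T a t = a +ᵥ (show (contract i T).Sec X from contractMk i T 0 t) := by
  refine Eq.trans ?_ (contractVadd_mk i T a 0 t).symm
  rw [add_zero]

theorem contractMk_zero_vadd {X : Over S} (h : Grp H X.left) (t : T.Sec X) :
    contractMk i T 0 (h +ᵥ t) =
      grpMap i h +ᵥ (show (contract i T).Sec X from contractMk i T 0 t) := by
  rw [← contractMk_rel, zero_add]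
  exact contractMk_eq_vadd i T _ t

theorem contract_ext {G : (Over S)ᵒᵖ ⥤ Type (max u v)} (hG : Presheaf.IsSheaf (J.over S) G)
    {X : Over S} {s r : G.obj (op X)} (z : (contract i T).Sec X)
    (h : ∀ ⦃Y : Over S⦄ (f : Y ⟶ X) (a : Grp A Y.left) (t : T.Sec Y),
      (contract i T).sheaf.obj.map f.op z = contractMk i T a t → G.map f.op s = G.map f.op r) :
    s = r := by
  obtain ⟨R, hR, h'⟩ := contract_locally_mk i T z
  refine sheaf_ext hG hR fun Y f hf => ?_
  obtain ⟨a, t, e⟩ := h' f hf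
  exact h f a t e

end Torsor

namespace BObj

variable {A H : Sheaf J AddCommGrpCat.{max u v}} (i : H ⟶ A)

open TorsorStack.Torsor

noncomputable def inducedObj (P : BObj H) : BObj A := ⟨P.base, contract i P.torsor⟩

section Lift

variable {P : BObj H} {Q : BObj A} (f : P.base ⟶ Q.base)
  (φ : ∀ X : Over P.base, P.torsor.Sec X → Q.torsor.Sec ((Over.map f).obj X))
  (hnat : ∀ ⦃X Y : Over P.base⦄ (g : Y ⟶ X) (t : P.torsor.Sec X),
    φ Y (P.torsor.sheaf.obj.map g.op t) =
      Q.torsor.sheaf.obj.map ((Over.map f).map g).op (φ X t))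
  (hequiv : ∀ (X : Over P.base) (h : Grp H X.left) (t : P.torsor.Sec X),
    φ X (h +ᵥ t) = (show Grp A ((Over.map f).obj X).left from grpMap i h) +ᵥ φ X t)

noncomputable def liftNatTrans :
    (contractSheaf i P.torsor).obj ⟶ (Over.map f).op ⋙ Q.torsor.sheaf.obj :=
  sheafifyLift (J.over P.base) (P := contractPresheaf i P.torsor)
    (Q := (Over.map f).op ⋙ Q.torsor.sheaf.obj)
    { app := fun X => TypeCat.ofHom (Quotient.lift
        (fun p => (show Grp A ((Over.map f).obj X.unop).left from p.1) +ᵥ φ X.unop p.2) (by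
          rintro ⟨a, t⟩ ⟨b, s⟩ ⟨h, h1, h2⟩
          dsimp only at h1 h2 ⊢
          rw [h1, h2, hequiv]
          exact add_vadd (show Grp A ((Over.map f).obj X.unop).left from b) (grpMap i h)
            (φ X.unop t)))
      naturality := fun X Y g => by
        ext x
        induction x using Quotient.inductionOn with
        | _ p =>
          refine Eq.trans ?_ (Q.torsor.map_vadd ((Over.map f).map g.unop) _ _).symm
          exact congrArg _ (hnat g.unop p.2) }
    (isSheaf_pullback f Q.torsor.sheaf)

theorem liftNatTrans_mk {X : Over P.base} (a : Grp A X.left) (t : P.torsor.Sec X) :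
    (liftNatTrans i f φ hnat hequiv).app (op X) (contractMk i P.torsor a t) =
      (show Grp A ((Over.map f).obj X).left from a) +ᵥ φ X t :=
  ConcreteCategory.congr_hom (NatTrans.congr_app
    (toSheafify_sheafifyLift (J.over P.base) (P := contractPresheaf i P.torsor)
      (Q := (Over.map f).op ⋙ Q.torsor.sheaf.obj) _
      (isSheaf_pullback f Q.torsor.sheaf)) (op X)) (Quotient.mk _ (a, t))

/-- An `H`-equivariant map from `T` to (a pullback of) an `A`-torsor extends to the contraction
product. -/
noncomputable def lift : inducedObj i P ⟶ Q where
  base := f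
  app X s := (liftNatTrans i f φ hnat hequiv).app (op X) s
  naturality X Y g s := NatTrans.naturality_apply (liftNatTrans i f φ hnat hequiv) g.op s
  map_vadd X c s := by
    refine contract_ext i P.torsor (isSheaf_pullback f Q.torsor.sheaf) s fun Y g a t e => ?_
    refine (NatTrans.naturality_apply (liftNatTrans i f φ hnat hequiv) g.op _).symm.trans ?_
    refine Eq.trans ?_ (Q.torsor.map_vadd ((Over.map f).map g) _ _).symm
    have h1 : (contractSheaf i P.torsor).obj.map g.op (contractVadd i P.torsor c s) =
        contractMk i P.torsor (A.obj.map g.left.op c + a) t :=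
      (contractVadd_map i P.torsor g c s).trans
        ((congrArg _ e).trans (contractVadd_mk i P.torsor _ a t))
    refine (congrArg _ h1).trans ((liftNatTrans_mk i f φ hnat hequiv _ _).trans ?_)
    have h2 := (NatTrans.naturality_apply (liftNatTrans i f φ hnat hequiv) g.op s).symm.trans
      ((congrArg _ e).trans (liftNatTrans_mk i f φ hnat hequiv a t))
    exact (add_vadd (show Grp A ((Over.map f).obj Y).left from A.obj.map g.left.op c)
      (show Grp A ((Over.map f).obj Y).left from a) (φ Y t)).trans (congrArg _ h2.symm)

theorem lift_app_mk {X : Over P.base} (t : P.torsor.Sec X) :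
    Hom.app (lift i f φ hnat hequiv) X (contractMk i P.torsor 0 t) = φ X t :=
  (liftNatTrans_mk i f φ hnat hequiv 0 t).trans
    (zero_vadd (Grp A ((Over.map f).obj X).left) (φ X t))

end Lift

theorem induced_hom_ext {P : BObj H} {Q : BObj A} {φ ψ : inducedObj i P ⟶ Q}
    (hb : Hom.base φ = Hom.base ψ)
    (h : ∀ (X : Over P.base) (t : P.torsor.Sec X)
      (e : (Over.map (Hom.base φ)).obj X ⟶ (Over.map (Hom.base ψ)).obj X), e.left = 𝟙 X.left →
      Q.torsor.sheaf.obj.map e.op (Hom.app ψ X (contractMk i P.torsor 0 t)) =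
        Hom.app φ X (contractMk i P.torsor 0 t)) : φ = ψ := by
  refine Hom.ext' hb fun X s e he => ?_
  refine contract_ext i P.torsor (isSheaf_pullback (Hom.base φ) Q.torsor.sheaf) s
    fun Y g a t e' => ?_
  have hY : ((Over.map (Hom.base φ)).obj Y).hom = ((Over.map (Hom.base ψ)).obj Y).hom := by
    exact congrArg (fun z => Y.hom ≫ z) hb
  let eY : (Over.map (Hom.base φ)).obj Y ⟶ (Over.map (Hom.base ψ)).obj Y :=
    Over.homMk (𝟙 Y.left) ((Category.id_comp _).trans hY.symm)
  have h1 : Q.torsor.sheaf.obj.map ((Over.map (Hom.base φ)).map g).op (Hom.app φ X s) =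
      Hom.app φ Y (contractMk i P.torsor a t) :=
    (Hom.naturality φ g s).symm.trans (congrArg _ e')
  have h2 : Q.torsor.sheaf.obj.map ((Over.map (Hom.base ψ)).map g).op (Hom.app ψ X s) =
      Hom.app ψ Y (contractMk i P.torsor a t) :=
    (Hom.naturality ψ g s).symm.trans (congrArg _ e')
  refine Eq.trans ?_ h1.symm
  refine (map_map_eq_map_map Q.torsor.sheaf.obj (g' := eY)
    (f' := (Over.map (Hom.base ψ)).map g) (by
      simp only [eY, he, Over.homMk_left]
      exact (Category.comp_id _).trans (Category.id_comp _).symm) _).trans ?_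
  rw [h2, contractMk_eq_vadd]
  refine (congrArg (Q.torsor.sheaf.obj.map eY.op) (Hom.map_vadd ψ Y a _)).trans ?_
  refine Eq.trans ?_ (Hom.map_vadd φ Y a _).symm
  refine (Q.torsor.map_vadd eY _ _).trans ?_
  rw [h Y t eY rfl]
  congr 1
  exact ConcreteCategory.congr_hom (A.obj.map_id _) a

/-- On morphisms, locally `(a, t) ↦ (a, φ t)`. -/
noncomputable def inducedMap {P Q : BObj H} (φ : P ⟶ Q) : inducedObj i P ⟶ inducedObj i Q :=
  lift i (Q := inducedObj i Q) (Hom.base φ)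
    (fun X t => contractMk i Q.torsor (X := (Over.map (Hom.base φ)).obj X) 0 (Hom.app φ X t))
    (fun X Y g t => by
      refine Eq.trans ?_ (contractMk_map i Q.torsor _ _ _).symm
      rw [map_zero, Hom.naturality φ]
      rfl)
    (fun X h t => by
      rw [Hom.map_vadd φ]
      exact contractMk_zero_vadd i Q.torsor _ _)

theorem inducedMap_app_mk {P Q : BObj H} (φ : P ⟶ Q) {X : Over P.base} (t : P.torsor.Sec X) :
    Hom.app (inducedMap i φ) X (contractMk i P.torsor 0 t) =
      contractMk i Q.torsor (X := (Over.map (Hom.base φ)).obj X) 0 (Hom.app φ X t) :=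
  lift_app_mk i _ _ _ _ t

/-- The functor `B H → B A` induced by `i : H ⟶ A`, taking `T` to its contraction product with `A`. -/
noncomputable def induced : BObj H ⥤ BObj A where
  obj := inducedObj i
  map := inducedMap i
  map_id P := by
    refine induced_hom_ext i rfl fun X t e he => ?_
    refine Eq.trans ?_ (inducedMap_app_mk i (𝟙 P) t).symm
    refine (congrArg ((contractSheaf i P.torsor).obj.map e.op)
      (contractMk_map i P.torsor _ 0 t)).trans ((contractMk_map i P.torsor e _ _).trans ?_)
    rw [map_zero, map_zero]
    exact congrArg _ (map_eq_map_map P.torsor.sheaf.obj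
      (by exact (Category.id_comp (𝟙 X.left)).symm.trans (congrArg (fun z => z ≫ _) he).symm) _).symm
  map_comp {P Q R} φ ψ := by
    refine induced_hom_ext i rfl fun X t e he => ?_
    refine Eq.trans ?_ (inducedMap_app_mk i (φ ≫ ψ) t).symm
    have h1 : Hom.app (inducedMap i ψ) _ (Hom.app (inducedMap i φ) X
        (contractMk i P.torsor 0 t)) = contractMk i R.torsor
          (X := (Over.map (Hom.base ψ)).obj ((Over.map (Hom.base φ)).obj X)) 0
            (Hom.app ψ _ (Hom.app φ X t)) :=
      (congrArg _ (inducedMap_app_mk i φ t)).trans (inducedMap_app_mk i ψ _)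
    refine (congrArg (fun z => (contractSheaf i R.torsor).obj.map e.op
      ((contractSheaf i R.torsor).obj.map (Quiver.Hom.op _) z)) h1).trans ?_
    refine (congrArg ((contractSheaf i R.torsor).obj.map e.op)
      (contractMk_map i R.torsor _ 0 _)).trans ((contractMk_map i R.torsor e _ _).trans ?_)
    rw [map_zero, map_zero]
    exact congrArg _ (map_eq_map_map R.torsor.sheaf.obj
      (by exact (Category.id_comp (𝟙 X.left)).symm.trans (congrArg (fun z => z ≫ _) he).symm) _).symm

end BObj

namespace Torsor

variable {A H : Sheaf J AddCommGrpCat.{max u v}} {S : C} (i : H ⟶ A) (T : Torsor H S) (n : ℕ)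

/-- The map from `T^n` to the `n`-th power of the contraction product, induced by `t ↦ (0, t)`. -/
noncomputable def powerContract : (T.power n).obj ⟶ ((contract i T).power n).obj :=
  T.powerLift n ((contract i T).power n).property
    (fun _ x => (contract i T).powerMk n fun j => contractMk i T 0 (x j))
    (fun X Y f x => by
      refine ((contract i T).powerMk_map n f _).trans ?_
      refine congrArg _ (funext fun j => (contractMk_map i T f 0 (x j)).trans ?_)
      rw [map_zero])
    (fun X a x ha => by
      refine (congrArg _ (funext fun j => contractMk_zero_vadd i T (a j) (x j))).trans
        ((contract i T).powerMk_vadd n (fun j => grpMap i (a j)) ?_ _)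
      rw [← map_sum, ha, map_zero])

theorem powerContract_mk {X : Over S} (x : Fin n → T.Sec X) :
    (powerContract i T n).app (op X) (T.powerMk n x) =
      (contract i T).powerMk n fun j => contractMk i T 0 (x j) :=
  T.powerLift_mk n _ _ _ _ x

/-- The global section of the `n`-th power of the contraction product that is induced by the canonical
section of `T^n`. Locally it is `((0, t), …, (0, t))`, see `contractSection_map`. -/
noncomputable def contractSection (hH : ∀ (U : C) (a : Grp H U), n • a = 0) :
    ((contract i T).power n).obj.obj (op (Over.mk (𝟙 S))) :=
  (powerContract i T n).app (op (Over.mk (𝟙 S))) (T.canonicalSection n hH)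

theorem contractSection_map (hH : ∀ (U : C) (a : Grp H U), n • a = 0) {X : Over S}
    (t : T.Sec X) :
    ((contract i T).power n).obj.map (toTop X).op (contractSection i T n hH) =
      (contract i T).powerMk n fun _ => contractMk i T 0 t :=
  (NatTrans.naturality_apply (powerContract i T n) (toTop X).op _).symm.trans
    ((congrArg _ (T.canonicalSection_map n hH t)).trans (powerContract_mk i T n _))

end Torsor

/-- An `A[n]`-torsor `T` gives the contraction product of `A` and `T` over `A[n]`, together with the
section of its `n`-th power coming from the canonical section of `T^n`. -/
noncomputable def torsionToPowObj (A : Sheaf J AddCommGrpCat.{max u v}) (n : ℕ)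
    (P : BObj (torsion A n)) : BPowObj A n where
  toBObj := (BObj.induced (torsionIncl A n)).obj P
  sec := Torsor.contractSection (torsionIncl A n) P.torsor n (nsmul_torsion A n)

theorem preservesSec_induced (A : Sheaf J AddCommGrpCat.{max u v}) (n : ℕ)
    {P Q : BObj (torsion A n)} (φ : P ⟶ Q) :
    BPowObj.PreservesSec (P := torsionToPowObj A n P) (Q := torsionToPowObj A n Q)
      ((BObj.induced (torsionIncl A n)).map φ) := by
  obtain ⟨R, hR, hne⟩ := P.torsor.locally_nonempty (Over.mk (𝟙 P.base))
  refine sheaf_ext (BObj.isSheaf_pullback (BObj.Hom.base φ)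
    ((torsionToPowObj A n Q).torsor.power n)) hR fun Y f hf => ?_
  obtain ⟨t⟩ := hne f hf
  obtain rfl : f = toTop Y := by
    ext
    exact (Category.comp_id _).symm.trans (Over.w f)
  refine (NatTrans.naturality_apply (BObj.powerMap ((BObj.induced (torsionIncl A n)).map φ) n)
    (toTop Y).op _).symm.trans ?_
  refine (congrArg _ (Torsor.contractSection_map (torsionIncl A n) P.torsor n
    (nsmul_torsion A n) t)).trans ?_
  refine (BObj.powerMap_mk ((BObj.induced (torsionIncl A n)).map φ) n _).trans ?_
  refine Eq.trans ?_ (map_toTop ((torsionToPowObj A n Q).torsor.power n).obj _ _).symm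
  refine Eq.trans ?_ (Torsor.contractSection_map (torsionIncl A n) Q.torsor n
    (nsmul_torsion A n) (X := (Over.map (BObj.Hom.base φ)).obj Y) (BObj.Hom.app φ Y t)).symm
  exact congrArg _ (funext fun _ => BObj.inducedMap_app_mk (torsionIncl A n) φ t)

/-- The functor underlying the natural map `B A[n] → B_n A`. -/
noncomputable def torsionToPow (A : Sheaf J AddCommGrpCat.{max u v}) (n : ℕ) :
    BObj (torsion A n) ⥤ BPowObj A n where
  obj := torsionToPowObj A n
  map φ := ⟨(BObj.induced (torsionIncl A n)).map φ, preservesSec_induced A n φ⟩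
  map_id P := BPowObj.Hom.ext ((BObj.induced (torsionIncl A n)).map_id P)
  map_comp φ ψ := BPowObj.Hom.ext ((BObj.induced (torsionIncl A n)).map_comp φ ψ)

/-- The classifying stack `B A`, as a category over the site. -/
def classifyingStack (A : Sheaf J AddCommGrpCat.{max u v}) : BasedCategory C :=
  .ofFunctor (BObj.proj A)

/-- `B_n A`, as a category over the site. -/
def powClassifyingStack (A : Sheaf J AddCommGrpCat.{max u v}) (n : ℕ) : BasedCategory C :=
  .ofFunctor (BPowObj.proj A n)

/-- The natural map `B A[n] → B_n A`, as a functor over the site. -/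
noncomputable def naturalMap (A : Sheaf J AddCommGrpCat.{max u v}) (n : ℕ) :
    BasedFunctor (classifyingStack (torsion A n)) (powClassifyingStack A n) where
  toFunctor := torsionToPow A n
  w := rfl

/-- Multiplication by `n` on `A`. -/
def mulBy (A : Sheaf J AddCommGrpCat.{max u v}) (n : ℕ) : A ⟶ A :=
  ObjectProperty.homMk
    { app := fun U => AddCommGrpCat.ofHom (nsmulAddMonoidHom n)
      naturality := fun U V f => by
        ext a
        exact (map_nsmul (A.obj.map f).hom n a).symm }

/-- A category over a site is a stack (in groupoids): it is fibred, with fibres that are groupoids;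
morphisms form a sheaf (`glue_hom`: a compatible family of morphisms defined on the pullbacks of `a`
along the members of a covering sieve comes from a unique morphism); and descent data relative to a
covering sieve, i.e. functors over the site from the sieve to the stack, are effective. -/
structure IsStack (J : GrothendieckTopology C) (𝒳 : BasedCategory.{v', u'} C) : Prop where
  isFibered : 𝒳.p.IsFibered
  isIso_of_isHomLift_id : ∀ ⦃S : C⦄ ⦃a b : 𝒳.obj⦄ (φ : a ⟶ b), 𝒳.p.IsHomLift (𝟙 S) φ → IsIso φ
  glue_hom : ∀ ⦃a b : 𝒳.obj⦄ (f : 𝒳.p.obj a ⟶ 𝒳.p.obj b) (R : Sieve (𝒳.p.obj a)),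
    R ∈ J (𝒳.p.obj a) →
    ∀ ψ : ∀ ⦃c : 𝒳.obj⦄ (φ : c ⟶ a), R (𝒳.p.map φ) → (c ⟶ b),
      (∀ ⦃c : 𝒳.obj⦄ (φ : c ⟶ a) (h : R (𝒳.p.map φ)), 𝒳.p.map (ψ φ h) = 𝒳.p.map φ ≫ f) →
      (∀ ⦃c c' : 𝒳.obj⦄ (χ : c' ⟶ c) (φ : c ⟶ a) (h : R (𝒳.p.map φ))
        (h' : R (𝒳.p.map (χ ≫ φ))), ψ (χ ≫ φ) h' = χ ≫ ψ φ h) →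
      ∃! θ : a ⟶ b, 𝒳.p.map θ = f ∧
        ∀ ⦃c : 𝒳.obj⦄ (φ : c ⟶ a) (h : R (𝒳.p.map φ)), φ ≫ θ = ψ φ h
  effective_descent : ∀ ⦃S : C⦄ (R : Sieve S), R ∈ J S →
    ∀ D : BasedFunctor (BasedCategory.ofFunctor R.arrows.diagram) 𝒳,
      ∃ (a : 𝒳.obj) (ε : ∀ g : R.arrows.category, D.obj g ⟶ a), 𝒳.p.obj a = S ∧
        (∀ g : R.arrows.category, 𝒳.p.IsHomLift g.obj.hom (ε g)) ∧
        ∀ ⦃g g' : R.arrows.category⦄ (u : g ⟶ g'), D.map u ≫ ε g' = ε g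

/-- A functor over the base is an equivalence: it has an inverse over the base, up to isomorphisms over
the base. -/
def IsEquivalenceOver {𝒳 : BasedCategory.{v', u'} C} {𝒴 : BasedCategory.{v', u'} C}
    (F : BasedFunctor 𝒳 𝒴) : Prop :=
  ∃ G : BasedFunctor 𝒴 𝒳,
    Nonempty (F.comp G ≅ BasedFunctor.id 𝒳) ∧ Nonempty (G.comp F ≅ BasedFunctor.id 𝒴)

end TorsorStack

/-! The inverse functor takes roots. Given an `A`-torsor `T` and a section `λ` of `T^n`, the local
sections `t` of `T` with `(t, …, t) = λ` form a subsheaf of `T`. Two tuples `(t_i)` and `(a_i +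
t_i)` have the same class in `T^n` exactly when `∑ a_i = 0` (`powMk_vadd`,
`sum_eq_zero_of_powMk_eq`). Hence two roots differ by some `a` with `n • a = 0`, and translating a
root by such an `a` gives a root: `A[n]` acts simply transitively on roots. Roots exist locally
(`exists_cover_isRoot`): locally `λ` is a tuple `(x_j) = (a_j + x_0)`, surjectivity of
multiplication by `n` gives, after refinement, `b` with `n • b = ∑ a_j`, and `b + x_0` is a root.

For an `A[n]`-torsor, `t ↦ (0, t)` maps it to the roots in its contraction product (`exists_unit`).
For `(T, λ)`, `(a, t) ↦ a + t` maps the contraction product of the torsor of roots to `T`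
(`exists_counit`). Both maps are natural and lie over identities, so they are invertible because the
fibres are groupoids.

For the stack properties, a morphism of torsors is bijective on sections (`on_bijective`), so every
morphism of `B A` is cartesian. Morphisms glue section by section. A torsor given over a covering
sieve extends to `S` as the sheaf of compatible families (`SieveTorsor.extend`), and descent data
give such a torsor. The induced maps on `T^n` are bijective as well (`powOn_bijective`), so a
section of the power pulls back uniquely along any morphism of torsors. The stack property of `B_n
A` then follows from that of `B A` and the sheaf property of `T^n`.

Sections are indexed by morphisms `f : Y ⟶ S`, and a composite is a free variable `f'` with an
equation `e`. Composites that agree only propositionally, such as `f ≫ 𝟙 S` and `f`, then need no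
transport. -/

namespace TorsorStack

variable {C : Type u} [Category.{v} C] {J : GrothendieckTopology C}

/-! ### Sections of a sheaf on `Over S`, indexed by morphisms to `S` -/

section SectionsOver

variable {S : C}

/-- The sections of a sheaf on `Over S` over a morphism `f : Y ⟶ S`. -/
def SecAt (F : Sheaf (J.over S) (Type (max u v))) {Y : C} (f : Y ⟶ S) : Type (max u v) :=
  F.obj.obj (op (Over.mk f))

namespace SecAt

variable {F : Sheaf (J.over S) (Type (max u v))}

/-- Restriction of sections along `g : Z ⟶ Y`. -/
def res {Y Z : C} {f : Y ⟶ S} {f' : Z ⟶ S} (g : Z ⟶ Y) (e : g ≫ f = f') (s : SecAt F f) :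
    SecAt F f' :=
  F.obj.map (Over.homMk (U := Over.mk f') (V := Over.mk f) g e).op s

theorem res_id {Y : C} {f : Y ⟶ S} {e : 𝟙 Y ≫ f = f} (s : SecAt F f) : res (𝟙 Y) e s = s :=
  ConcreteCategory.congr_hom (F.obj.map_id (op (Over.mk f))) s

theorem res_res {Y Z W : C} {f : Y ⟶ S} {f' : Z ⟶ S} {f'' : W ⟶ S} {g : Z ⟶ Y} {k : W ⟶ Z}
    (e : g ≫ f = f') (e' : k ≫ f' = f'') (s : SecAt F f) :
    res k e' (res g e s) = res (k ≫ g) (by rw [Category.assoc, e, e']) s :=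
  (map_eq_map_map F.obj (by rfl) s).symm

theorem res_congr {Y Z : C} {f : Y ⟶ S} {f' : Z ⟶ S} {g g' : Z ⟶ Y} (h : g = g')
    {e : g ≫ f = f'} {e' : g' ≫ f = f'} (s : SecAt F f) : res g e s = res g' e' s := by
  subst h; rfl

theorem res_eq_self {Y : C} {f : Y ⟶ S} {g : Y ⟶ Y} (h : g = 𝟙 Y) {e : g ≫ f = f}
    (s : SecAt F f) : res g e s = s := by
  subst h; exact res_id s

theorem ext {Y : C} {f : Y ⟶ S} {s t : SecAt F f} {R : Sieve Y} (hR : R ∈ J Y)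
    (h : ∀ ⦃Z : C⦄ (g : Z ⟶ Y) {f' : Z ⟶ S} (e : g ≫ f = f'), R g → res g e s = res g e t) :
    s = t :=
  sheaf_ext (X := Over.mk f) F.property (J.overEquiv_symm_mem_over (Over.mk f) R hR)
    fun _ g hg => h g.left (Over.w g) ((Sieve.overEquiv_symm_iff R g).1 hg)

/-- Since sections with property `P` are unique and stable under restriction, local choices are
automatically compatible. No compatible family has to be supplied. -/
theorem glue {Y : C} {f : Y ⟶ S}
    (P : ∀ ⦃Z : C⦄ (g : Z ⟶ Y) {f' : Z ⟶ S}, g ≫ f = f' → SecAt F f' → Prop)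
    (hres : ∀ ⦃Z W : C⦄ (g : Z ⟶ Y) (k : W ⟶ Z) {f' : Z ⟶ S} {f'' : W ⟶ S} (e : g ≫ f = f')
      (e' : k ≫ f' = f'') (e'' : (k ≫ g) ≫ f = f'') (s : SecAt F f'),
      P g e s → P (k ≫ g) e'' (res k e' s))
    (huniq : ∀ ⦃Z : C⦄ (g : Z ⟶ Y) {f' : Z ⟶ S} (e : g ≫ f = f') (s t : SecAt F f'),
      P g e s → P g e t → s = t)
    {R : Sieve Y} (hR : R ∈ J Y)
    (hex : ∀ ⦃Z : C⦄ (g : Z ⟶ Y) {f' : Z ⟶ S} (e : g ≫ f = f'), R g → ∃ s, P g e s) :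
    ∃ s : SecAt F f, ∀ ⦃Z : C⦄ (g : Z ⟶ Y) {f' : Z ⟶ S} (e : g ≫ f = f') (t : SecAt F f'),
      P g e t → res g e s = t := by
  obtain ⟨s, hs⟩ := sheaf_glue (X := Over.mk f) F.property
    (fun Z g t => P g.left (Over.w g) t)
    (fun Z W g k t h => hres _ k.left (Over.w g) (Over.w k) (Over.w (k ≫ g)) _ h)
    (fun Z g t t' h h' => huniq _ _ _ _ h h')
    (J.overEquiv_symm_mem_over (Over.mk f) R hR)
    (fun Z g hg => hex g.left (Over.w g) ((Sieve.overEquiv_symm_iff R g).1 hg))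
  exact ⟨s, fun Z g f' e t ht => hs (Over.homMk (U := Over.mk f') (V := Over.mk f) g e) t ht⟩

end SecAt

end SectionsOver

/-! ### Local-to-global principles for sections of `A` -/

theorem Grp.ext_of_cover {A : Sheaf J AddCommGrpCat.{max u v}} {Y : C} {a b : Grp A Y}
    {R : Sieve Y} (hR : R ∈ J Y)
    (h : ∀ ⦃Z : C⦄ (g : Z ⟶ Y), R g → A.obj.map g.op a = A.obj.map g.op b) : a = b :=
  sheaf_ext (isSheaf_forget A) hR h

theorem Grp.map_map {A : Sheaf J AddCommGrpCat.{max u v}} {Y Z W : C} (g : Z ⟶ Y) (k : W ⟶ Z)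
    (a : Grp A Y) : A.obj.map k.op (A.obj.map g.op a) = A.obj.map (k ≫ g).op a :=
  (ConcreteCategory.congr_hom (A.obj.map_comp g.op k.op) a).symm

theorem Grp.map_id {A : Sheaf J AddCommGrpCat.{max u v}} {Y : C} (a : Grp A Y) :
    A.obj.map (𝟙 Y).op a = a :=
  ConcreteCategory.congr_hom (A.obj.map_id (op Y)) a

theorem Grp.glue {A : Sheaf J AddCommGrpCat.{max u v}} {Y : C}
    (P : ∀ ⦃Z : C⦄, (Z ⟶ Y) → Grp A Z → Prop)
    (hres : ∀ ⦃Z W : C⦄ (g : Z ⟶ Y) (k : W ⟶ Z) (a : Grp A Z),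
      P g a → P (k ≫ g) (A.obj.map k.op a))
    (huniq : ∀ ⦃Z : C⦄ (g : Z ⟶ Y) (a b : Grp A Z), P g a → P g b → a = b)
    {R : Sieve Y} (hR : R ∈ J Y) (hex : ∀ ⦃Z : C⦄ (g : Z ⟶ Y), R g → ∃ a, P g a) :
    ∃ a : Grp A Y, ∀ ⦃Z : C⦄ (g : Z ⟶ Y) (b : Grp A Z), P g b → A.obj.map g.op a = b :=
  sheaf_glue (isSheaf_forget A) P hres huniq hR hex

/-! ### Torsors and their contraction powers on sections -/

namespace Torsor

variable {A : Sheaf J AddCommGrpCat.{max u v}} {S : C} (T : Torsor A S)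

instance {Y : C} (f : Y ⟶ S) : AddAction (Grp A Y) (SecAt T.sheaf f) :=
  T.act (Over.mk f)

variable {T}

theorem res_vadd {Y Z : C} {f : Y ⟶ S} {f' : Z ⟶ S} (g : Z ⟶ Y) (e : g ≫ f = f')
    (a : Grp A Y) (s : SecAt T.sheaf f) :
    SecAt.res g e (a +ᵥ s) = A.obj.map g.op a +ᵥ SecAt.res g e s :=
  T.map_vadd (Over.homMk (U := Over.mk f') (V := Over.mk f) g e) a s

theorem secAt_vadd_cancel {Y : C} {f : Y ⟶ S} {a b : Grp A Y} {s : SecAt T.sheaf f}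
    (h : a +ᵥ s = b +ᵥ s) : a = b :=
  T.vadd_cancel (X := Over.mk f) h

theorem secAt_exists_vadd_eq {Y : C} {f : Y ⟶ S} (s t : SecAt T.sheaf f) :
    ∃ a : Grp A Y, a +ᵥ s = t :=
  T.exists_vadd_eq (X := Over.mk f) s t

theorem exists_cover_nonempty (T : Torsor A S) {Y : C} (f : Y ⟶ S) :
    ∃ R ∈ J Y, ∀ ⦃Z : C⦄ (g : Z ⟶ Y) {f' : Z ⟶ S}, g ≫ f = f' → R g →
      Nonempty (SecAt T.sheaf f') := by
  obtain ⟨R, hR, h⟩ := T.locally_nonempty (Over.mk f)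
  refine ⟨_, (J.mem_over_iff R).1 hR, fun Z g f' e hg => ?_⟩
  subst e
  exact h _ ((Sieve.overEquiv_iff R g).1 hg)

variable (T)

/-- The section of `T^n` over `f` given by a tuple of sections of `T`. -/
noncomputable def powMk (n : ℕ) {Y : C} {f : Y ⟶ S} (x : Fin n → SecAt T.sheaf f) :
    SecAt (T.power n) f :=
  T.powerMk n (X := Over.mk f) x

variable {T}

theorem powMk_res {n : ℕ} {Y Z : C} {f : Y ⟶ S} {f' : Z ⟶ S} (g : Z ⟶ Y) (e : g ≫ f = f')
    (x : Fin n → SecAt T.sheaf f) :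
    SecAt.res g e (T.powMk n x) = T.powMk n fun i => SecAt.res g e (x i) :=
  T.powerMk_map n (Over.homMk (U := Over.mk f') (V := Over.mk f) g e) x

theorem powMk_vadd {n : ℕ} {Y : C} {f : Y ⟶ S} (a : Fin n → Grp A Y) (ha : ∑ i, a i = 0)
    (x : Fin n → SecAt T.sheaf f) : T.powMk n (fun i => a i +ᵥ x i) = T.powMk n x :=
  T.powerMk_vadd n (X := Over.mk f) a ha x

theorem exists_cover_powMk {n : ℕ} {Y : C} {f : Y ⟶ S} (s : SecAt (T.power n) f) :
    ∃ R ∈ J Y, ∀ ⦃Z : C⦄ (g : Z ⟶ Y) {f' : Z ⟶ S} (e : g ≫ f = f'), R g →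
      ∃ x : Fin n → SecAt T.sheaf f', SecAt.res g e s = T.powMk n x := by
  obtain ⟨R, hR, h⟩ := T.power_locally_mk n (X := Over.mk f) s
  refine ⟨_, (J.mem_over_iff R).1 hR, fun Z g f' e hg => ?_⟩
  subst e
  exact h _ ((Sieve.overEquiv_iff R g).1 hg)

/-- Equality in the quotient sheaf means that, locally, the tuples are related by some `b` with `∑
b_i = 0`. Freeness of the action forces `b_i = -a_i`, so the sum vanishes locally, hence globally.
This is the converse of `powMk_vadd`. -/
theorem sum_eq_zero_of_powMk_eq {n : ℕ} {Y : C} {f : Y ⟶ S} {a : Fin n → Grp A Y}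
    {x : Fin n → SecAt T.sheaf f} (h : T.powMk n (fun i => a i +ᵥ x i) = T.powMk n x) :
    ∑ i, a i = 0 := by
  obtain ⟨R, hR, h⟩ := sheafify_locally_eq (K := J.over S) (T.powerPresheaf n) h
  refine Grp.ext_of_cover ((J.mem_over_iff R).1 hR) fun Z g hg => ?_
  obtain ⟨b, hb, h⟩ := Quotient.exact (s := T.powerSetoid n _)
    (h _ ((Sieve.overEquiv_iff R g).1 hg))
  rw [map_zero, map_sum]
  have key : ∀ i, A.obj.map g.op (a i) = - b i := fun i => by
    have h1 : (SecAt.res g (by rfl) (x i) : SecAt T.sheaf (g ≫ f)) =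
      b i +ᵥ SecAt.res g (by rfl) (a i +ᵥ x i) := congrFun h i
    rw [res_vadd, vadd_vadd] at h1
    have h2 := secAt_vadd_cancel ((zero_vadd (Grp A Z) _).trans h1)
    exact (neg_eq_of_add_eq_zero_right h2.symm).symm
  rw [Finset.sum_congr rfl fun i _ => key i, Finset.sum_neg_distrib]
  exact neg_eq_zero.2 hb

end Torsor

/-! ### Morphisms of torsors on sections -/

/-- The map on sections over `f` given by a map from `F` to the restriction of `G` along `b`. -/
def SecAt.map {S S' : C} {b : S ⟶ S'} {F : Sheaf (J.over S) (Type (max u v))}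
    {G : Sheaf (J.over S') (Type (max u v))} (α : F.obj ⟶ (Over.map b).op ⋙ G.obj) {Y : C}
    {f : Y ⟶ S} {f' : Y ⟶ S'} (e : f ≫ b = f') (s : SecAt F f) : SecAt G f' :=
  SecAt.res (f := f ≫ b) (𝟙 Y) (by simpa using e) (α.app (op (Over.mk f)) s)

theorem SecAt.map_res {S S' : C} {b : S ⟶ S'} {F : Sheaf (J.over S) (Type (max u v))}
    {G : Sheaf (J.over S') (Type (max u v))} (α : F.obj ⟶ (Over.map b).op ⋙ G.obj) {Y Z : C}
    {f : Y ⟶ S} {f' : Y ⟶ S'} (e : f ≫ b = f') {k : Z ⟶ S} (g : Z ⟶ Y) (eg : g ≫ f = k)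
    {k' : Z ⟶ S'} (e' : k ≫ b = k') (s : SecAt F f) :
    SecAt.map α e' (SecAt.res g eg s) =
      SecAt.res g (by rw [← e, ← e', ← eg, Category.assoc]) (SecAt.map α e s) := by
  subst e e' eg
  have := NatTrans.naturality_apply α (Over.homMk (U := Over.mk (g ≫ f)) (V := Over.mk f) g).op s
  refine (SecAt.res_id _).trans (this.trans ?_)
  refine Eq.trans ?_ (congrArg _ (SecAt.res_id _).symm)
  rfl

theorem SecAt.map_app {S S' : C} {b : S ⟶ S'} {F : Sheaf (J.over S) (Type (max u v))}
    {G : Sheaf (J.over S') (Type (max u v))} (α : F.obj ⟶ (Over.map b).op ⋙ G.obj) {Y : C}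
    {f : Y ⟶ S} (s : SecAt F f) : SecAt.map α (f := f) rfl s = α.app (op (Over.mk f)) s :=
  SecAt.res_id _

namespace BObj

variable {A : Sheaf J AddCommGrpCat.{max u v}} {P Q R : BObj A}

namespace Hom

/-- The map of sheaves underlying a morphism of torsors. -/
def natTrans (φ : P ⟶ Q) :
    P.torsor.sheaf.obj ⟶ (Over.map (Hom.base φ)).op ⋙ Q.torsor.sheaf.obj where
  app X := TypeCat.ofHom (Hom.app φ X.unop)
  naturality X Y f := by
    ext s
    exact Hom.naturality φ f.unop s

/-- The map on sections over `f` given by a morphism of torsors. -/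
def on (φ : P ⟶ Q) {Y : C} {f : Y ⟶ P.base} {f' : Y ⟶ Q.base} (e : f ≫ Hom.base φ = f')
    (s : SecAt P.torsor.sheaf f) : SecAt Q.torsor.sheaf f' :=
  SecAt.map (natTrans φ) e s

theorem on_res (φ : P ⟶ Q) {Y Z : C} {f : Y ⟶ P.base} {f' : Y ⟶ Q.base}
    (e : f ≫ Hom.base φ = f') {k : Z ⟶ P.base} (g : Z ⟶ Y) (eg : g ≫ f = k)
    {k' : Z ⟶ Q.base} (e' : k ≫ Hom.base φ = k') (s : SecAt P.torsor.sheaf f) :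
    on φ e' (SecAt.res g eg s) =
      SecAt.res g (by rw [← e, ← e', ← eg, Category.assoc]) (on φ e s) :=
  SecAt.map_res _ e g eg e' s

theorem on_rfl (φ : P ⟶ Q) {Y : C} {f : Y ⟶ P.base} (s : SecAt P.torsor.sheaf f) :
    on φ rfl s = Hom.app φ (Over.mk f) s :=
  SecAt.map_app _ s

theorem on_vadd (φ : P ⟶ Q) {Y : C} {f : Y ⟶ P.base} {f' : Y ⟶ Q.base}
    (e : f ≫ Hom.base φ = f') (a : Grp A Y) (s : SecAt P.torsor.sheaf f) :
    on φ e (a +ᵥ s) = a +ᵥ on φ e s := by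
  subst e
  rw [on_rfl, on_rfl]
  exact Hom.map_vadd φ (Over.mk f) a s

theorem base_comp (φ : P ⟶ Q) (ψ : Q ⟶ R) :
    Hom.base (φ ≫ ψ) = Hom.base φ ≫ Hom.base ψ := rfl

theorem on_id {Y : C} {f : Y ⟶ P.base} (e : f ≫ Hom.base (𝟙 P) = f) (s : SecAt P.torsor.sheaf f) :
    on (𝟙 P) e s = s :=
  (SecAt.res_res (f := f) (f' := f ≫ 𝟙 P.base) (g := 𝟙 Y) (k := 𝟙 Y)
    (by simp) (by simp) s).trans
    (SecAt.res_eq_self (by simp) s)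

theorem on_comp (φ : P ⟶ Q) (ψ : Q ⟶ R) {Y : C} {f : Y ⟶ P.base} {f' : Y ⟶ Q.base}
    {f'' : Y ⟶ R.base} (e : f ≫ Hom.base φ = f') (e' : f' ≫ Hom.base ψ = f'')
    (e'' : f ≫ Hom.base (φ ≫ ψ) = f'') (s : SecAt P.torsor.sheaf f) :
    on (φ ≫ ψ) e'' s = on ψ e' (on φ e s) := by
  subst e e'
  rw [on_rfl, on_rfl]
  refine (SecAt.res_res (f := (f ≫ Hom.base φ) ≫ Hom.base ψ) (f' := f ≫ Hom.base (φ ≫ ψ))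
    (g := 𝟙 Y) (k := 𝟙 Y) (by simpa using e''.symm) (by simpa using e'') _).trans
      (SecAt.res_eq_self (by simp) _)

theorem ext_on {φ ψ : P ⟶ Q} (hb : Hom.base φ = Hom.base ψ)
    (h : ∀ ⦃Y : C⦄ (f : Y ⟶ P.base) (f' : Y ⟶ Q.base) (e : f ≫ Hom.base φ = f')
      (e' : f ≫ Hom.base ψ = f') (s : SecAt P.torsor.sheaf f), on φ e s = on ψ e' s) : φ = ψ := by
  refine Hom.ext' hb fun X t e he => ?_
  have := (on_rfl φ (f := X.hom) t).symm.trans (h X.hom _ rfl (by rw [hb]) t)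
  refine Eq.trans ?_ this.symm
  refine congrArg (fun g => Q.torsor.sheaf.obj.map (Quiver.Hom.op g) (Hom.app ψ X t)) ?_
  ext
  exact he

/-- A morphism of torsors over `b`, given by equivariant maps on sections that are compatible with
restriction. -/
def mk' (b : P.base ⟶ Q.base)
    (on : ∀ ⦃Y : C⦄ (f : Y ⟶ P.base) (f' : Y ⟶ Q.base), f ≫ b = f' →
      SecAt P.torsor.sheaf f → SecAt Q.torsor.sheaf f')
    (on_res : ∀ ⦃Y Z : C⦄ (f : Y ⟶ P.base) (f' : Y ⟶ Q.base) (e : f ≫ b = f') (k : Z ⟶ P.base)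
      (k' : Z ⟶ Q.base) (e' : k ≫ b = k') (g : Z ⟶ Y) (eg : g ≫ f = k) (eg' : g ≫ f' = k')
      (s : SecAt P.torsor.sheaf f),
      on k k' e' (SecAt.res g eg s) = SecAt.res g eg' (on f f' e s))
    (on_vadd : ∀ ⦃Y : C⦄ (f : Y ⟶ P.base) (f' : Y ⟶ Q.base) (e : f ≫ b = f') (a : Grp A Y)
      (s : SecAt P.torsor.sheaf f), on f f' e (a +ᵥ s) = a +ᵥ on f f' e s) : P ⟶ Q where
  base := b
  app X s := on X.hom _ rfl s
  naturality X Y f s := on_res X.hom _ rfl Y.hom _ rfl f.left (Over.w f)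
    (Over.w ((Over.map b).map f)) s
  map_vadd X a s := on_vadd X.hom _ rfl a s

/-- Existential form of `mk'`: the base becomes an equation that can be eliminated, and only the
values on sections remain visible. -/
theorem exists_hom (b : P.base ⟶ Q.base)
    (l : ∀ ⦃Y : C⦄ (f : Y ⟶ P.base) (f' : Y ⟶ Q.base), f ≫ b = f' →
      SecAt P.torsor.sheaf f → SecAt Q.torsor.sheaf f')
    (l_res : ∀ ⦃Y Z : C⦄ (f : Y ⟶ P.base) (f' : Y ⟶ Q.base) (e : f ≫ b = f') (k : Z ⟶ P.base)
      (k' : Z ⟶ Q.base) (e' : k ≫ b = k') (g : Z ⟶ Y) (eg : g ≫ f = k) (eg' : g ≫ f' = k')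
      (s : SecAt P.torsor.sheaf f),
      l k k' e' (SecAt.res g eg s) = SecAt.res g eg' (l f f' e s))
    (l_vadd : ∀ ⦃Y : C⦄ (f : Y ⟶ P.base) (f' : Y ⟶ Q.base) (e : f ≫ b = f') (a : Grp A Y)
      (s : SecAt P.torsor.sheaf f), l f f' e (a +ᵥ s) = a +ᵥ l f f' e s) :
    ∃ φ : P ⟶ Q, Hom.base φ = b ∧ ∀ ⦃Y : C⦄ (f : Y ⟶ P.base) (f' : Y ⟶ Q.base) (e : f ≫ b = f')
      (e' : f ≫ Hom.base φ = f') (s : SecAt P.torsor.sheaf f), on φ e' s = l f f' e s := by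
  refine ⟨mk' b l l_res l_vadd, rfl, fun Y f f' e e' s => ?_⟩
  subst e
  exact on_rfl _ s

/-- Two sections over the same `f` differ by an element of `A`, which equivariance preserves.
Freeness in the target makes it zero. -/
theorem on_injective (φ : P ⟶ Q) {Y : C} {f : Y ⟶ P.base} {f' : Y ⟶ Q.base}
    (e : f ≫ Hom.base φ = f') : Function.Injective (on φ e) := fun s t h => by
  obtain ⟨a, rfl⟩ := Torsor.secAt_exists_vadd_eq s t
  rw [on_vadd] at h
  rw [← Torsor.secAt_vadd_cancel ((zero_vadd (Grp A Y) _).trans h), zero_vadd]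

/-- Wherever the source has a section, a translate of it hits the given section, by transitivity in
the target. Injectivity makes these local preimages unique, so they glue. -/
theorem on_bijective (φ : P ⟶ Q) {Y : C} {f : Y ⟶ P.base} {f' : Y ⟶ Q.base}
    (e : f ≫ Hom.base φ = f') : Function.Bijective (on φ e) := by
  refine ⟨on_injective φ e, fun t => ?_⟩
  subst e
  obtain ⟨R, hR, h⟩ := P.torsor.exists_cover_nonempty f
  have key : ∀ ⦃Z : C⦄ (g : Z ⟶ Y) {k : Z ⟶ P.base} (e : g ≫ f = k), R g →
      ∃ s : SecAt P.torsor.sheaf k,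
        on φ (f' := g ≫ f ≫ base φ) (by rw [← e, Category.assoc]) s = SecAt.res g rfl t := by
    intro Z g k e hg
    obtain ⟨s⟩ := h g e hg
    obtain ⟨a, ha⟩ := Torsor.secAt_exists_vadd_eq
      (on φ (f' := g ≫ f ≫ base φ) (by rw [← e, Category.assoc]) s) (SecAt.res g rfl t)
    exact ⟨a +ᵥ s, (on_vadd _ _ _ _).trans ha⟩
  obtain ⟨s, hs⟩ := SecAt.glue (F := P.torsor.sheaf) (f := f)
    (fun Z g k e s => on φ (f' := g ≫ f ≫ base φ) (by rw [← e, Category.assoc]) s =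
      SecAt.res g rfl t)
    (fun Z W g k f' f'' e e' e'' s h => by
      rw [on_res φ (f' := g ≫ f ≫ base φ) (by rw [← e, Category.assoc]), h, SecAt.res_res])
    (fun Z g f' e s t h h' => on_injective φ _ (h.trans h'.symm)) hR key
  refine ⟨s, SecAt.ext hR fun Z g k e hg => ?_⟩
  subst e
  obtain ⟨r, hr⟩ := key g rfl hg
  rw [← hr, ← hs g rfl r hr, on_res]

end Hom

end BObj

/-! ### Cartesian morphisms, pullbacks and maps on contraction powers -/

namespace BObj

variable {A : Sheaf J AddCommGrpCat.{max u v}} {P Q R : BObj A}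

namespace Hom

/-- Every morphism of `B A` is cartesian. -/
theorem existsUnique_lift (φ : P ⟶ Q) (ψ : R ⟶ Q) (b : R.base ⟶ P.base)
    (hb : b ≫ Hom.base φ = Hom.base ψ) : ∃! χ : R ⟶ P, Hom.base χ = b ∧ χ ≫ φ = ψ := by
  -- The lift is `φ⁻¹ ∘ ψ` on sections. Its compatibility with restriction and with the action is
  -- checked after applying the injective map `φ`.
  have hex : ∀ ⦃Y : C⦄ (f : Y ⟶ R.base) (f' : Y ⟶ P.base) (_ : f ≫ b = f')
      (s : SecAt R.torsor.sheaf f), ∃ t : SecAt P.torsor.sheaf f',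
        ∀ e', on φ e' t = on ψ (rfl : f ≫ Hom.base ψ = _) s := by
    intro Y f f' e s
    obtain ⟨t, ht⟩ := (on_bijective φ (f := f') (f' := f ≫ Hom.base ψ)
      (by rw [← e, Category.assoc, hb])).2 (on ψ rfl s)
    exact ⟨t, fun _ => ht⟩
  choose l hl using hex
  have e0 : ∀ {Y : C} {f : Y ⟶ R.base} {f' : Y ⟶ P.base}, f ≫ b = f' →
      f' ≫ Hom.base φ = f ≫ Hom.base ψ := fun e => by rw [← e, Category.assoc, hb]
  obtain ⟨χ, rfl, hχ⟩ := Hom.exists_hom b l (fun Y Z f f' e k k' e' g eg eg' s => by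
      refine on_injective φ (e0 e') ?_
      rw [hl, on_res φ (e0 e), hl, on_res ψ rfl])
    (fun Y f f' e a s => by
      refine on_injective φ (e0 e) ?_
      rw [hl, on_vadd ψ, on_vadd φ, hl])
  refine ⟨χ, ⟨rfl, ?_⟩, ?_⟩
  · refine ext_on hb fun Y f f' e e' s => ?_
    subst e'
    rw [on_comp _ φ (f' := f ≫ base χ) rfl (e0 rfl), hχ _ _ rfl, hl]
  · rintro χ' ⟨h1, h2⟩
    refine ext_on h1 fun Y f f' e e' s => ?_
    refine on_injective φ (e0 e') ?_
    rw [hχ _ _ e', hl, ← on_comp χ' φ e (e0 e') (by rw [h2])]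
    simp only [h2]

end Hom

/-- The pullback of a torsor along a morphism of the base. -/
def pull (P : BObj A) {Y : C} (b : Y ⟶ P.base) : BObj A where
  base := Y
  torsor :=
    { sheaf := (J.overMapPullback (Type (max u v)) b).obj P.torsor.sheaf
      act := fun X => P.torsor.act ((Over.map b).obj X)
      map_vadd := fun _ _ g a t => P.torsor.map_vadd ((Over.map b).map g) a t
      simply_transitive := fun X => P.torsor.simply_transitive ((Over.map b).obj X)
      locally_nonempty := fun X => by
        obtain ⟨R, hR, h⟩ := P.torsor.exists_cover_nonempty (X.hom ≫ b)
        refine ⟨_, J.overEquiv_symm_mem_over X R hR, fun Z g hg => ?_⟩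
        exact h g.left (Over.w ((Over.map b).map g)) ((Sieve.overEquiv_symm_iff R g).1 hg) }

/-- The projection from a pullback. -/
def pullHom (P : BObj A) {Y : C} (b : Y ⟶ P.base) : pull P b ⟶ P where
  base := b
  app _ t := t
  naturality _ _ _ _ := rfl
  map_vadd _ _ _ := rfl

namespace Hom

/-- The map on sections of the `n`-th powers over `f` given by a morphism of torsors. -/
noncomputable def powOn (φ : P ⟶ Q) (n : ℕ) {Y : C} {f : Y ⟶ P.base} {f' : Y ⟶ Q.base}
    (e : f ≫ Hom.base φ = f') (s : SecAt (P.torsor.power n) f) : SecAt (Q.torsor.power n) f' :=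
  SecAt.map (powerMap φ n) e s

variable {n : ℕ}

theorem powOn_res (φ : P ⟶ Q) {Y Z : C} {f : Y ⟶ P.base} {f' : Y ⟶ Q.base}
    (e : f ≫ Hom.base φ = f') {k : Z ⟶ P.base} (g : Z ⟶ Y) (eg : g ≫ f = k)
    {k' : Z ⟶ Q.base} (e' : k ≫ Hom.base φ = k') (s : SecAt (P.torsor.power n) f) :
    powOn φ n e' (SecAt.res g eg s) =
      SecAt.res g (by rw [← e, ← e', ← eg, Category.assoc]) (powOn φ n e s) :=
  SecAt.map_res _ e g eg e' s

theorem powOn_powMk (φ : P ⟶ Q) {Y : C} {f : Y ⟶ P.base} {f' : Y ⟶ Q.base}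
    (e : f ≫ Hom.base φ = f') (x : Fin n → SecAt P.torsor.sheaf f) :
    powOn φ n e (P.torsor.powMk n x) = Q.torsor.powMk n fun i => on φ e (x i) := by
  subst e
  refine (SecAt.map_app _ _).trans ((powerMap_mk φ n _).trans ?_)
  exact congrArg _ (funext fun i => (on_rfl φ (x i)).symm)

theorem powOn_comp (φ : P ⟶ Q) (ψ : Q ⟶ R) {Y : C} {f : Y ⟶ P.base} {f' : Y ⟶ Q.base}
    {f'' : Y ⟶ R.base} (e : f ≫ Hom.base φ = f') (e' : f' ≫ Hom.base ψ = f'')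
    (e'' : f ≫ Hom.base (φ ≫ ψ) = f'') (s : SecAt (P.torsor.power n) f) :
    powOn (φ ≫ ψ) n e'' s = powOn ψ n e' (powOn φ n e s) := by
  subst e e'
  obtain ⟨T, hT, h⟩ := Torsor.exists_cover_powMk s
  refine SecAt.ext hT fun Z g k eg hg => ?_
  obtain ⟨x, hx⟩ := h g rfl hg
  subst eg
  have e3 : (g ≫ f) ≫ Hom.base (φ ≫ ψ) = g ≫ (f ≫ Hom.base φ) ≫ Hom.base ψ := by
    rw [← e'', Category.assoc]
  rw [← powOn_res (φ ≫ ψ) e'' g rfl e3,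
    ← powOn_res ψ rfl g (k := (g ≫ f) ≫ Hom.base φ) (by simp) (by simp),
    ← powOn_res φ rfl g rfl rfl, hx, powOn_powMk, powOn_powMk, powOn_powMk]
  exact congrArg _ (funext fun i => on_comp _ _ _ _ _ _)

/-- Locally both sections are tuples, differing by some `a_i`. Equality of the images gives `∑ a_i =
0`, and this already identifies the two tuples in the source. -/
theorem powOn_injective (φ : P ⟶ Q) {Y : C} {f : Y ⟶ P.base} {f' : Y ⟶ Q.base}
    (e : f ≫ Hom.base φ = f') : Function.Injective (powOn φ n e) := fun s t h => by
  obtain ⟨R, hR, hs⟩ := Torsor.exists_cover_powMk s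
  obtain ⟨R', hR', ht⟩ := Torsor.exists_cover_powMk t
  refine SecAt.ext (J.intersection_covering hR hR') fun Z g k eg hg => ?_
  obtain ⟨x, hx⟩ := hs g eg hg.1
  obtain ⟨y, hy⟩ := ht g eg hg.2
  have ek : k ≫ Hom.base φ = g ≫ f' := by rw [← e, ← eg, Category.assoc]
  have h' := congrArg (SecAt.res g rfl) h
  rw [← powOn_res φ e g eg ek, ← powOn_res φ e g eg ek, hx, hy, powOn_powMk, powOn_powMk] at h'
  choose a ha using fun i => Torsor.secAt_exists_vadd_eq (x i) (y i)
  obtain rfl : (fun i => a i +ᵥ x i) = y := funext ha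
  simp only [on_vadd] at h'
  rw [hx, hy, Torsor.powMk_vadd a (Torsor.sum_eq_zero_of_powMk_eq h'.symm)]

/-- Tuples lift entry by entry through `on_bijective`. Every section is locally a tuple, and
injectivity glues the local preimages. -/
theorem powOn_bijective (φ : P ⟶ Q) {Y : C} {f : Y ⟶ P.base} {f' : Y ⟶ Q.base}
    (e : f ≫ Hom.base φ = f') : Function.Bijective (powOn φ n e) := by
  refine ⟨powOn_injective φ e, fun t => ?_⟩
  subst e
  obtain ⟨R, hR, h⟩ := Torsor.exists_cover_powMk t
  have key : ∀ ⦃Z : C⦄ (g : Z ⟶ Y) {k : Z ⟶ P.base} (e : g ≫ f = k), R g →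
      ∃ s : SecAt (P.torsor.power n) k,
        powOn φ n (f' := g ≫ f ≫ base φ) (by rw [← e, Category.assoc]) s = SecAt.res g rfl t := by
    intro Z g k e hg
    obtain ⟨x, hx⟩ := h g rfl hg
    choose y hy using fun i => (on_bijective φ (f := k) (f' := g ≫ f ≫ base φ)
      (by rw [← e, Category.assoc])).2 (x i)
    refine ⟨P.torsor.powMk n y, ?_⟩
    rw [powOn_powMk, hx]
    exact congrArg _ (funext hy)
  obtain ⟨s, hs⟩ := SecAt.glue (F := P.torsor.power n) (f := f)
    (fun Z g k e s => powOn φ n (f' := g ≫ f ≫ base φ) (by rw [← e, Category.assoc]) s =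
      SecAt.res g rfl t)
    (fun Z W g k f' f'' e e' e'' s h => by
      rw [powOn_res φ (f' := g ≫ f ≫ base φ) (by rw [← e, Category.assoc]), h, SecAt.res_res])
    (fun Z g f' e s t h h' => powOn_injective φ _ (h.trans h'.symm)) hR key
  refine ⟨s, SecAt.ext hR fun Z g k e hg => ?_⟩
  subst e
  obtain ⟨r, hr⟩ := key g rfl hg
  rw [← hr, ← hs g rfl r hr, powOn_res]

end Hom

end BObj

/-! ### Compatibility with the sections of the powers -/

namespace BPowObj

open BObj

variable {A : Sheaf J AddCommGrpCat.{max u v}} {n : ℕ} {P Q R : BPowObj A n}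

/-- The restriction of the given section along `f`. -/
noncomputable def secAt (P : BPowObj A n) {Y : C} (f : Y ⟶ P.base) :
    SecAt (P.torsor.power n) f :=
  SecAt.res (f := 𝟙 P.base) f (Category.comp_id f) P.sec

theorem res_secAt (P : BPowObj A n) {Y Z : C} (f : Y ⟶ P.base) {f' : Z ⟶ P.base} (g : Z ⟶ Y)
    (e : g ≫ f = f') : SecAt.res g e (P.secAt f) = P.secAt f' :=
  (SecAt.res_res _ _ _).trans (SecAt.res_congr e _)

theorem secAt_id (P : BPowObj A n) : P.secAt (𝟙 P.base) = P.sec := SecAt.res_id _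

/-- The definition compares sections over `𝟙 P.base ≫ base φ`, which equals `base φ` only
propositionally. Restriction along the identity passes between the two. -/
theorem preservesSec_iff (φ : P.toBObj ⟶ Q.toBObj) :
    PreservesSec φ ↔ Hom.powOn φ n (Category.id_comp _) (P.secAt (𝟙 P.base)) =
      Q.secAt (BObj.Hom.base φ) := by
  have h1 : Hom.powOn φ n rfl P.sec = (powerMap φ n).app (op (Over.mk (𝟙 P.base))) P.sec :=
    SecAt.map_app _ P.sec
  have h2 : Hom.powOn φ n rfl P.sec = SecAt.res (𝟙 P.base) (by simp)
      (Hom.powOn φ n (Category.id_comp _) (P.secAt (𝟙 P.base))) := by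
    rw [secAt_id]
    exact (congrArg _ (SecAt.res_id (e := Category.id_comp _) P.sec).symm).trans
      (Hom.powOn_res φ (Category.id_comp _) (𝟙 P.base) (Category.id_comp _) rfl P.sec)
  have h3 : (Q.torsor.power n).obj.map
      (toTop ((Over.map (BObj.Hom.base φ)).obj (Over.mk (𝟙 P.base)))).op Q.sec =
        SecAt.res (𝟙 P.base) (by simp) (Q.secAt (BObj.Hom.base φ)) := by
    rw [res_secAt (f' := 𝟙 P.base ≫ BObj.Hom.base φ)]
    rfl
  constructor
  · intro h
    have h4 : SecAt.res (f' := 𝟙 P.base ≫ BObj.Hom.base φ) (𝟙 P.base) (by simp)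
      (Hom.powOn φ n (Category.id_comp _) (P.secAt (𝟙 P.base))) =
        SecAt.res (𝟙 P.base) (by simp) (Q.secAt (BObj.Hom.base φ)) :=
      h2.symm.trans (h1.trans (h.trans h3))
    have h5 := congrArg (SecAt.res (f' := BObj.Hom.base φ) (𝟙 P.base) (by simp)) h4
    rw [SecAt.res_res, SecAt.res_res, SecAt.res_eq_self (by simp), SecAt.res_eq_self (by simp)]
      at h5
    exact h5
  · intro h
    exact h1.symm.trans (h2.trans ((congrArg _ h).trans h3.symm))

theorem PreservesSec.powOn {φ : P.toBObj ⟶ Q.toBObj} (h : PreservesSec φ) {Y : C}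
    {f : Y ⟶ P.base} {f' : Y ⟶ Q.base} (e : f ≫ BObj.Hom.base φ = f') :
    Hom.powOn φ n e (P.secAt f) = Q.secAt f' := by
  rw [← res_secAt P (𝟙 P.base) f (Category.comp_id f),
    Hom.powOn_res φ (Category.id_comp _), (preservesSec_iff φ).1 h, res_secAt]

theorem preservesSec_of_cover {φ : P.toBObj ⟶ Q.toBObj} {R : Sieve P.base} (hR : R ∈ J P.base)
    (h : ∀ ⦃Y : C⦄ (f : Y ⟶ P.base) (f' : Y ⟶ Q.base) (e : f ≫ BObj.Hom.base φ = f'), R f →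
      Hom.powOn φ n e (P.secAt f) = Q.secAt f') : PreservesSec φ := by
  refine (preservesSec_iff φ).2 (SecAt.ext hR fun Y f k e hf => ?_)
  rw [res_secAt, ← Hom.powOn_res φ (Category.id_comp _) f (Category.comp_id f) e, res_secAt]
  exact h f k e hf

end BPowObj

/-! ### Categories over `C` in which every morphism is cartesian -/

section Cartesian

variable {𝒳 : Type u'} [Category.{v'} 𝒳] {p : 𝒳 ⥤ C}

theorem isStronglyCartesian_of_existsUnique {a b : 𝒳} (φ : a ⟶ b)
    (h : ∀ ⦃c : 𝒳⦄ (ψ : c ⟶ b) (g : p.obj c ⟶ p.obj a), g ≫ p.map φ = p.map ψ →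
      ∃! χ : c ⟶ a, p.map χ = g ∧ χ ≫ φ = ψ) : p.IsStronglyCartesian (p.map φ) φ where
  universal_property' {c} g ψ hψ := by
    obtain ⟨χ, ⟨h1, h2⟩, h3⟩ := h ψ g (IsHomLift.eq_of_isHomLift p _ ψ)
    subst h1
    refine ⟨χ, ⟨inferInstance, h2⟩, fun χ' ⟨h4, h5⟩ => h3 χ' ⟨?_, h5⟩⟩
    exact (IsHomLift.eq_of_isHomLift p _ χ').symm

variable (h : ∀ ⦃a b c : 𝒳⦄ (φ : a ⟶ b) (ψ : c ⟶ b) (g : p.obj c ⟶ p.obj a),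
  g ≫ p.map φ = p.map ψ → ∃! χ : c ⟶ a, p.map χ = g ∧ χ ≫ φ = ψ)

include h

theorem isFibered_of_existsUnique
    (h' : ∀ (a : 𝒳) (S : C) (f : S ⟶ p.obj a), ∃ (b : 𝒳) (φ : b ⟶ a), p.IsHomLift f φ) :
    p.IsFibered :=
  .of_exists_isStronglyCartesian fun a S f => by
    obtain ⟨b, φ, hφ⟩ := h' a S f
    refine ⟨b, φ, ?_⟩
    have hb := IsHomLift.domain_eq p f φ
    subst hb
    rw [IsHomLift.eq_of_isHomLift p f φ]
    exact isStronglyCartesian_of_existsUnique φ fun c ψ g => h φ ψ g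

/-- A cartesian morphism over an isomorphism is an isomorphism. -/
theorem isIso_of_isHomLift_id {S : C} {a b : 𝒳} (φ : a ⟶ b) (hφ : p.IsHomLift (𝟙 S) φ) :
    IsIso φ := by
  have : IsIso (p.map φ) := by
    rw [IsHomLift.fac' p (𝟙 S) φ]
    infer_instance
  have := isStronglyCartesian_of_existsUnique φ fun c ψ g => h φ ψ g
  exact Functor.IsStronglyCartesian.isIso_of_base_isIso p (p.map φ) φ

end Cartesian

/-! ### Gluing morphisms of torsors -/

namespace BObj

variable {A : Sheaf J AddCommGrpCat.{max u v}} {P Q : BObj A}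

open Hom

/-- The base of a pullback is recorded only up to an isomorphism `i`, so that later arguments do not
depend on how the pullback is built. -/
theorem exists_pull (P : BObj A) {Y : C} (b : Y ⟶ P.base) :
    ∃ (c : BObj A) (φ : c ⟶ P) (i : Y ≅ c.base), i.hom ≫ Hom.base φ = b :=
  ⟨pull P b, pullHom P b, Iso.refl Y, Category.id_comp b⟩

/-- Morphisms of `B A` form a sheaf. -/
theorem glue_hom (f : P.base ⟶ Q.base) {R : Sieve P.base} (hR : R ∈ J P.base)
    (ψ : ∀ ⦃c : BObj A⦄ (φ : c ⟶ P), R (Hom.base φ) → (c ⟶ Q))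
    (hψ : ∀ ⦃c : BObj A⦄ (φ : c ⟶ P) (h : R (Hom.base φ)),
      Hom.base (ψ φ h) = Hom.base φ ≫ f)
    (hψ' : ∀ ⦃c c' : BObj A⦄ (χ : c' ⟶ c) (φ : c ⟶ P) (h : R (Hom.base φ))
      (h' : R (Hom.base (χ ≫ φ))), ψ (χ ≫ φ) h' = χ ≫ ψ φ h) :
    ∃! θ : P ⟶ Q, Hom.base θ = f ∧
      ∀ ⦃c : BObj A⦄ (φ : c ⟶ P) (h : R (Hom.base φ)), φ ≫ θ = ψ φ h := by
  have hψr : ∀ ⦃c : BObj A⦄ (φ : c ⟶ P) (h : R (Hom.base φ)) {Y : C} {k : Y ⟶ c.base}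
      {k' : Y ⟶ P.base} {f' : Y ⟶ Q.base}, k ≫ Hom.base φ = k' → k' ≫ f = f' →
        k ≫ Hom.base (ψ φ h) = f' := by
    intro c φ h Y k k' f' e e'
    rw [hψ, ← e', ← e, Category.assoc]
  -- the relation between sections given by the family of morphisms
  let P' : ∀ {Y : C} (k' : Y ⟶ P.base) (f' : Y ⟶ Q.base), k' ≫ f = f' →
      SecAt P.torsor.sheaf k' → SecAt Q.torsor.sheaf f' → Prop := fun {Y} k' f' e s t =>
    ∀ ⦃c : BObj A⦄ (φ : c ⟶ P) (h : R (Hom.base φ)) ⦃Z : C⦄ (g : Z ⟶ Y) (k : Z ⟶ c.base)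
      (l : Z ⟶ P.base) (e1 : g ≫ k' = l) (e2 : k ≫ Hom.base φ = l) (l' : Z ⟶ Q.base)
      (e3 : l ≫ f = l') (z : SecAt c.torsor.sheaf k), on φ e2 z = SecAt.res g e1 s →
        on (ψ φ h) (hψr φ h e2 e3) z = SecAt.res g (by rw [← e3, ← e1, ← e, Category.assoc]) t
  have P'_res : ∀ {Y Z : C} {k' : Y ⟶ P.base} {f' : Y ⟶ Q.base} (e : k' ≫ f = f')
      {l : Z ⟶ P.base} {l' : Z ⟶ Q.base} (e' : l ≫ f = l') (g : Z ⟶ Y) (e1 : g ≫ k' = l)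
      (e2 : g ≫ f' = l') (s) (t), P' k' f' e s t →
        P' l l' e' (SecAt.res g e1 s) (SecAt.res g e2 t) := by
    intro Y Z k' f' e l l' e' g e1 e2 s t H c φ h W g' k m e3 e4 m' e5 z hz
    rw [SecAt.res_res] at hz ⊢
    exact H φ h (g' ≫ g) k m _ e4 m' e5 z hz
  -- Over a member `k'` of `R`, the pullback of `P` along `k'` is itself a test object, and testing
  -- on it over `𝟙 Y` determines `t`.
  have P'_uniq : ∀ {Y : C} {k' : Y ⟶ P.base} {f' : Y ⟶ Q.base} (e : k' ≫ f = f') (s) (t t'),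
      R k' → P' k' f' e s t → P' k' f' e s t' → t = t' := by
    intro Y k' f' e s t t' hk H H'
    obtain ⟨c, φ, i, hi⟩ := exists_pull P k'
    have h : R (Hom.base φ) := by
      rw [← Iso.inv_hom_id_assoc i (Hom.base φ), hi]
      exact R.downward_closed hk _
    obtain ⟨z, hz⟩ := (on_bijective φ hi).2 s
    have h1 := H φ h (𝟙 Y) i.hom k' (Category.id_comp _) hi f' e z
      (hz.trans (SecAt.res_id s).symm)
    have h2 := H' φ h (𝟙 Y) i.hom k' (Category.id_comp _) hi f' e z
      (hz.trans (SecAt.res_id s).symm)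
    rw [SecAt.res_id] at h1 h2
    exact h1.symm.trans h2
  -- The candidate is the value of `ψ` on the pullback along `k'`. An arbitrary test object `c` is
  -- compared with that pullback `d` through the pullback `d'` along `l`. As all morphisms are
  -- cartesian, `d'` maps to both, by `χ₁` and `χ₂`, and the compatibility of `ψ` with these two
  -- maps identifies the values.
  have P'_ex : ∀ {Y : C} {k' : Y ⟶ P.base} {f' : Y ⟶ Q.base} (e : k' ≫ f = f') (s),
      R k' → ∃ t, P' k' f' e s t := by
    intro Y k' f' e s hk
    obtain ⟨d, π, i, hi⟩ := exists_pull P k'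
    have hd : R (Hom.base π) := by
      rw [← Iso.inv_hom_id_assoc i (Hom.base π), hi]
      exact R.downward_closed hk _
    obtain ⟨z, hz⟩ := (on_bijective π hi).2 s
    refine ⟨on (ψ π hd) (hψr _ hd hi e) z, ?_⟩
    intro c φ h Z g k l e1 e2 l' e3 y hy
    obtain ⟨d', π', i', hi'⟩ := exists_pull P l
    have hd' : R (Hom.base π') := by
      rw [← Iso.inv_hom_id_assoc i' (Hom.base π'), hi', ← e1, ← Category.assoc]
      exact R.downward_closed hk _
    obtain ⟨χ₁, ⟨b1, h1⟩, -⟩ := existsUnique_lift φ π' (i'.inv ≫ k) (by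
      rw [Category.assoc, e2, ← hi', Iso.inv_hom_id_assoc])
    obtain ⟨χ₂, ⟨b2, h2⟩, -⟩ := existsUnique_lift π π' (i'.inv ≫ g ≫ i.hom) (by
      rw [Category.assoc, Category.assoc, hi, e1, ← hi', Iso.inv_hom_id_assoc])
    have b1' : i'.hom ≫ Hom.base χ₁ = k := by rw [b1, Iso.hom_inv_id_assoc]
    have b2' : i'.hom ≫ Hom.base χ₂ = g ≫ i.hom := by rw [b2, Iso.hom_inv_id_assoc]
    have e4 : (g ≫ i.hom) ≫ Hom.base π = l := by rw [Category.assoc, hi, e1]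
    obtain ⟨x, hx⟩ := (on_bijective π' hi').2 (SecAt.res g e1 s)
    have x1 : on χ₁ b1' x = y := by
      refine on_injective φ e2 ?_
      rw [← on_comp χ₁ φ _ e2 (by rw [h1, hi'])]
      simp only [h1]
      rw [hy, hx]
    have x2 : on χ₂ b2' x = SecAt.res g rfl z := by
      refine on_injective π e4 ?_
      rw [← on_comp χ₂ π _ e4 (by rw [h2, hi'])]
      simp only [h2]
      rw [hx, on_res π hi, hz]
    have key : ψ π' hd' = χ₁ ≫ ψ φ h := by
      have := hψ' χ₁ φ h (by rw [h1]; exact hd')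
      simpa only [h1] using this
    have key' : ψ π' hd' = χ₂ ≫ ψ π hd := by
      have := hψ' χ₂ π hd (by rw [h2]; exact hd')
      simpa only [h2] using this
    have e5 : i'.hom ≫ Hom.base (ψ π' hd') = l' := hψr _ hd' hi' e3
    have f1 : on (ψ π' hd') e5 x = on (ψ φ h) (hψr φ h e2 e3) y := by
      rw [← x1, ← on_comp _ _ _ _ (by rw [← key]; exact e5)]
      simp only [key]
    have f2 : on (ψ π' hd') e5 x = SecAt.res g (by rw [← e3, ← e1, ← e, Category.assoc])
          (on (ψ π hd) (hψr _ hd hi e) z) := by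
      rw [← on_res (ψ π hd) (hψr _ hd hi e) g rfl (hψr _ hd e4 e3), ← x2,
        ← on_comp _ _ _ _ (by rw [← key']; exact e5)]
      simp only [key']
    exact f1.symm.trans f2
  have hglue : ∀ ⦃Y : C⦄ (k' : Y ⟶ P.base) (f' : Y ⟶ Q.base) (e : k' ≫ f = f') (s),
      ∃ t, P' k' f' e s t := by
    intro Y k' f' e s
    obtain ⟨t, ht⟩ := SecAt.glue (F := Q.torsor.sheaf) (f := f') (R := R.pullback k')
      -- Membership in `R` is part of the glued property because `P'_uniq` holds only over members
      -- of `R`.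
      (fun Z g m e' t => R (g ≫ k') ∧ P' (g ≫ k') m (by rw [Category.assoc, e, e'])
        (SecAt.res g rfl s) t)
      (fun Z W g g' f₁ f₂ e₁ e₂ e₃ t ht => by
        refine ⟨by rw [Category.assoc]; exact R.downward_closed ht.1 g', ?_⟩
        have := P'_res (by rw [Category.assoc, e, e₁]) (l := (g' ≫ g) ≫ k') (l' := f₂)
          (by rw [Category.assoc, e, e₃]) g'
          (Category.assoc _ _ _).symm e₂ _ _ ht.2
        rw [SecAt.res_res] at this
        exact this)
      (fun Z g f₁ e₁ t t' h h' =>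
        P'_uniq (by rw [Category.assoc, e, e₁]) _ _ _ h.1 h.2 h'.2)
      (J.pullback_stable k' hR)
      (fun Z g f₁ e₁ hg => by
        obtain ⟨t, ht⟩ := P'_ex (by rw [Category.assoc, e, e₁]) (SecAt.res g rfl s) hg
        exact ⟨t, hg, ht⟩)
    refine ⟨t, fun c φ h Z g k l e1 e2 l' e3 z hz => ?_⟩
    subst e1
    have hg : R (g ≫ k') := by
      rw [← e2]
      exact R.downward_closed h k
    obtain ⟨t', ht'⟩ := P'_ex e3 (SecAt.res g rfl s) hg
    rw [ht g (by rw [← e3, ← e, Category.assoc]) t' ⟨hg, ht'⟩]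
    have := ht' φ h (𝟙 Z) k _ (Category.id_comp _) e2 l' e3 z (hz.trans (SecAt.res_id _).symm)
    rwa [SecAt.res_id] at this
  have huniq : ∀ ⦃Y : C⦄ (k' : Y ⟶ P.base) (f' : Y ⟶ Q.base) (e : k' ≫ f = f') (s) (t t'),
      P' k' f' e s t → P' k' f' e s t' → t = t' := by
    intro Y k' f' e s t t' h h'
    refine SecAt.ext (J.pullback_stable k' hR) fun Z g m em hg => ?_
    have e' : (g ≫ k') ≫ f = m := by rw [Category.assoc, e, em]
    exact P'_uniq e' _ _ _ hg (P'_res e e' g rfl em s t h) (P'_res e e' g rfl em s t' h')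
  choose l hl using hglue
  obtain ⟨θ, rfl, hθ⟩ := exists_hom f l
    (fun Y Z k f' e m m' e' g eg eg' s => huniq _ _ e' _ _ _ (hl _ _ _ _)
      (P'_res e e' g eg eg' _ _ (hl _ _ _ _)))
    (fun Y k f' e a s => huniq _ _ e _ _ _ (hl _ _ _ _) (by
      intro c φ h Z g n m e1 e2 m' e3 z hz
      have h1 := hl k f' e s φ h g n m e1 e2 m' e3 (-(A.obj.map g.op a) +ᵥ z)
        (by rw [on_vadd, hz, Torsor.res_vadd, neg_vadd_vadd])
      rw [on_vadd, neg_vadd_eq_iff] at h1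
      rw [h1, Torsor.res_vadd]))
  refine ⟨θ, ⟨rfl, fun c φ h => ?_⟩, fun θ' ⟨hb, h'⟩ => ?_⟩
  · refine ext_on (hψ φ h).symm fun Y k f' e e' s => ?_
    rw [on_comp φ θ rfl (by rw [← e, base_comp, Category.assoc]) e,
      hθ _ _ (by rw [← e, base_comp, Category.assoc])]
    have := hl (k ≫ Hom.base φ) f' (by rw [← e, base_comp, Category.assoc]) (on φ rfl s) φ h
      (𝟙 Y) k _ (Category.id_comp _) rfl f' (by rw [← e, base_comp, Category.assoc]) s
      (SecAt.res_id _).symm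
    rw [SecAt.res_id] at this
    exact this.symm
  · refine ext_on hb fun Y k f' e e' s => ?_
    rw [hθ _ _ e']
    -- A competing morphism `θ'` also satisfies the relation that characterises the glued values.
    refine huniq _ _ e' s _ _ (fun c φ h Z g n m e1 e2 m' e3 z hz => ?_) (hl _ _ _ _)
    rw [← on_res θ' e g e1 (by rw [hb, e3]), ← hz,
      ← on_comp φ θ' e2 _ (by rw [h' φ h, hψr φ h e2 e3])]
    simp only [h' φ h]

end BObj

/-! ### Extending a torsor from a covering sieve -/

/-- A torsor defined only over the members of a sieve `R` on `S`: its sections over the members of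
`R`, with restriction maps, an action of `A` and gluing. -/
structure SieveTorsor (A : Sheaf J AddCommGrpCat.{max u v}) {S : C} (R : Sieve S) where
  sec : R.arrows.category → Type (max u v)
  [act : ∀ g, AddAction (Grp A g.obj.left) (sec g)]
  res : ∀ {g' g : R.arrows.category}, (g' ⟶ g) → sec g → sec g'
  res_id : ∀ {g : R.arrows.category} (s : sec g), res (𝟙 g) s = s
  res_comp : ∀ {g'' g' g : R.arrows.category} (v : g'' ⟶ g') (u : g' ⟶ g) (s : sec g),
    res (v ≫ u) s = res v (res u s)
  res_vadd : ∀ {g' g : R.arrows.category} (u : g' ⟶ g) (a : Grp A g.obj.left) (s : sec g),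
    res u (a +ᵥ s) = A.obj.map u.hom.left.op a +ᵥ res u s
  vadd_cancel : ∀ {g : R.arrows.category} {a b : Grp A g.obj.left} {s : sec g},
    a +ᵥ s = b +ᵥ s → a = b
  exists_vadd_eq : ∀ {g : R.arrows.category} (s t : sec g), ∃ a : Grp A g.obj.left, a +ᵥ s = t
  locally_nonempty : ∀ g : R.arrows.category, ∃ K ∈ (J.over S) g.obj,
    ∀ ⦃h : R.arrows.category⦄ (u : h ⟶ g), K u.hom → Nonempty (sec h)
  glue : ∀ (g : R.arrows.category) (K : Sieve g.obj), K ∈ (J.over S) g.obj →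
    ∀ y : ∀ ⦃h : R.arrows.category⦄ (u : h ⟶ g), K u.hom → sec h,
      (∀ ⦃h' h : R.arrows.category⦄ (v : h' ⟶ h) (u : h ⟶ g) (hu : K u.hom) (hv : K (v ≫ u).hom),
        y (v ≫ u) hv = res v (y u hu)) →
      ∃! s : sec g, ∀ ⦃h : R.arrows.category⦄ (u : h ⟶ g) (hu : K u.hom), res u s = y u hu

namespace SieveTorsor

attribute [instance] SieveTorsor.act

variable {A : Sheaf J AddCommGrpCat.{max u v}} {S : C} {R : Sieve S} (T : SieveTorsor A R)

/-- The sections over `X` of the extension to `Over S` of a torsor over a sieve: compatible families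
of sections over the members of the sieve that map to `X`. -/
@[ext]
structure Family (X : Over S) : Type (max u v) where
  val : ∀ g : R.arrows.category, (g.obj ⟶ X) → T.sec g
  compat : ∀ ⦃g' g : R.arrows.category⦄ (u : g' ⟶ g) (w : g.obj ⟶ X),
    val g' (u.hom ≫ w) = T.res u (val g w)

variable {T}

/-- Restriction of a compatible family. -/
def Family.map {X Y : Over S} (f : Y ⟶ X) (s : T.Family X) : T.Family Y where
  val g w := s.val g (w ≫ f)
  compat g' g u w := by rw [Category.assoc, s.compat]

theorem Family.ext' {X : Over S} {s t : T.Family X} (h : ∀ g w, s.val g w = t.val g w) : s = t :=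
  Family.ext (funext fun g => funext fun w => h g w)

theorem Family.map_val {X Y : Over S} (f : Y ⟶ X) (s : T.Family X) (g : R.arrows.category)
    (w : g.obj ⟶ Y) : (s.map f).val g w = s.val g (w ≫ f) := rfl

variable (T)

/-- The presheaf of compatible families. -/
def familyPresheaf : (Over S)ᵒᵖ ⥤ Type (max u v) where
  obj X := T.Family X.unop
  map f := TypeCat.ofHom (Family.map f.unop)
  map_id X := by
    refine ConcreteCategory.hom_ext _ _ fun s => Family.ext' fun g w => ?_
    exact congrArg (s.val g) (Category.comp_id w)
  map_comp f g := by
    refine ConcreteCategory.hom_ext _ _ fun s => Family.ext' fun h w => ?_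
    exact congrArg (s.val h) (Category.assoc w _ _).symm

/-- To amalgamate families given over a cover `K` of `X`, fix `w : g ⟶ X`. The pullback of `K` along
`w` covers `g`, and the values of the given families at identities glue to a section over `g` by the
gluing property of `T`. Its uniqueness yields compatibility in `g`, restriction to the given
families, and uniqueness of the amalgamation. -/
theorem isSheaf_familyPresheaf : Presheaf.IsSheaf (J.over S) T.familyPresheaf := by
  rw [isSheaf_iff_isSheaf_of_type]
  intro X K hK x hx
  rw [Presieve.compatible_iff_sieveCompatible] at hx
  let y : ∀ {Y : Over S} (f : Y ⟶ X), K f → T.Family Y := fun f hf => x f hf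
  -- The composite is a free variable `k`, so the identity also applies to reassociated composites,
  -- on which the proof of membership in `K` depends.
  have hy : ∀ {Z Y : Over S} (f : Y ⟶ X) (g : Z ⟶ Y) (hf : K f) (k : Z ⟶ X) (e : k = g ≫ f),
      y k (e ▸ K.downward_closed hf g) = (y f hf).map g := by
    rintro Z Y f g hf _ rfl
    exact hx f g hf
  have hglue : ∀ (g : R.arrows.category) (w : g.obj ⟶ X), ∃! s : T.sec g,
      ∀ ⦃h : R.arrows.category⦄ (u : h ⟶ g) (hu : K (u.hom ≫ w)),
        T.res u s = (y (u.hom ≫ w) hu).val h (𝟙 h.obj) := fun g w => by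
    refine T.glue g _ ((J.over S).pullback_stable w hK)
      (fun h u hu => (y (u.hom ≫ w) hu).val h (𝟙 h.obj)) fun h' h v u hu hv => ?_
    rw [hy (u.hom ≫ w) v.hom hu ((v ≫ u).hom ≫ w) (Category.assoc v.hom u.hom w),
      Family.map_val, ← Family.compat]
    congr 1
    exact (Category.id_comp v.hom).trans (Category.comp_id v.hom).symm
  choose t ht huniq using hglue
  have key : ∀ {Z : Over S} (f : Z ⟶ X) (hf : K f) (g : R.arrows.category) (w : g.obj ⟶ Z),
      (y f hf).val g w = t g (w ≫ f) := by
    intro Z f hf g w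
    refine huniq _ _ _ fun h u hu => ?_
    rw [hy f (u.hom ≫ w) hf _ (Category.assoc u.hom w f).symm, Family.map_val, ← Family.compat]
    congr 1
    exact (Category.id_comp _).symm
  let t' : T.Family X :=
    { val := t
      compat := fun g' g u w => by
        refine (huniq _ _ _ fun h v hv => ?_).symm
        have hv' : K ((v ≫ u).hom ≫ w) := by
          have e : (v ≫ u).hom ≫ w = v.hom ≫ u.hom ≫ w := Category.assoc v.hom u.hom w
          rwa [e]
        rw [← T.res_comp, ht g w (v ≫ u) hv', key, key]
        congr 2
        exact Category.assoc v.hom u.hom w }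
  refine ⟨t', fun Z f hf => Family.ext' fun g w => (key f hf g w).symm,
    fun T' hT' => Family.ext' fun g w => huniq _ _ _ fun h u hu => ?_⟩
  have h1 : y (u.hom ≫ w) hu = Family.map (u.hom ≫ w) T' := (hT' (u.hom ≫ w) hu).symm
  refine Eq.trans ?_ (congrArg (fun z => Family.val z h (𝟙 h.obj)) h1.symm)
  refine (Family.compat (T := T) T' u w).symm.trans ?_
  exact congrArg (Family.val (T := T) T' h) (Category.id_comp _).symm

/-- The family given by a section over a member of the sieve. -/
def Family.ofSec {X : Over S} (hX : R X.hom) (s : T.sec ⟨X, hX⟩) : T.Family X where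
  val _ w := T.res (g := ⟨X, hX⟩) (ObjectProperty.homMk w) s
  compat _ _ u w := T.res_comp u (g := ⟨X, hX⟩) (ObjectProperty.homMk w) s

instance (X : Over S) : AddAction (Grp A X.left) (T.Family X) where
  vadd a s :=
    { val := fun g w => A.obj.map w.left.op a +ᵥ s.val g w
      compat := fun g' g u w => by
        rw [s.compat, T.res_vadd, Grp.map_map]
        rfl }
  zero_vadd s := Family.ext (funext fun g => funext fun w => by
    change A.obj.map w.left.op 0 +ᵥ s.val g w = s.val g w
    rw [map_zero, zero_vadd])
  add_vadd a b s := Family.ext (funext fun g => funext fun w => by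
    change A.obj.map w.left.op (a + b) +ᵥ s.val g w =
      A.obj.map w.left.op a +ᵥ (A.obj.map w.left.op b +ᵥ s.val g w)
    rw [map_add, add_vadd])

theorem Family.vadd_val {X : Over S} (a : Grp A X.left) (s : T.Family X) (g : R.arrows.category)
    (w : g.obj ⟶ X) : (a +ᵥ s).val g w = A.obj.map w.left.op a +ᵥ s.val g w := rfl

/-- The extension to `S` of a torsor over a covering sieve of `S`. -/
def extend (hR : R ∈ J S) : Torsor A S where
  sheaf := ⟨T.familyPresheaf, T.isSheaf_familyPresheaf⟩
  act X := inferInstanceAs (AddAction (Grp A X.left) (T.Family X))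
  map_vadd X Y f a s := Family.ext (funext fun g => funext fun w => by
    refine (Family.vadd_val T a s g (w ≫ f)).trans ?_
    refine Eq.trans ?_ (Family.vadd_val T (A.obj.map f.left.op a) _ g w).symm
    rw [Grp.map_map]
    rfl)
  simply_transitive X := by
    have hRX := J.pullback_stable X.hom hR
    constructor
    · rintro ⟨a, s⟩ ⟨b, s'⟩ h
      obtain ⟨rfl, h⟩ := Prod.mk.inj h
      refine Prod.ext (Grp.ext_of_cover hRX fun Z k hk => ?_) rfl
      -- Freeness is tested on the members `k ≫ X.hom` of `R`, where `T` itself acts freely.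
      have h1 := congrArg (fun t : T.Family X => t.val ⟨Over.mk (k ≫ X.hom), hk⟩ (Over.homMk k)) h
      exact T.vadd_cancel h1
    · rintro ⟨s, r⟩
      change T.Family X at s r
      -- Over members of `R`, the element translating `s` to `r` exists and is unique. Requiring it
      -- to work for every `w` that factors through `k` makes the property stable under restriction.
      obtain ⟨a, ha⟩ := Grp.glue (A := A) (Y := X.left)
        (fun Z k a => ∃ _ : R (k ≫ X.hom), ∀ (g : R.arrows.category) (w : g.obj ⟶ X)
          (m : g.obj.left ⟶ Z), m ≫ k = w.left →
            A.obj.map m.op a +ᵥ s.val g w = r.val g w)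
        (fun Z W k l a h => by
          refine ⟨by rw [Category.assoc]; exact R.downward_closed h.1 l, fun g w m e => ?_⟩
          rw [Grp.map_map]
          exact h.2 g w _ (by rw [← e, Category.assoc]))
        (fun Z k a b h h' => by
          have h1 := h.2 ⟨Over.mk (k ≫ X.hom), h.1⟩ (Over.homMk k) (𝟙 Z) (Category.id_comp k)
          have h2 := h'.2 ⟨Over.mk (k ≫ X.hom), h.1⟩ (Over.homMk k) (𝟙 Z) (Category.id_comp k)
          erw [Grp.map_id] at h1 h2
          exact T.vadd_cancel (h1.trans h2.symm))
        hRX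
        (fun Z k hk => by
          obtain ⟨a, ha⟩ := T.exists_vadd_eq
            (s.val ⟨Over.mk (k ≫ X.hom), hk⟩ (Over.homMk k))
            (r.val ⟨Over.mk (k ≫ X.hom), hk⟩ (Over.homMk k))
          refine ⟨a, hk, fun g w m e => ?_⟩
          let u : g ⟶ ⟨Over.mk (k ≫ X.hom), hk⟩ := ObjectProperty.homMk (Over.homMk m (by
            change m ≫ k ≫ X.hom = _
            rw [← Category.assoc, e, Over.w]))
          have hw : w = u.hom ≫ Over.homMk k := by
            ext
            exact e.symm
          rw [hw, s.compat, r.compat, ← ha, T.res_vadd]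
          rfl)
      refine ⟨(a, s), Prod.ext rfl (Family.ext' fun g w => ?_)⟩
      obtain ⟨b, hb⟩ := T.exists_vadd_eq (s.val g w) (r.val g w)
      refine Eq.trans ?_ hb
      refine congrArg (· +ᵥ s.val g w) (ha w.left b ⟨?_, fun g' w' m e => ?_⟩)
      · rw [Over.w]
        exact g.property
      · let u : g' ⟶ g := ObjectProperty.homMk (Over.homMk m (by
          rw [← Over.w w, ← Category.assoc, e, Over.w]))
        have hw : w' = u.hom ≫ w := by
          ext
          exact e.symm
        rw [hw, s.compat, r.compat, ← hb, T.res_vadd]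
        rfl
  locally_nonempty X := by
    -- Two refinements suffice: first pass to members of `R`, then to a cover over which `T` has a
    -- section. Such a section defines a family by restriction.
    let K : Sieve X :=
      { arrows := fun Y _ => Nonempty (T.Family Y)
        downward_closed := fun {Y Z f} ⟨s⟩ g => ⟨T.familyPresheaf.map g.op s⟩ }
    refine ⟨K, (J.over S).transitive
      (J.overEquiv_symm_mem_over X _ (J.pullback_stable X.hom hR)) K fun Y f hf => ?_,
      fun Y f hf => hf⟩
    have hY : R Y.hom := by
      have : R (f.left ≫ X.hom) := (Sieve.overEquiv_symm_iff _ f).1 hf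
      rwa [Over.w] at this
    obtain ⟨L, hL, h⟩ := T.locally_nonempty ⟨Y, hY⟩
    refine (J.over S).superset_covering (fun Z v hv => ?_) hL
    have hZ : R Z.hom := by
      rw [← Over.w v]
      exact R.downward_closed hY _
    obtain ⟨s⟩ := h (h := ⟨Z, hZ⟩) (ObjectProperty.homMk v) hv
    exact ⟨Family.ofSec T hZ s⟩

end SieveTorsor

/-! ### Descent data as a torsor over a sieve -/

namespace BObj

variable {A : Sheaf J AddCommGrpCat.{max u v}} {S : C} {R : Sieve S}

open Hom

section Descent

variable (D : R.arrows.category ⥤ BObj A) (i : ∀ g : R.arrows.category, g.obj.left ≅ (D.obj g).base)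
  (hi : ∀ ⦃g' g : R.arrows.category⦄ (u : g' ⟶ g),
    (i g').hom ≫ Hom.base (D.map u) = u.hom.left ≫ (i g).hom)

include hi

/-- The base of `D.obj g` is linked to `g` only by an isomorphism `i g`. For a functor over the site
this comes from an equality of objects, which is thus used without transport, and `hi` is its
naturality. -/
theorem existsUnique_descentRes {g' g : R.arrows.category} (u : g' ⟶ g)
    (s : SecAt (D.obj g).torsor.sheaf (i g).hom) :
    ∃! t : SecAt (D.obj g').torsor.sheaf (i g').hom,
      on (D.map u) (hi u) t = SecAt.res u.hom.left rfl s :=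
  (on_bijective (D.map u) (hi u)).existsUnique _

/-- Restriction in descent data: the inverse of `D.map u` applied to the restriction along `u`. -/
noncomputable def descentRes {g' g : R.arrows.category} (u : g' ⟶ g)
    (s : SecAt (D.obj g).torsor.sheaf (i g).hom) : SecAt (D.obj g').torsor.sheaf (i g').hom :=
  (existsUnique_descentRes D i hi u s).choose

theorem on_descentRes {g' g : R.arrows.category} (u : g' ⟶ g)
    (s : SecAt (D.obj g).torsor.sheaf (i g).hom) :
    on (D.map u) (hi u) (descentRes D i hi u s) = SecAt.res u.hom.left rfl s :=
  (existsUnique_descentRes D i hi u s).choose_spec.1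

theorem eq_descentRes {g' g : R.arrows.category} (u : g' ⟶ g)
    {s : SecAt (D.obj g).torsor.sheaf (i g).hom} {t : SecAt (D.obj g').torsor.sheaf (i g').hom}
    (h : on (D.map u) (hi u) t = SecAt.res u.hom.left rfl s) : t = descentRes D i hi u s :=
  on_injective _ _ (h.trans (on_descentRes D i hi u s).symm)

theorem descentRes_comp {g'' g' g : R.arrows.category} (v : g'' ⟶ g') (u : g' ⟶ g)
    (s : SecAt (D.obj g).torsor.sheaf (i g).hom) :
    descentRes D i hi (v ≫ u) s = descentRes D i hi v (descentRes D i hi u s) := by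
  symm
  refine eq_descentRes D i hi (v ≫ u) ?_
  have e1 : (v.hom.left ≫ (i g').hom) ≫ Hom.base (D.map u) =
      (v ≫ u).hom.left ≫ (i g).hom := by
    rw [Category.assoc, hi, ← Category.assoc]
    rfl
  have e2 : (i g'').hom ≫ Hom.base (D.map v ≫ D.map u) = (v ≫ u).hom.left ≫ (i g).hom := by
    rw [← D.map_comp, hi]
  have h1 := on_comp (D.map v) (D.map u) (hi v) e1 e2
    (descentRes D i hi v (descentRes D i hi u s))
  simp only [← D.map_comp] at h1
  rw [h1, on_descentRes, on_res (D.map u) (hi u), on_descentRes, SecAt.res_res]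
  rfl

/-- The maps `D.map u` push every `y u` into the single torsor `D.obj g`, whose sheaf property glues
the images. Bijectivity on sections then brings the result back to each `D.obj h`. -/
theorem existsUnique_descentGlue (g : R.arrows.category) (K : Sieve g.obj)
    (hK : K ∈ (J.over S) g.obj)
    (y : ∀ ⦃h : R.arrows.category⦄ (u : h ⟶ g), K u.hom →
      SecAt (D.obj h).torsor.sheaf (i h).hom)
    (hy : ∀ ⦃h' h : R.arrows.category⦄ (v : h' ⟶ h) (u : h ⟶ g) (hu : K u.hom)
      (hv : K (v ≫ u).hom), y (v ≫ u) hv = descentRes D i hi v (y u hu)) :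
    ∃! s : SecAt (D.obj g).torsor.sheaf (i g).hom, ∀ ⦃h : R.arrows.category⦄ (u : h ⟶ g)
      (hu : K u.hom), descentRes D i hi u s = y u hu := by
  have hK' := (J.mem_over_iff K).1 hK
  -- the member of the sieve given by a map to `g`, and its map to `g`
  let o : ∀ {Z : C} (_ : Z ⟶ g.obj.left), R.arrows.category := fun k =>
    ⟨Over.mk (k ≫ g.obj.hom), R.downward_closed g.property k⟩
  let p : ∀ {Z : C} (k : Z ⟶ g.obj.left), o k ⟶ g := fun k => ObjectProperty.homMk (Over.homMk k)
  have hp : ∀ {Z : C} (k : Z ⟶ g.obj.left), Sieve.overEquiv _ K k → K (p k).hom := fun k hk =>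
    (Sieve.overEquiv_iff K k).1 hk
  have fac : ∀ {Z : C} (k : Z ⟶ g.obj.left) {h : R.arrows.category} (u : h ⟶ g)
      (a : h.obj.left ⟶ Z), a ≫ k = u.hom.left → ∃ v : h ⟶ o k, v.hom.left = a ∧ v ≫ p k = u := by
    intro Z k h u a e
    refine ⟨ObjectProperty.homMk (Over.homMk a ?_), rfl, ?_⟩
    · change a ≫ k ≫ g.obj.hom = _
      rw [← Category.assoc, e, Over.w]
    · ext
      exact e
  have e0 : ∀ {Z : C} (k : Z ⟶ g.obj.left) {f' : Z ⟶ (D.obj g).base} (_ : k ≫ (i g).hom = f')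
      {h : R.arrows.category} (u : h ⟶ g) (a : h.obj.left ⟶ Z), a ≫ k = u.hom.left →
      (i h).hom ≫ Hom.base (D.map u) = a ≫ f' := by
    intro Z k f' e h u a e'
    rw [hi, ← e, ← e', Category.assoc]
  obtain ⟨s, hs⟩ := SecAt.glue (F := (D.obj g).torsor.sheaf) (f := (i g).hom)
    (fun Z k f' e t => Sieve.overEquiv _ K k ∧ ∀ ⦃h : R.arrows.category⦄ (u : h ⟶ g) (hu : K u.hom)
      (a : h.obj.left ⟶ Z) (e' : a ≫ k = u.hom.left),
        on (D.map u) (e0 k e u a e') (y u hu) = SecAt.res a rfl t)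
    (fun Z W k l f' f'' e e' e'' t ht => by
      refine ⟨Sieve.downward_closed _ ht.1 l, fun h u hu a ea => ?_⟩
      rw [SecAt.res_res]
      have := ht.2 u hu (a ≫ l) (by rw [Category.assoc, ea])
      subst e'
      have h2 := congrArg (SecAt.res (f' := a ≫ l ≫ f') (𝟙 _) (by simp)) this
      rw [SecAt.res_res, ← on_res (D.map u) _ (𝟙 _) (Category.id_comp _)
        (by rw [hi, ← ea, ← e]; simp), SecAt.res_id] at h2
      rw [h2]
      exact SecAt.res_congr (Category.id_comp _) _)
    -- Testing at `p k` over `𝟙 Z` determines the section, up to replacing `𝟙 Z ≫ f'` by `f'`.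
    (fun Z k f' e t t' h h' => by
      have h1 := h.2 (p k) (hp k h.1) (𝟙 Z) (Category.id_comp k)
      have h2 := h'.2 (p k) (hp k h.1) (𝟙 Z) (Category.id_comp k)
      have h0 : SecAt.res (f' := 𝟙 Z ≫ f') (𝟙 Z) rfl t = SecAt.res (𝟙 Z) rfl t' := h1.symm.trans h2
      have h3 := congrArg (SecAt.res (f' := f') (𝟙 Z) (by simp)) h0
      rw [SecAt.res_res, SecAt.res_res, SecAt.res_eq_self (by simp),
        SecAt.res_eq_self (by simp)] at h3
      exact h3)
    hK'
    (fun Z k f' e hk => by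
      subst e
      refine ⟨on (D.map (p k)) (hi (p k)) (y (p k) (hp k hk)), hk, fun h u hu a ea => ?_⟩
      obtain ⟨v, rfl, rfl⟩ := fac k u a ea
      have e1 : (v.hom.left ≫ (i (o k)).hom) ≫ Hom.base (D.map (p k)) =
          v.hom.left ≫ k ≫ (i g).hom := by
        rw [Category.assoc, hi]
        rfl
      have e2 : (i h).hom ≫ Hom.base (D.map v ≫ D.map (p k)) = v.hom.left ≫ k ≫ (i g).hom := by
        rw [← e1, base_comp, ← Category.assoc, hi]
      have h1 := on_comp (D.map v) (D.map (p k)) (hi v) e1 e2 (y (v ≫ p k) hu)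
      simp only [← D.map_comp] at h1
      refine h1.trans ?_
      rw [hy v (p k) (hp k hk) hu, on_descentRes]
      exact on_res (D.map (p k)) (hi (p k)) v.hom.left rfl e1 _)
  have hs' : ∀ ⦃h : R.arrows.category⦄ (u : h ⟶ g) (hu : K u.hom),
      SecAt.res u.hom.left rfl s = on (D.map u) (hi u) (y u hu) := fun h u hu => by
    refine hs u.hom.left rfl _ ⟨?_, fun h' u' hu' a e => ?_⟩
    · exact (Sieve.overEquiv_symm_iff (Sieve.overEquiv _ K) u.hom).1 (by
        rwa [OrderIso.symm_apply_apply])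
    · obtain ⟨v, hv, rfl⟩ : ∃ v : h' ⟶ h, v.hom.left = a ∧ v ≫ u = u' := by
        refine ⟨ObjectProperty.homMk (Over.homMk a ?_), rfl, ?_⟩
        · rw [← Over.w u.hom, ← Category.assoc, e, Over.w]
        · ext
          exact e
      subst hv
      have e1 : (v.hom.left ≫ (i h).hom) ≫ Hom.base (D.map u) =
          v.hom.left ≫ u.hom.left ≫ (i g).hom := by
        rw [Category.assoc, hi]
      have e2 : (i h').hom ≫ Hom.base (D.map v ≫ D.map u) =
          v.hom.left ≫ u.hom.left ≫ (i g).hom := by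
        rw [← e1, base_comp, ← Category.assoc, hi]
      have h1 := on_comp (D.map v) (D.map u) (hi v) e1 e2 (y (v ≫ u) hu')
      simp only [← D.map_comp] at h1
      refine h1.trans ?_
      rw [hy v u hu hu', on_descentRes]
      exact on_res (D.map u) (hi u) v.hom.left rfl e1 _
  refine ⟨s, fun h u hu => (eq_descentRes D i hi u (hs' u hu).symm).symm, fun s' h' => ?_⟩
  -- Uniqueness: a competitor `s'` and `s` have the same restriction along every `k`, namely the
  -- image of `y (p k)`.
  refine SecAt.ext hK' fun Z k f' e hk => ?_
  subst e
  have h1 := on_descentRes D i hi (p k) s'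
  rw [h' (p k) (hp k hk)] at h1
  exact h1.symm.trans (hs' (p k) (hp k hk)).symm

/-- The torsor over a sieve given by descent data. -/
noncomputable def descentSieveTorsor : SieveTorsor A R where
  sec g := SecAt (D.obj g).torsor.sheaf (i g).hom
  res u s := descentRes D i hi u s
  res_id {g} s := by
    refine (eq_descentRes D i hi (𝟙 g) ?_).symm
    have h1 := on_id (P := D.obj g) (Category.comp_id (i g).hom) s
    have e : (𝟙 (D.obj g)) = D.map (𝟙 g) := (D.map_id g).symm
    have e' : (i g).hom ≫ Hom.base (D.map (𝟙 g)) = (i g).hom := by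
      rw [← e]; exact Category.comp_id _
    have h2 : on (D.map (𝟙 g)) e' s = s := by
      simp only [D.map_id]
      exact h1
    have h3 := on_res (D.map (𝟙 g)) e' (𝟙 _) (Category.id_comp _) (hi (𝟙 g)) s
    rw [SecAt.res_id, h2] at h3
    exact h3
  res_comp v u s := descentRes_comp D i hi v u s
  res_vadd u a s := by
    refine (eq_descentRes D i hi u ?_).symm
    rw [on_vadd, on_descentRes, Torsor.res_vadd]
  vadd_cancel h := Torsor.secAt_vadd_cancel h
  exists_vadd_eq s t := Torsor.secAt_exists_vadd_eq s t
  locally_nonempty g := by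
    obtain ⟨K, hK, h⟩ := (D.obj g).torsor.exists_cover_nonempty (i g).hom
    refine ⟨_, J.overEquiv_symm_mem_over g.obj K hK, fun h' u hu => ?_⟩
    obtain ⟨s⟩ := h u.hom.left rfl ((Sieve.overEquiv_symm_iff K u.hom).1 hu)
    obtain ⟨t, -⟩ := (on_bijective (D.map u) (hi u)).2 s
    exact ⟨t⟩
  glue := existsUnique_descentGlue D i hi

end Descent

end BObj

/-! ### Effectivity of descent for torsors -/

namespace BObj

variable {A : Sheaf J AddCommGrpCat.{max u v}} {S : C} {R : Sieve S}

open Hom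

section Descent

variable (D : R.arrows.category ⥤ BObj A) (i : ∀ g : R.arrows.category, g.obj.left ≅ (D.obj g).base)
  (hi : ∀ ⦃g' g : R.arrows.category⦄ (u : g' ⟶ g),
    (i g').hom ≫ Hom.base (D.map u) = u.hom.left ≫ (i g).hom)

/-- This is the map from `D.obj g` to the glued torsor on sections. Since `k'` factors through `g`,
every `w : h ⟶ k'` yields a map `v : h ⟶ g`, the only one satisfying `hv` because `i g` is
invertible. The value at `w` is the preimage under `D.map v` of the restriction of `s`. -/
theorem exists_descentFamily (g : R.arrows.category) {Z : C} {k : Z ⟶ (D.obj g).base}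
    {k' : Z ⟶ S} (e : k ≫ (i g).inv ≫ g.obj.hom = k') (s : SecAt (D.obj g).torsor.sheaf k) :
    ∃ F : (descentSieveTorsor D i hi).Family (Over.mk k'),
      ∀ ⦃h : R.arrows.category⦄ (w : h.obj ⟶ Over.mk k') (v : h ⟶ g)
        (hv : v.hom.left ≫ (i g).hom = w.left ≫ k),
        on (D.map v) ((hi v).trans hv)
          (show SecAt (D.obj h).torsor.sheaf (i h).hom from F.val h w) =
            SecAt.res w.left rfl s := by
  have hex : ∀ (h : R.arrows.category) (w : h.obj ⟶ Over.mk k'),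
      ∃ t : SecAt (D.obj h).torsor.sheaf (i h).hom, ∀ (v : h ⟶ g)
        (hv : v.hom.left ≫ (i g).hom = w.left ≫ k),
        on (D.map v) ((hi v).trans hv) t = SecAt.res w.left rfl s := by
    intro h w
    let v : h ⟶ g := ObjectProperty.homMk (Over.homMk (w.left ≫ k ≫ (i g).inv) (by
      rw [Category.assoc, Category.assoc, e]
      exact Over.w w))
    have hv : v.hom.left ≫ (i g).hom = w.left ≫ k := by
      change (w.left ≫ k ≫ (i g).inv) ≫ (i g).hom = _
      simp
    obtain ⟨t, ht⟩ := (on_bijective (D.map v) ((hi v).trans hv)).2 (SecAt.res w.left rfl s)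
    refine ⟨t, fun v' hv' => ?_⟩
    obtain rfl : v' = v := by
      ext
      exact (cancel_mono (i g).hom).1 (hv'.trans hv.symm)
    exact ht
  choose F hF using hex
  refine ⟨⟨F, fun g₁ g₂ u w => ?_⟩, fun h w v hv => hF h w v hv⟩
  refine eq_descentRes D i hi u ?_
  let v : g₂ ⟶ g := ObjectProperty.homMk (Over.homMk (w.left ≫ k ≫ (i g).inv) (by
      rw [Category.assoc, Category.assoc, e]
      exact Over.w w))
  have hv : v.hom.left ≫ (i g).hom = w.left ≫ k := by
    change (w.left ≫ k ≫ (i g).inv) ≫ (i g).hom = _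
    simp
  have huv : (u ≫ v).hom.left ≫ (i g).hom = (u.hom ≫ w).left ≫ k := by
    change (u.hom.left ≫ v.hom.left) ≫ _ = (u.hom.left ≫ w.left) ≫ k
    rw [Category.assoc, hv, Category.assoc]
  have e1 : (u.hom.left ≫ (i g₂).hom) ≫ Hom.base (D.map v) = (u.hom ≫ w).left ≫ k := by
    rw [Category.assoc, hi, ← huv, ← Category.assoc]
    rfl
  have e2 : (i g₁).hom ≫ Hom.base (D.map u ≫ D.map v) = (u.hom ≫ w).left ≫ k := by
    rw [← D.map_comp, hi, huv]
  refine on_injective (D.map v) e1 ?_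
  rw [← on_comp _ _ (hi u) e1 e2, on_res (D.map v) ((hi v).trans hv), hF g₂ w v hv, SecAt.res_res]
  have := hF g₁ (u.hom ≫ w) (u ≫ v) huv
  simp only [D.map_comp] at this
  exact this

/-- Every index `(h, w)` of a family over `k'` comes with a map `v : h ⟶ g`, and `D.map v` is
injective on sections. Families can therefore be compared inside `D.obj g`. -/
theorem descentFamily_ext (g : R.arrows.category) {Z : C} {k : Z ⟶ (D.obj g).base}
    {k' : Z ⟶ S} (e : k ≫ (i g).inv ≫ g.obj.hom = k')
    {F F' : (descentSieveTorsor D i hi).Family (Over.mk k')}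
    (h : ∀ ⦃h : R.arrows.category⦄ (w : h.obj ⟶ Over.mk k') (v : h ⟶ g)
        (hv : v.hom.left ≫ (i g).hom = w.left ≫ k),
        on (D.map v) ((hi v).trans hv)
          (show SecAt (D.obj h).torsor.sheaf (i h).hom from F.val h w) =
        on (D.map v) ((hi v).trans hv)
          (show SecAt (D.obj h).torsor.sheaf (i h).hom from F'.val h w)) : F = F' := by
  refine SieveTorsor.Family.ext' fun h' w => ?_
  let v : h' ⟶ g := ObjectProperty.homMk (Over.homMk (w.left ≫ k ≫ (i g).inv) (by
      rw [Category.assoc, Category.assoc, e]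
      exact Over.w w))
  have hv : v.hom.left ≫ (i g).hom = w.left ≫ k := by
    change (w.left ≫ k ≫ (i g).inv) ≫ (i g).hom = _
    simp
  exact on_injective _ _ (h w v hv)

include hi in
/-- Descent data in `B A` are effective. -/
theorem exists_descent (hR : R ∈ J S) : ∃ (T : Torsor A S) (ε : ∀ g, D.obj g ⟶ ⟨S, T⟩),
    (∀ g, Hom.base (ε g) = (i g).inv ≫ g.obj.hom) ∧
      ∀ ⦃g' g : R.arrows.category⦄ (u : g' ⟶ g), D.map u ≫ ε g = ε g' := by
  choose F hF using @exists_descentFamily C _ J A S R D i hi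
  let P : BObj A := ⟨S, (descentSieveTorsor D i hi).extend hR⟩
  have hε : ∀ g, ∃ ε : D.obj g ⟶ P, Hom.base ε = (i g).inv ≫ g.obj.hom ∧
      ∀ ⦃Z : C⦄ (k : Z ⟶ (D.obj g).base) (k' : Z ⟶ S) (e : k ≫ (i g).inv ≫ g.obj.hom = k')
        (e' : k ≫ Hom.base ε = k') (s : SecAt (D.obj g).torsor.sheaf k), on ε e' s = F g e s := by
    intro g
    refine exists_hom (P := D.obj g) (Q := P) ((i g).inv ≫ g.obj.hom)
      (fun Z k k' e s => F g e s) ?_ ?_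
    · intro Y Z k k' e l l' e' m em em' s
      refine descentFamily_ext D i hi g e' fun h w v hv => (hF g e' _ w v hv).trans ?_
      have h1 := hF g e s (w ≫ Over.homMk m em') v (by
        rw [hv, ← em]
        exact (Category.assoc _ _ _).symm)
      rw [SecAt.res_res]
      subst em
      have h2 := congrArg (SecAt.res (f' := w.left ≫ m ≫ k) (𝟙 _) (by
        exact (Category.id_comp _).trans (Category.assoc _ _ _))) h1
      rw [SecAt.res_res, ← on_res (D.map v) _ (𝟙 _) (Category.id_comp _) ((hi v).trans hv),
        SecAt.res_id] at h2
      refine Eq.trans ?_ h2.symm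
      exact SecAt.res_congr (Category.id_comp _).symm _
    · intro Z k k' e a s
      refine descentFamily_ext D i hi g e fun h w v hv => (hF g e _ w v hv).trans ?_
      refine Eq.trans ?_ (on_vadd (D.map v) ((hi v).trans hv) (A.obj.map w.left.op a)
        (show SecAt (D.obj h).torsor.sheaf (i h).hom from (F g e s).val h w)).symm
      rw [Torsor.res_vadd, hF g e s w v hv]
  choose ε hb hε using hε
  refine ⟨P.torsor, ε, hb, fun g' g u => ?_⟩
  have hb' : Hom.base (D.map u ≫ ε g) = Hom.base (ε g') := by
    rw [base_comp, hb, hb, ← cancel_epi (i g').hom, ← Category.assoc, hi, Category.assoc,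
      Iso.hom_inv_id_assoc, Iso.hom_inv_id_assoc]
    exact Over.w u.hom
  refine ext_on hb' fun Z k k' e e' s => ?_
  have e1 : (k ≫ Hom.base (D.map u)) ≫ Hom.base (ε g) = k' := by
    rw [Category.assoc, ← base_comp]; exact e
  have e2 : (k ≫ Hom.base (D.map u)) ≫ (i g).inv ≫ g.obj.hom = k' := by rw [← hb]; exact e1
  have e3 : k ≫ (i g').inv ≫ g'.obj.hom = k' := by rw [← hb]; exact e'
  rw [on_comp (D.map u) (ε g) rfl e1 e]
  refine (hε g _ _ e2 _ _).trans (Eq.trans ?_ (hε g' _ _ e3 _ _).symm)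
  refine descentFamily_ext D i hi g e2 fun h w v hv => (hF g e2 _ w v hv).trans ?_
  -- The section starts in `D.obj g'`, so the map `v` to `g` factors as `v' ≫ u`. Functoriality of
  -- `D` then matches the two families.
  obtain ⟨v', hv', rfl⟩ : ∃ v' : h ⟶ g', v'.hom.left ≫ (i g').hom = w.left ≫ k ∧ v' ≫ u = v := by
    let v' : h ⟶ g' := ObjectProperty.homMk (Over.homMk (w.left ≫ k ≫ (i g').inv) (by
      rw [Category.assoc, Category.assoc, e3]
      exact Over.w w))
    have hv' : v'.hom.left ≫ (i g').hom = w.left ≫ k := by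
      change (w.left ≫ k ≫ (i g').inv) ≫ (i g').hom = _
      simp
    refine ⟨v', hv', ?_⟩
    ext
    refine (cancel_mono (i g).hom).1 ?_
    rw [hv]
    change (v'.hom.left ≫ u.hom.left) ≫ _ = _
    rw [Category.assoc, ← hi, ← Category.assoc, hv', Category.assoc]
  have h1 := hF g' e3 s w v' hv'
  have e4 : (w.left ≫ k) ≫ Hom.base (D.map u) = w.left ≫ k ≫ Hom.base (D.map u) :=
    Category.assoc _ _ _
  have h2 := on_comp (D.map v') (D.map u) ((hi v').trans hv') e4
    (by rw [← D.map_comp, hi, hv])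
    (show SecAt (D.obj h).torsor.sheaf (i h).hom from (F g' e3 s).val h w)
  simp only [← D.map_comp] at h2
  rw [h1] at h2
  refine Eq.trans ?_ h2.symm
  exact (on_res (D.map u) rfl w.left rfl e4 s).symm

end Descent

end BObj

/-! ### `B A` is a stack -/

theorem eqToHom_comp_map_basedFunctor {𝒳 𝒴 : BasedCategory C} (D : BasedFunctor 𝒳 𝒴) {a b : 𝒳.obj}
    (u : a ⟶ b) : eqToHom (D.w_obj a).symm ≫ 𝒴.p.map (D.map u) =
      𝒳.p.map u ≫ eqToHom (D.w_obj b).symm := by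
  have := Functor.congr_hom D.w u
  simp only [Functor.comp_map] at this
  rw [this]
  simp

theorem isStack_classifyingStack (A : Sheaf J AddCommGrpCat.{max u v}) :
    IsStack J (classifyingStack A) where
  isFibered := isFibered_of_existsUnique (p := BObj.proj A)
    (fun _ _ _ φ ψ b hb => BObj.Hom.existsUnique_lift φ ψ b hb)
    (fun a _ f => ⟨BObj.pull a f, BObj.pullHom a f, IsHomLift.map (BObj.proj A) (BObj.pullHom a f)⟩)
  isIso_of_isHomLift_id S _ _ φ hφ := isIso_of_isHomLift_id (p := BObj.proj A)
    (fun _ _ _ φ ψ b hb => BObj.Hom.existsUnique_lift φ ψ b hb) (S := S) φ hφ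
  glue_hom _ _ f _ hR ψ hψ hψ' := BObj.glue_hom f hR ψ hψ hψ'
  effective_descent S R hR D := by
    obtain ⟨T, ε, hb, hε⟩ := BObj.exists_descent (A := A) (R := R) D.toFunctor
      (fun g => eqToIso (D.w_obj g).symm) (fun _ _ u => eqToHom_comp_map_basedFunctor D u) hR
    refine ⟨(⟨S, T⟩ : BObj A), ε, rfl, fun g => ?_, fun g g' u => hε u⟩
    refine IsHomLift.of_fac' (BObj.proj A) _ _ (D.w_obj g) rfl ?_
    exact (hb g).trans (congrArg (_ ≫ ·) (Category.comp_id g.obj.hom).symm)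

/-! ### `B_n A` is a stack -/

namespace BPowObj

variable {A : Sheaf J AddCommGrpCat.{max u v}} {n : ℕ} {P Q R : BPowObj A n}

open BObj.Hom

/-- The functor `B_n A → B A` that forgets the section of the power. -/
def forgetSec (A : Sheaf J AddCommGrpCat.{max u v}) (n : ℕ) : BPowObj A n ⥤ BObj A where
  obj P := P.toBObj
  map φ := Hom.hom φ

theorem ext_hom {φ ψ : P ⟶ Q} (h : Hom.hom φ = Hom.hom ψ) : φ = ψ := Hom.ext h

/-- The map on powers induced by `φ` is injective and can be cancelled. Cartesian lifts in `B A` are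
therefore automatically morphisms of `B_n A`. -/
theorem PreservesSec.of_comp {φ : P.toBObj ⟶ Q.toBObj} {χ : R.toBObj ⟶ P.toBObj}
    (h : PreservesSec φ) (h' : PreservesSec (P := R) (Q := Q) (χ ≫ φ)) : PreservesSec χ := by
  refine (preservesSec_iff χ).2 (powOn_injective φ (BObj.Hom.base_comp χ φ).symm ?_)
  rw [h.powOn, ← powOn_comp χ φ _ _ (Category.id_comp _)]
  exact (preservesSec_iff (P := R) (Q := Q) (χ ≫ φ)).1 h'

/-- The section is the preimage of the one on `Q` under the bijection on powers. This supplies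
pullbacks in `B_n A`. -/
theorem exists_preservesSec {P : BObj A} (φ : P ⟶ Q.toBObj) :
    ∃ s, PreservesSec (P := ⟨P, s⟩) (Q := Q) φ := by
  obtain ⟨s, hs⟩ := (powOn_bijective (n := n) φ (Category.id_comp _)).2
    (Q.secAt (BObj.Hom.base φ))
  refine ⟨s, (preservesSec_iff (P := ⟨P, s⟩) φ).2 ?_⟩
  rw [secAt_id]
  exact hs

theorem existsUnique_lift (φ : P ⟶ Q) (ψ : R ⟶ Q) (b : R.base ⟶ P.base)
    (hb : b ≫ BObj.Hom.base (Hom.hom φ) = BObj.Hom.base (Hom.hom ψ)) :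
    ∃! χ : R ⟶ P, BObj.Hom.base (Hom.hom χ) = b ∧ χ ≫ φ = ψ := by
  obtain ⟨χ, ⟨h1, h2⟩, h3⟩ := BObj.Hom.existsUnique_lift (Hom.hom φ) (Hom.hom ψ) b hb
  refine ⟨⟨χ, PreservesSec.of_comp (Hom.preservesSec φ) (by
    rw [h2]
    exact Hom.preservesSec ψ)⟩, ⟨h1, ext_hom h2⟩, fun χ' h => ext_hom (h3 _ ⟨h.1, ?_⟩)⟩
  exact congrArg Hom.hom h.2

/-- Morphisms of `B_n A` form a sheaf. -/
theorem glue_hom (f : P.base ⟶ Q.base) {R : Sieve P.base} (hR : R ∈ J P.base)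
    (ψ : ∀ ⦃c : BPowObj A n⦄ (φ : c ⟶ P), R (BObj.Hom.base (Hom.hom φ)) → (c ⟶ Q))
    (hψ : ∀ ⦃c : BPowObj A n⦄ (φ : c ⟶ P) (h : R (BObj.Hom.base (Hom.hom φ))),
      BObj.Hom.base (Hom.hom (ψ φ h)) = BObj.Hom.base (Hom.hom φ) ≫ f)
    (hψ' : ∀ ⦃c c' : BPowObj A n⦄ (χ : c' ⟶ c) (φ : c ⟶ P)
      (h : R (BObj.Hom.base (Hom.hom φ))) (h' : R (BObj.Hom.base (Hom.hom (χ ≫ φ)))),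
        ψ (χ ≫ φ) h' = χ ≫ ψ φ h) :
    ∃! θ : P ⟶ Q, BObj.Hom.base (Hom.hom θ) = f ∧
      ∀ ⦃c : BPowObj A n⦄ (φ : c ⟶ P) (h : R (BObj.Hom.base (Hom.hom φ))), φ ≫ θ = ψ φ h := by
  -- Every torsor mapping to `P` receives the pulled-back section, which turns `ψ` into a family of
  -- morphisms on `B A`.
  choose s hs using fun (c : BObj A) (φ : c ⟶ P.toBObj) => exists_preservesSec (Q := P) φ
  let m : ∀ ⦃c : BObj A⦄ (φ : c ⟶ P.toBObj), (⟨c, s c φ⟩ : BPowObj A n) ⟶ P :=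
    fun c φ => ⟨φ, hs c φ⟩
  obtain ⟨θ, ⟨h1, h2⟩, h3⟩ := BObj.glue_hom f hR (fun c φ h => Hom.hom (ψ (m φ) h))
    (fun c φ h => hψ (m φ) h)
    (fun c c' χ φ h h' => by
      let χ' : (⟨c', s c' (χ ≫ φ)⟩ : BPowObj A n) ⟶ ⟨c, s c φ⟩ :=
        ⟨χ, PreservesSec.of_comp (P := ⟨c, s c φ⟩) (R := ⟨c', s c' (χ ≫ φ)⟩) (hs c φ) (hs c' _)⟩
      exact congrArg Hom.hom (hψ' χ' (m φ) h h'))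
  -- An object of `B_n A` over `P` has its own section besides the chosen one. By cancellation the
  -- identity preserves them, so `ψ` has the same value for both.
  have key : ∀ ⦃c : BPowObj A n⦄ (φ : c ⟶ P) (h : R (BObj.Hom.base (Hom.hom φ))),
      Hom.hom (ψ (m (Hom.hom φ)) h) = Hom.hom (ψ φ h) := by
    intro c φ h
    let χ : (⟨c.toBObj, s c.toBObj (Hom.hom φ)⟩ : BPowObj A n) ⟶ c :=
      ⟨𝟙 c.toBObj, PreservesSec.of_comp (R := ⟨c.toBObj, s c.toBObj (Hom.hom φ)⟩)
        (Hom.preservesSec φ) (by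
          rw [Category.id_comp]
          exact hs _ _)⟩
    have e : χ ≫ φ = m (Hom.hom φ) := ext_hom (Category.id_comp (Hom.hom φ))
    have h' := hψ' χ φ h (by rw [e]; exact h)
    simp only [e] at h'
    rw [h']
    exact Category.id_comp (Hom.hom (ψ φ h))
  -- Preservation is local. Over a member `k` of `R`, pull `P` back along `k`: there `φ ≫ θ` is a
  -- value of `ψ`, hence preserves sections, as does `φ`.
  have hθ : PreservesSec θ := by
    refine preservesSec_of_cover hR fun Y k k' e hk => ?_
    obtain ⟨c, φ, i, hi⟩ := P.toBObj.exists_pull k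
    have h : R (BObj.Hom.base φ) := by
      rw [← Iso.inv_hom_id_assoc i (BObj.Hom.base φ), hi]
      exact R.downward_closed hk _
    have e' : i.hom ≫ BObj.Hom.base (φ ≫ θ) = k' := by
      rw [← e, ← hi, Category.assoc]
      rfl
    have h4 : PreservesSec (P := ⟨c, s c φ⟩) (Q := Q) (φ ≫ θ) := by
      rw [h2 φ h]
      exact Hom.preservesSec (ψ (m φ) h)
    rw [← (hs c φ).powOn hi, ← powOn_comp φ θ hi e e']
    exact h4.powOn e'
  refine ⟨⟨θ, hθ⟩, ⟨h1, fun c φ h => ext_hom ((h2 (Hom.hom φ) h).trans (key φ h))⟩,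
    fun θ' h => ext_hom (h3 _ ⟨h.1, fun c φ hφ => ?_⟩)⟩
  exact congrArg Hom.hom (h.2 (m φ) hφ)

/-- Descent data in `B_n A` are effective. -/
theorem exists_descent {S : C} {R : Sieve S} (D : R.arrows.category ⥤ BPowObj A n)
    (i : ∀ g : R.arrows.category, g.obj.left ≅ (D.obj g).base)
    (hi : ∀ ⦃g' g : R.arrows.category⦄ (u : g' ⟶ g),
      (i g').hom ≫ BObj.Hom.base (Hom.hom (D.map u)) = u.hom.left ≫ (i g).hom) (hR : R ∈ J S) :
    ∃ (T : Torsor A S) (s : (T.power n).obj.obj (op (Over.mk (𝟙 S))))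
      (ε : ∀ g, D.obj g ⟶ ⟨⟨S, T⟩, s⟩),
      (∀ g, BObj.Hom.base (Hom.hom (ε g)) = (i g).inv ≫ g.obj.hom) ∧
        ∀ ⦃g' g : R.arrows.category⦄ (u : g' ⟶ g), D.map u ≫ ε g = ε g' := by
  obtain ⟨T, ε, hb, hε⟩ : ∃ (T : Torsor A S) (ε : ∀ g, (D.obj g).toBObj ⟶ ⟨S, T⟩),
      (∀ g, BObj.Hom.base (ε g) = (i g).inv ≫ g.obj.hom) ∧
        ∀ ⦃g' g : R.arrows.category⦄ (u : g' ⟶ g), Hom.hom (D.map u) ≫ ε g = ε g' :=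
    BObj.exists_descent (D ⋙ forgetSec A n) i hi hR
  have eb : ∀ (g : R.arrows.category) {Z : C} (k : Z ⟶ g.obj.left) {f : Z ⟶ S},
      k ≫ g.obj.hom = f → (k ≫ (i g).hom) ≫ BObj.Hom.base (ε g) = f := by
    rintro g Z k f rfl
    rw [hb, Category.assoc, Iso.hom_inv_id_assoc]
  -- The sections of the powers, transported to `T^n` by `ε`, agree along every `u`. This is the
  -- compatibility needed to glue them.
  have comp : ∀ ⦃g' g : R.arrows.category⦄ (u : g' ⟶ g) {Z : C} (k : Z ⟶ g'.obj.left) {f : Z ⟶ S}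
      (e : k ≫ g'.obj.hom = f) (e' : (k ≫ u.hom.left) ≫ g.obj.hom = f),
      powOn (ε g') n (eb g' k e) ((D.obj g').secAt (k ≫ (i g').hom)) =
        powOn (ε g) n (eb g (k ≫ u.hom.left) e')
          ((D.obj g).secAt ((k ≫ u.hom.left) ≫ (i g).hom)) := by
    intro g' g u Z k f e e'
    have e1 : (k ≫ (i g').hom) ≫ BObj.Hom.base (Hom.hom (D.map u)) =
        (k ≫ u.hom.left) ≫ (i g).hom := by
      rw [Category.assoc, hi, Category.assoc]
    rw [← (Hom.preservesSec (D.map u)).powOn e1]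
    have e2 : (k ≫ (i g').hom) ≫ BObj.Hom.base (Hom.hom (D.map u) ≫ ε g) = f := by
      have : Hom.hom (D.map u) ≫ ε g = ε g' := hε u
      rw [this]
      exact eb g' k e
    refine Eq.trans ?_ (powOn_comp (Hom.hom (D.map u)) (ε g) e1 (eb g _ e') e2 _)
    have : ε g' = Hom.hom (D.map u) ≫ ε g := (hε u).symm
    simp only [this]
  obtain ⟨s, hs⟩ := SecAt.glue (F := T.power n) (f := 𝟙 S)
    (fun Z k f e t => ∃ h : R k, t = powOn (ε ⟨Over.mk k, h⟩) n
      (eb ⟨Over.mk k, h⟩ (𝟙 Z) ((Category.id_comp k).trans ((Category.comp_id k).symm.trans e)))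
        ((D.obj ⟨Over.mk k, h⟩).secAt (𝟙 Z ≫ (i ⟨Over.mk k, h⟩).hom)))
    (fun Z W k l f f' e e' e'' t ⟨h, ht⟩ => by
      have hl := R.downward_closed h l
      refine ⟨hl, ?_⟩
      let u : (⟨Over.mk (l ≫ k), hl⟩ : R.arrows.category) ⟶ ⟨Over.mk k, h⟩ :=
        ObjectProperty.homMk (Over.homMk l)
      have e3 : (𝟙 W ≫ l) ≫ k = f' := by
        rw [Category.id_comp, ← e'', Category.comp_id]
      refine Eq.trans ?_ (comp u (𝟙 W) ((Category.id_comp _).trans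
        ((Category.comp_id _).symm.trans e'')) e3).symm
      rw [ht, ← powOn_res (ε ⟨Over.mk k, h⟩) _ l (k := (𝟙 W ≫ l) ≫ (i ⟨Over.mk k, h⟩).hom)
        (by simp) (eb ⟨Over.mk k, h⟩ (𝟙 W ≫ l) e3)]
      congr 1
      exact res_secAt _ _ _ _)
    (fun Z k f e t t' h h' => h.2.trans h'.2.symm) hR
    (fun Z k f e h => ⟨_, h, rfl⟩)
  have hcongr : ∀ (g : R.arrows.category) {Z : C} {k k₁ : Z ⟶ (D.obj g).base} {f : Z ⟶ S},
      k = k₁ → ∀ (e : k ≫ BObj.Hom.base (ε g) = f) (e₁ : k₁ ≫ BObj.Hom.base (ε g) = f),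
        powOn (ε g) n e ((D.obj g).secAt k) = powOn (ε g) n e₁ ((D.obj g).secAt k₁) := by
    rintro g Z k _ f rfl e e₁
    rfl
  have hs' : ∀ (g : R.arrows.category), PreservesSec (P := D.obj g) (Q := ⟨⟨S, T⟩, s⟩) (ε g) := by
    intro g
    -- The trivial sieve suffices: every `k'` considered factors through `g` and so lies in `R`.
    refine preservesSec_of_cover (R := ⊤) (J.top_mem _) fun Y k k' e _ => ?_
    have e1 : (k ≫ (i g).inv) ≫ g.obj.hom = k' := by rw [← e, hb, Category.assoc]
    have hk : R k' := by
      rw [← e1]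
      exact R.downward_closed g.property _
    have h1 := hs k' (Category.comp_id k') _ ⟨hk, rfl⟩
    refine Eq.trans ?_ h1.symm
    let u : (⟨Over.mk k', hk⟩ : R.arrows.category) ⟶ g :=
      ObjectProperty.homMk (Over.homMk (k ≫ (i g).inv) e1)
    refine Eq.trans ?_ (comp u (𝟙 Y) (Category.id_comp k') ((congrArg (· ≫ g.obj.hom)
      (Category.id_comp (k ≫ (i g).inv))).trans e1)).symm
    have e2 : k = (𝟙 Y ≫ u.hom.left) ≫ (i g).hom := by
      change k = (𝟙 Y ≫ k ≫ (i g).inv) ≫ (i g).hom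
      simp
    exact hcongr g e2 _ _
  exact ⟨T, s, fun g => ⟨ε g, hs' g⟩, hb, fun g' g u => ext_hom (hε u)⟩

end BPowObj

theorem isStack_powClassifyingStack (A : Sheaf J AddCommGrpCat.{max u v}) (n : ℕ) :
    IsStack J (powClassifyingStack A n) where
  isFibered := isFibered_of_existsUnique (p := BPowObj.proj A n)
    (fun _ _ _ φ ψ b hb => BPowObj.existsUnique_lift φ ψ b hb)
    (fun a _ f => by
      obtain ⟨s, hs⟩ := BPowObj.exists_preservesSec (Q := a) (BObj.pullHom a.toBObj f)
      let φ : (⟨BObj.pull a.toBObj f, s⟩ : BPowObj A n) ⟶ a := ⟨BObj.pullHom a.toBObj f, hs⟩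
      exact ⟨_, φ, IsHomLift.map (BPowObj.proj A n) φ⟩)
  isIso_of_isHomLift_id S _ _ φ hφ := isIso_of_isHomLift_id (p := BPowObj.proj A n)
    (fun _ _ _ φ ψ b hb => BPowObj.existsUnique_lift φ ψ b hb) (S := S) φ hφ
  glue_hom _ _ f _ hR ψ hψ hψ' := BPowObj.glue_hom f hR ψ hψ hψ'
  effective_descent S R hR D := by
    obtain ⟨T, s, ε, hb, hε⟩ := BPowObj.exists_descent (A := A) (n := n) (R := R) D.toFunctor
      (fun g => eqToIso (D.w_obj g).symm) (fun _ _ u => eqToHom_comp_map_basedFunctor D u) hR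
    refine ⟨(⟨⟨S, T⟩, s⟩ : BPowObj A n), ε, rfl, fun g => ?_, fun g g' u => hε u⟩
    refine IsHomLift.of_fac' (BPowObj.proj A n) _ _ (D.w_obj g) rfl ?_
    exact (hb g).trans (congrArg (_ ≫ ·) (Category.comp_id g.obj.hom).symm)

/-! ### The torsor of roots -/

namespace BPowObj

variable {A : Sheaf J AddCommGrpCat.{max u v}} {n : ℕ} (P : BPowObj A n)

/-- A section `t` of the torsor is a root of the given section of the `n`-th power if the latter
is `(t, …, t)`. -/
def IsRoot {Y : C} {f : Y ⟶ P.base} (t : SecAt P.torsor.sheaf f) : Prop :=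
  P.torsor.powMk n (fun _ => t) = P.secAt f

variable {P}

theorem IsRoot.res {Y Z : C} {f : Y ⟶ P.base} {f' : Z ⟶ P.base} {t : SecAt P.torsor.sheaf f}
    (h : P.IsRoot t) (g : Z ⟶ Y) (e : g ≫ f = f') : P.IsRoot (SecAt.res g e t) := by
  have h' := congrArg (SecAt.res g e) h
  rwa [Torsor.powMk_res, res_secAt] at h'

theorem IsRoot.of_cover {Y : C} {f : Y ⟶ P.base} {t : SecAt P.torsor.sheaf f} {R : Sieve Y}
    (hR : R ∈ J Y) (h : ∀ ⦃Z : C⦄ (g : Z ⟶ Y) {f' : Z ⟶ P.base} (e : g ≫ f = f'), R g →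
      P.IsRoot (SecAt.res g e t)) : P.IsRoot t :=
  SecAt.ext hR fun Z g f' e hg => by
    rw [Torsor.powMk_res, res_secAt]
    exact h g e hg

theorem IsRoot.vadd {Y : C} {f : Y ⟶ P.base} {t : SecAt P.torsor.sheaf f} (h : P.IsRoot t)
    {a : Grp A Y} (ha : n • a = 0) : P.IsRoot (a +ᵥ t) :=
  (Torsor.powMk_vadd (fun _ => a) (by simpa using ha) _).trans h

/-- If `t` and `a + t` are both roots, their constant tuples have the same class, so the sum of `n`
copies of `a` vanishes. -/
theorem IsRoot.exists_vadd_eq {Y : C} {f : Y ⟶ P.base} {t s : SecAt P.torsor.sheaf f}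
    (h : P.IsRoot t) (h' : P.IsRoot s) : ∃ a : Grp A Y, n • a = 0 ∧ a +ᵥ t = s := by
  obtain ⟨a, rfl⟩ := Torsor.secAt_exists_vadd_eq t s
  refine ⟨a, ?_, rfl⟩
  simpa using Torsor.sum_eq_zero_of_powMk_eq (a := fun _ => a) (h'.trans h.symm)

theorem IsRoot.on {Q : BPowObj A n} {φ : P.toBObj ⟶ Q.toBObj} (hφ : PreservesSec φ) {Y : C}
    {f : Y ⟶ P.base} {f' : Y ⟶ Q.base} (e : f ≫ BObj.Hom.base φ = f')
    {t : SecAt P.torsor.sheaf f} (h : P.IsRoot t) : Q.IsRoot (BObj.Hom.on φ e t) := by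
  have h' := congrArg (BObj.Hom.powOn φ n e) h
  rwa [BObj.Hom.powOn_powMk, hφ.powOn] at h'

/-- Surjectivity of multiplication by `n` enters here. Locally the section is a tuple of translates
`x_j = a_j + x_0`; divide `∑ a_j` by `n` after a further refinement and translate `x_0` by the
quotient. Positivity of `n` provides the entry `x_0`. -/
theorem exists_cover_isRoot (P : BPowObj A n) (hn : 0 < n)
    (hA : Sheaf.IsLocallySurjective (mulBy A n)) {Y : C} (f : Y ⟶ P.base) :
    ∃ R ∈ J Y, ∀ ⦃Z : C⦄ (g : Z ⟶ Y) {f' : Z ⟶ P.base}, g ≫ f = f' → R g →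
      ∃ t : SecAt P.torsor.sheaf f', P.IsRoot t := by
  obtain ⟨R, hR, h⟩ := Torsor.exists_cover_powMk (P.secAt f)
  let K : Sieve Y :=
    { arrows := fun Z g => ∃ t : SecAt P.torsor.sheaf (g ≫ f), P.IsRoot t
      downward_closed := by
        rintro Z W g ⟨t, ht⟩ k
        exact ⟨_, ht.res k (Category.assoc k g f).symm⟩ }
  refine ⟨K, J.transitive hR K fun Z g hg => ?_, fun Z g f' e hg => by subst e; exact hg⟩
  obtain ⟨x, hx⟩ := h g rfl hg
  rw [res_secAt] at hx
  choose a ha using fun j => Torsor.secAt_exists_vadd_eq (x ⟨0, hn⟩) (x j)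
  have hs := hA.imageSieve_mem (U := Z) (∑ j, a j)
  refine J.superset_covering (fun W k hk => ?_) hs
  obtain ⟨b, hb⟩ : ∃ b : Grp A W, n • b = A.obj.map k.op (∑ j, a j) := hk
  have e : (k ≫ g) ≫ f = k ≫ g ≫ f := Category.assoc k g f
  refine ⟨b +ᵥ SecAt.res k e.symm (x ⟨0, hn⟩), ?_⟩
  rw [IsRoot, ← res_secAt P (g ≫ f) k e.symm, hx, Torsor.powMk_res,
    -- The corrections `a_j - b` have sum `∑ a_j - n • b = 0` and carry the constant tuple `b + x_0`
    -- to `a_j + x_0 = x_j`.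
    ← Torsor.powMk_vadd (fun j => A.obj.map k.op (a j) - b)]
  · congr 1
    funext j
    rw [← ha j, Torsor.res_vadd, vadd_vadd, sub_add_cancel]
  · rw [Finset.sum_sub_distrib, ← map_sum, ← hb]
    simp

variable (P)

/-- The sheaf of roots. -/
def rootSheaf : Sheaf (J.over P.base) (Type (max u v)) where
  obj :=
    { obj := fun X => {t : SecAt P.torsor.sheaf X.unop.hom // P.IsRoot t}
      map := fun {X Y} g => TypeCat.ofHom fun t =>
        ⟨SecAt.res g.unop.left (Over.w g.unop) t.1, t.2.res _ _⟩
      map_id := fun X => ConcreteCategory.hom_ext _ _ fun t => Subtype.ext (SecAt.res_id t.1)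
      map_comp := fun {X Y Z} g k => ConcreteCategory.hom_ext _ _ fun t => Subtype.ext
        (SecAt.res_res (Over.w g.unop) (Over.w k.unop) t.1).symm }
  property := by
    rw [isSheaf_iff_isSheaf_of_type]
    intro X R hR x hx
    have hT := (isSheaf_iff_isSheaf_of_type _ _).1 P.torsor.sheaf.property
    obtain ⟨s, hs, hu⟩ := hT R hR (fun Y f hf => (x f hf).1)
      (fun Y₁ Y₂ Z g₁ g₂ f₁ f₂ h₁ h₂ e => congrArg Subtype.val (hx g₁ g₂ h₁ h₂ e))
    -- Roots glue inside `T` because being a root is a local condition.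
    have h0 : P.IsRoot (f := X.hom) s := by
      refine IsRoot.of_cover ((J.mem_over_iff R).1 hR) fun Z g f' e hg => ?_
      subst e
      have hg' := (Sieve.overEquiv_iff R g).1 hg
      have h1 : SecAt.res (f := X.hom) g rfl s = (x _ hg').1 := hs _ hg'
      rw [h1]
      exact (x _ hg').2
    refine ⟨⟨s, h0⟩, fun Y f hf => Subtype.ext (hs f hf), fun t ht => Subtype.ext ?_⟩
    exact hu t.1 fun Y f hf => congrArg Subtype.val (ht f hf)

/-- The torsor of roots under the `n`-torsion of `A`. -/
def rootTorsor (hn : 0 < n) (hA : Sheaf.IsLocallySurjective (mulBy A n)) :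
    Torsor (torsion A n) P.base where
  sheaf := P.rootSheaf
  act X :=
    { vadd := fun a t => ⟨a.1 +ᵥ t.1, t.2.vadd a.2⟩
      zero_vadd := fun t => Subtype.ext (zero_vadd (Grp A X.left) t.1)
      add_vadd := fun a b t => Subtype.ext (add_vadd a.1 b.1 t.1) }
  map_vadd X Y g a t := Subtype.ext (Torsor.res_vadd g.left (Over.w g) a.1 t.1)
  simply_transitive X := by
    constructor
    · rintro ⟨a, t⟩ ⟨b, s⟩ h
      obtain ⟨rfl, h2⟩ := Prod.mk.inj h
      exact Prod.ext (Subtype.ext (Torsor.secAt_vadd_cancel (congrArg Subtype.val h2))) rfl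
    · rintro ⟨t, s⟩
      obtain ⟨a, ha, h⟩ := t.2.exists_vadd_eq s.2
      exact ⟨(⟨a, ha⟩, t), Prod.ext rfl (Subtype.ext h)⟩
  locally_nonempty X := by
    obtain ⟨R, hR, h⟩ := P.exists_cover_isRoot hn hA X.hom
    refine ⟨_, J.overEquiv_symm_mem_over X R hR, fun Z g hg => ?_⟩
    obtain ⟨t, ht⟩ := h g.left (Over.w g) ((Sieve.overEquiv_symm_iff R g).1 hg)
    exact ⟨⟨t, ht⟩⟩

variable (hn : 0 < n) (hA : Sheaf.IsLocallySurjective (mulBy A n))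

/-- The torsor of roots, as an object of the classifying stack. -/
def root : BObj (torsion A n) := ⟨P.base, P.rootTorsor hn hA⟩

variable {P hn hA}

/-- A root, as a section of the given torsor. -/
def rootVal {Y : C} {f : Y ⟶ P.base} (s : SecAt (P.rootTorsor hn hA).sheaf f) :
    SecAt P.torsor.sheaf f := Subtype.val s

theorem isRoot_rootVal {Y : C} {f : Y ⟶ P.base} (s : SecAt (P.rootTorsor hn hA).sheaf f) :
    P.IsRoot (rootVal s) := s.2

theorem rootVal_injective {Y : C} {f : Y ⟶ P.base} :
    Function.Injective (rootVal : SecAt (P.rootTorsor hn hA).sheaf f → _) :=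
  Subtype.val_injective

theorem rootVal_res {Y Z : C} {f : Y ⟶ P.base} {f' : Z ⟶ P.base} (g : Z ⟶ Y) (e : g ≫ f = f')
    (s : SecAt (P.rootTorsor hn hA).sheaf f) :
    rootVal (SecAt.res g e s) = SecAt.res g e (rootVal s) := rfl

theorem rootVal_vadd {Y : C} {f : Y ⟶ P.base} (a : Grp (torsion A n) Y)
    (s : SecAt (P.rootTorsor hn hA).sheaf f) :
    rootVal (a +ᵥ s) = Torsor.grpMap (torsionIncl A n) a +ᵥ rootVal s := rfl

theorem exists_rootVal_eq {Y : C} {f : Y ⟶ P.base} {t : SecAt P.torsor.sheaf f}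
    (h : P.IsRoot t) : ∃ s : SecAt (P.rootTorsor hn hA).sheaf f, rootVal s = t :=
  ⟨⟨t, h⟩, rfl⟩

/-- Morphisms of `B_n A` carry roots to roots, so the map on `T` restricts. Uniqueness, from
injectivity of `rootVal`, later gives functoriality. -/
theorem existsUnique_rootMap {Q : BPowObj A n} (φ : P ⟶ Q) :
    ∃! ψ : P.root hn hA ⟶ Q.root hn hA, BObj.Hom.base ψ = BObj.Hom.base (Hom.hom φ) ∧
      ∀ ⦃Y : C⦄ (f : Y ⟶ P.base) (f' : Y ⟶ Q.base)
        (e : f ≫ BObj.Hom.base (P := P.root hn hA) (Q := Q.root hn hA) ψ = f')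
        (e' : f ≫ BObj.Hom.base (Hom.hom φ) = f') (s : SecAt (P.rootTorsor hn hA).sheaf f),
          rootVal (hn := hn) (hA := hA) (BObj.Hom.on ψ e s) =
            BObj.Hom.on (Hom.hom φ) e' (rootVal s) := by
  have hex : ∀ ⦃Y : C⦄ (f : Y ⟶ P.base) (f' : Y ⟶ Q.base)
      (e : f ≫ BObj.Hom.base (Hom.hom φ) = f') (s : SecAt (P.rootTorsor hn hA).sheaf f),
      ∃ t : SecAt (Q.rootTorsor hn hA).sheaf f',
        rootVal t = BObj.Hom.on (Hom.hom φ) e (rootVal s) := fun Y f f' e s =>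
    exists_rootVal_eq ((isRoot_rootVal s).on (Hom.preservesSec φ) e)
  choose l hl using hex
  obtain ⟨ψ, hb, hψ⟩ := BObj.Hom.exists_hom (P := P.root hn hA) (Q := Q.root hn hA)
    (BObj.Hom.base (P := P.toBObj) (Q := Q.toBObj) (Hom.hom φ)) l
    (fun Y Z f f' e k k' e' g eg eg' s => rootVal_injective <| by
      refine (hl _ _ _ _).trans ?_
      refine Eq.trans ?_ (congrArg (SecAt.res g eg') (hl _ _ _ _).symm)
      exact BObj.Hom.on_res (Hom.hom φ) e g eg e' (rootVal s))
    (fun Y f f' e a s => rootVal_injective <| by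
      refine (hl _ _ _ _).trans ?_
      refine Eq.trans ?_ (congrArg (Torsor.grpMap (torsionIncl A n) a +ᵥ ·) (hl _ _ _ _).symm)
      exact BObj.Hom.on_vadd (Hom.hom φ) e _ (rootVal s))
  refine ⟨ψ, ⟨hb, fun Y f f' e e' s => ?_⟩, fun ψ' h => ?_⟩
  · exact (congrArg rootVal (hψ f f' e' e s)).trans (hl _ _ _ _)
  · refine BObj.Hom.ext_on (h.1.trans hb.symm) fun Y f f' e e' s =>
      rootVal_injective (hn := hn) (hA := hA) ?_
    have e2 : f ≫ BObj.Hom.base (P := P.toBObj) (Q := Q.toBObj) (Hom.hom φ) = f' := by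
      rw [← e', hb]
      rfl
    refine (h.2 f f' e e2 s).trans ?_
    exact ((congrArg rootVal (hψ f f' e2 e' s)).trans (hl _ _ _ _)).symm

variable (hn hA)

/-- The map on torsors of roots induced by a morphism of `B_n A`. -/
noncomputable def rootMap {P Q : BPowObj A n} (φ : P ⟶ Q) : P.root hn hA ⟶ Q.root hn hA :=
  (existsUnique_rootMap φ).choose

theorem base_rootMap {P Q : BPowObj A n} (φ : P ⟶ Q) :
    BObj.Hom.base (rootMap hn hA φ) = BObj.Hom.base (Hom.hom φ) :=
  (existsUnique_rootMap φ).choose_spec.1.1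

theorem rootVal_rootMap {P Q : BPowObj A n} (φ : P ⟶ Q) {Y : C} {f : Y ⟶ P.base} {f' : Y ⟶ Q.base}
    (e : f ≫ BObj.Hom.base (P := P.root hn hA) (Q := Q.root hn hA) (rootMap hn hA φ) = f')
    (e' : f ≫ BObj.Hom.base (Hom.hom φ) = f') (s : SecAt (P.rootTorsor hn hA).sheaf f) :
    rootVal (hn := hn) (hA := hA) (BObj.Hom.on (rootMap hn hA φ) e s) =
      BObj.Hom.on (Hom.hom φ) e' (rootVal s) :=
  (existsUnique_rootMap φ).choose_spec.1.2 f f' e e' s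

theorem rootMap_unique {P Q : BPowObj A n} (φ : P ⟶ Q) (ψ : P.root hn hA ⟶ Q.root hn hA)
    (hb : BObj.Hom.base ψ = BObj.Hom.base (Hom.hom φ))
    (h : ∀ ⦃Y : C⦄ (f : Y ⟶ P.base) (f' : Y ⟶ Q.base)
        (e : f ≫ BObj.Hom.base (P := P.root hn hA) (Q := Q.root hn hA) ψ = f')
        (e' : f ≫ BObj.Hom.base (Hom.hom φ) = f') (s : SecAt (P.rootTorsor hn hA).sheaf f),
          rootVal (hn := hn) (hA := hA) (BObj.Hom.on ψ e s) =
            BObj.Hom.on (Hom.hom φ) e' (rootVal s)) : ψ = rootMap hn hA φ :=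
  (existsUnique_rootMap φ).choose_spec.2 ψ ⟨hb, h⟩

/-- The functor from `B_n A` to `B A[n]` given by torsors of roots. -/
noncomputable def rootFunctor : BPowObj A n ⥤ BObj (torsion A n) where
  obj P := P.root hn hA
  map φ := rootMap hn hA φ
  map_id P := by
    refine (rootMap_unique hn hA (𝟙 P) _ rfl fun Y f f' e e' s => ?_).symm
    obtain rfl : f = f' := (Category.comp_id f).symm.trans e
    refine (congrArg rootVal (BObj.Hom.on_id (P := P.root hn hA) e s)).trans ?_
    exact (BObj.Hom.on_id e' (rootVal s)).symm
  map_comp {P Q R} φ ψ := by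
    refine (rootMap_unique hn hA (φ ≫ ψ) _ ?_ fun Y f f' e e' s => ?_).symm
    · rw [BObj.Hom.base_comp, base_rootMap, base_rootMap]
      rfl
    · have e1 : f ≫ BObj.Hom.base (P := P.root hn hA) (Q := Q.root hn hA)
          (rootMap hn hA φ) = f ≫ BObj.Hom.base (Hom.hom φ) := by
        rw [base_rootMap]
        rfl
      have e3 : (f ≫ BObj.Hom.base (Hom.hom φ)) ≫ BObj.Hom.base (Hom.hom ψ) = f' := by
        rw [← e', Category.assoc]
        rfl
      have e2 : (f ≫ BObj.Hom.base (Hom.hom φ)) ≫ BObj.Hom.base (P := Q.root hn hA)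
          (Q := R.root hn hA) (rootMap hn hA ψ) = f' := by
        rw [base_rootMap]
        exact e3
      refine (congrArg rootVal (BObj.Hom.on_comp (rootMap hn hA φ) (rootMap hn hA ψ)
        e1 e2 e s)).trans ?_
      refine (rootVal_rootMap hn hA ψ e2 e3 _).trans ?_
      refine (congrArg _ (rootVal_rootMap hn hA φ e1 rfl s)).trans ?_
      exact (BObj.Hom.on_comp (Hom.hom φ) (Hom.hom ψ) rfl e3 e' _).symm

end BPowObj

/-- The functor given by torsors of roots, over the site. -/
noncomputable def rootBasedFunctor (A : Sheaf J AddCommGrpCat.{max u v}) (n : ℕ) (hn : 0 < n)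
    (hA : Sheaf.IsLocallySurjective (mulBy A n)) :
    BasedFunctor (powClassifyingStack A n) (classifyingStack (torsion A n)) where
  toFunctor := BPowObj.rootFunctor hn hA
  w := Functor.hext (fun _ => rfl) fun _ _ φ => heq_of_eq (BPowObj.base_rootMap hn hA φ)

/-- Used for morphisms over identities, where `f` and `f ≫ 𝟙` are only propositionally equal and
sections are moved between them by restriction along `𝟙 Y`. -/
theorem SecAt.res_id_comm {S : C} {F : Sheaf (J.over S) (Type (max u v))} {Y Z : C}
    {f f' : Y ⟶ S} {k k' : Z ⟶ S} (g : Z ⟶ Y) (e : 𝟙 Y ≫ f = f') (e' : 𝟙 Z ≫ k = k')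
    (eg : g ≫ f = k) (eg' : g ≫ f' = k') (s : SecAt F f) :
    res (𝟙 Z) e' (res g eg s) = res g eg' (res (𝟙 Y) e s) := by
  rw [res_res, res_res]
  exact res_congr (by simp) s

theorem Torsor.res_id_vadd {A : Sheaf J AddCommGrpCat.{max u v}} {S : C} {T : Torsor A S} {Y : C}
    {f f' : Y ⟶ S} (e : 𝟙 Y ≫ f = f') (a : Grp A Y) (s : SecAt T.sheaf f) :
    SecAt.res (𝟙 Y) e (a +ᵥ s) = a +ᵥ SecAt.res (𝟙 Y) e s := by
  rw [res_vadd, Grp.map_id]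

/-! ### The universal property of the contraction product on sections -/

section Contract

variable {A H : Sheaf J AddCommGrpCat.{max u v}} (i : H ⟶ A)

namespace Torsor

variable {S : C} (T : Torsor H S)

/-- The section `(0, t)` of the contraction product. -/
noncomputable def contractOn {Y : C} {f : Y ⟶ S} (t : SecAt T.sheaf f) :
    SecAt (contract i T).sheaf f :=
  contractMk i T (X := Over.mk f) 0 t

variable {T}

theorem contractOn_res {Y Z : C} {f : Y ⟶ S} {f' : Z ⟶ S} (g : Z ⟶ Y) (e : g ≫ f = f')
    (t : SecAt T.sheaf f) :
    T.contractOn i (SecAt.res g e t) = SecAt.res g e (T.contractOn i t) := by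
  refine Eq.trans ?_ (contractMk_map i T
    (Over.homMk (U := Over.mk f') (V := Over.mk f) g e) 0 t).symm
  rw [map_zero]
  rfl

theorem contractOn_vadd {Y : C} {f : Y ⟶ S} (h : Grp H Y) (t : SecAt T.sheaf f) :
    T.contractOn i (h +ᵥ t) = grpMap i h +ᵥ T.contractOn i t :=
  contractMk_zero_vadd i T (X := Over.mk f) h t

end Torsor

namespace BObj

open TorsorStack.Torsor

variable {P Q : BObj H} {B : BObj A}

theorem on_inducedMap_contractOn (φ : P ⟶ Q) {Y : C} {f : Y ⟶ P.base} {f' : Y ⟶ Q.base}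
    (e : f ≫ Hom.base φ = f')
    (e' : f ≫ Hom.base (P := inducedObj i P) (Q := inducedObj i Q) (inducedMap i φ) = f')
    (t : SecAt P.torsor.sheaf f) :
    Hom.on (inducedMap i φ) e' (P.torsor.contractOn i t) =
      Q.torsor.contractOn i (Hom.on φ e t) := by
  subst e
  refine (Hom.on_rfl (inducedMap i φ) _).trans ((inducedMap_app_mk i φ t).trans ?_)
  rw [Hom.on_rfl]
  rfl

theorem exists_hom_contractOn (b : P.base ⟶ B.base)
    (l : ∀ ⦃Y : C⦄ (f : Y ⟶ P.base) (f' : Y ⟶ B.base), f ≫ b = f' →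
      SecAt P.torsor.sheaf f → SecAt B.torsor.sheaf f')
    (l_res : ∀ ⦃Y Z : C⦄ (f : Y ⟶ P.base) (f' : Y ⟶ B.base) (e : f ≫ b = f') (k : Z ⟶ P.base)
      (k' : Z ⟶ B.base) (e' : k ≫ b = k') (g : Z ⟶ Y) (eg : g ≫ f = k) (eg' : g ≫ f' = k')
      (s : SecAt P.torsor.sheaf f),
      l k k' e' (SecAt.res g eg s) = SecAt.res g eg' (l f f' e s))
    (l_vadd : ∀ ⦃Y : C⦄ (f : Y ⟶ P.base) (f' : Y ⟶ B.base) (e : f ≫ b = f') (a : Grp H Y)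
      (s : SecAt P.torsor.sheaf f), l f f' e (a +ᵥ s) = grpMap i a +ᵥ l f f' e s) :
    ∃ φ : inducedObj i P ⟶ B, Hom.base φ = b ∧
      ∀ ⦃Y : C⦄ (f : Y ⟶ P.base) (f' : Y ⟶ B.base) (e : f ≫ b = f')
        (e' : f ≫ Hom.base (P := inducedObj i P) φ = f') (s : SecAt P.torsor.sheaf f),
          Hom.on φ e' (P.torsor.contractOn i s) = l f f' e s := by
  refine ⟨lift i b (fun X t => l X.hom _ rfl t)
    (fun X Y g t => l_res X.hom _ rfl Y.hom _ rfl g.left (Over.w g)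
      (Over.w ((Over.map b).map g)) t)
    (fun X h t => l_vadd X.hom _ rfl h t), rfl, fun Y f f' e e' s => ?_⟩
  subst e
  exact (Hom.on_rfl _ _).trans (lift_app_mk i b _ _ _ (X := Over.mk f) s)

/-- Where `T` has a section `t`, any section of the contraction product is a translate of `(0, t)`,
so equivariance leaves only these to be compared. -/
theorem ext_on_contractOn {φ ψ : inducedObj i P ⟶ B} (hb : Hom.base φ = Hom.base ψ)
    (h : ∀ ⦃Y : C⦄ (f : Y ⟶ P.base) (f' : Y ⟶ B.base)
      (e : f ≫ Hom.base (P := inducedObj i P) φ = f')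
      (e' : f ≫ Hom.base (P := inducedObj i P) ψ = f') (s : SecAt P.torsor.sheaf f),
        Hom.on φ e (P.torsor.contractOn i s) = Hom.on ψ e' (P.torsor.contractOn i s)) :
    φ = ψ := by
  refine Hom.ext_on hb fun Y f f' e e' s => ?_
  obtain ⟨R, hR, hne⟩ := P.torsor.exists_cover_nonempty f
  refine SecAt.ext hR fun Z g k ek hg => ?_
  obtain ⟨t⟩ := hne g rfl hg
  have e1 : (g ≫ f) ≫ Hom.base φ = k := (Category.assoc _ _ _).trans ((congrArg _ e).trans ek)
  have e2 : (g ≫ f) ≫ Hom.base ψ = k := (Category.assoc _ _ _).trans ((congrArg _ e').trans ek)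
  rw [← Hom.on_res φ e g rfl e1, ← Hom.on_res ψ e' g rfl e2]
  obtain ⟨a, ha⟩ := secAt_exists_vadd_eq (T := (inducedObj i P).torsor)
    (P.torsor.contractOn i t) (SecAt.res g rfl s)
  refine (congrArg (Hom.on φ e1) ha.symm).trans (Eq.trans ?_ (congrArg (Hom.on ψ e2) ha))
  refine (Hom.on_vadd φ e1 a _).trans (Eq.trans ?_ (Hom.on_vadd ψ e2 a _).symm)
  exact congrArg _ (h _ _ e1 e2 t)

end BObj

end Contract

/-! ### Unit and counit -/

variable {A : Sheaf J AddCommGrpCat.{max u v}} {n : ℕ}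

/-- The canonical section restricts to `(t, …, t)`, so `(0, t)` is a root of the section it induces
on the contraction product. This makes the unit well defined. -/
theorem powMk_contractOn {P : BObj (torsion A n)} {Y : C} {f : Y ⟶ P.base}
    (t : SecAt P.torsor.sheaf f) :
    (Torsor.contract (torsionIncl A n) P.torsor).powMk n
      (fun _ => P.torsor.contractOn (torsionIncl A n) t) = (torsionToPowObj A n P).secAt f :=
  (Torsor.contractSection_map (torsionIncl A n) P.torsor n (nsmul_torsion A n)
    (X := Over.mk f) t).symm

variable (hn : 0 < n) (hA : Sheaf.IsLocallySurjective (mulBy A n))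

open BPowObj

/-- An `A[n]`-torsor maps to the torsor of roots of the contraction product. -/
theorem exists_unit (P : BObj (torsion A n)) :
    ∃ φ : P ⟶ (torsionToPowObj A n P).root hn hA, BObj.Hom.base φ = 𝟙 P.base ∧
      ∀ ⦃Y : C⦄ (f : Y ⟶ P.base) (e : f ≫ BObj.Hom.base φ = f) (s : SecAt P.torsor.sheaf f),
        rootVal (P := torsionToPowObj A n P) (hn := hn) (hA := hA) (BObj.Hom.on φ e s) =
          P.torsor.contractOn (torsionIncl A n) s := by
  have hex : ∀ ⦃Y : C⦄ (f f' : Y ⟶ P.base) (e : f ≫ 𝟙 P.base = f') (s : SecAt P.torsor.sheaf f),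
      ∃ t : SecAt ((torsionToPowObj A n P).rootTorsor hn hA).sheaf f',
        rootVal t = P.torsor.contractOn (torsionIncl A n)
          (SecAt.res (𝟙 Y) ((Category.id_comp f).trans ((Category.comp_id f).symm.trans e)) s) :=
    fun Y f f' e s =>
    exists_rootVal_eq (P := torsionToPowObj A n P) (powMk_contractOn _)
  choose l hl using hex
  obtain ⟨φ, hb, hφ⟩ := BObj.Hom.exists_hom (P := P) (Q := (torsionToPowObj A n P).root hn hA)
    (𝟙 P.base) l
    (fun Y Z f f' e k k' e' g eg eg' s =>
      rootVal_injective (P := torsionToPowObj A n P) (hn := hn) (hA := hA) <| by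
        refine (hl _ _ _ _).trans ?_
        refine Eq.trans ?_ (congrArg (SecAt.res g eg') (hl _ _ _ _).symm)
        refine Eq.trans ?_ (Torsor.contractOn_res (torsionIncl A n) g eg' _)
        exact congrArg _ (SecAt.res_id_comm g _ _ eg eg' s))
    (fun Y f f' e a s =>
      rootVal_injective (P := torsionToPowObj A n P) (hn := hn) (hA := hA) <| by
        refine (hl _ _ _ _).trans ?_
        refine Eq.trans ?_ (congrArg (Torsor.grpMap (torsionIncl A n) a +ᵥ ·) (hl _ _ _ _).symm)
        refine (congrArg _ (Torsor.res_id_vadd _ a s)).trans ?_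
        exact Torsor.contractOn_vadd _ _ _)
  refine ⟨φ, hb, fun Y f e s => ?_⟩
  refine (congrArg rootVal (hφ f f (Category.comp_id f) e s)).trans ((hl _ _ _ _).trans ?_)
  rw [SecAt.res_id]

/-- The contraction product of the torsor of roots maps to the given torsor. -/
theorem exists_counit (P : BPowObj A n) :
    ∃ φ : torsionToPowObj A n (P.root hn hA) ⟶ P,
      BObj.Hom.base (Hom.hom φ) = 𝟙 P.base ∧
      ∀ ⦃Y : C⦄ (f : Y ⟶ P.base) (e : f ≫ BObj.Hom.base (P := (torsionToPowObj A n
          (P.root hn hA)).toBObj) (Q := P.toBObj) (Hom.hom φ) = f)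
        (s : SecAt (P.rootTorsor hn hA).sheaf f),
        BObj.Hom.on (Hom.hom φ) e
          ((P.rootTorsor hn hA).contractOn (torsionIncl A n) s) = rootVal s := by
  obtain ⟨φ, hb, hφ⟩ := BObj.exists_hom_contractOn (P := P.root hn hA) (B := P.toBObj)
    (torsionIncl A n) (𝟙 P.base)
    (fun Y f f' e s => SecAt.res (𝟙 Y)
      ((Category.id_comp f).trans ((Category.comp_id f).symm.trans e))
      (rootVal (P := P) (hn := hn) (hA := hA) s))
    (fun Y Z f f' e k k' e' g eg eg' s => by
      refine (congrArg _ (rootVal_res g eg s)).trans ?_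
      exact SecAt.res_id_comm g _ _ eg eg' _)
    (fun Y f f' e a s => by
      refine (congrArg _ (rootVal_vadd a s)).trans ?_
      exact Torsor.res_id_vadd _ _ _)
  have hφ' : ∀ ⦃Y : C⦄ (f : Y ⟶ P.base)
      (e : f ≫ BObj.Hom.base (P := BObj.inducedObj (torsionIncl A n) (P.root hn hA)) φ = f)
      (s : SecAt (P.rootTorsor hn hA).sheaf f),
      BObj.Hom.on φ e ((P.rootTorsor hn hA).contractOn (torsionIncl A n) s) = rootVal s :=
    fun Y f e s => (hφ f f (Category.comp_id f) e s).trans (SecAt.res_id _)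
  -- Preservation of the sections is checked where a root `s` exists: the power of `(0, s)` goes to
  -- `(s, …, s)`, which is the section of `P`.
  obtain ⟨R, hR, hne⟩ := (P.rootTorsor hn hA).exists_cover_nonempty (𝟙 P.base)
  refine ⟨⟨φ, preservesSec_of_cover (P := torsionToPowObj A n (P.root hn hA)) (Q := P) hR
    fun Y f f' e hf => ?_⟩, hb, hφ'⟩
  obtain ⟨s⟩ := hne f (Category.comp_id f) hf
  obtain rfl : f = f' := by
    rw [hb] at e
    exact (Category.comp_id f).symm.trans e
  refine (congrArg (BObj.Hom.powOn φ n e) (powMk_contractOn (P := P.root hn hA) s).symm).trans ?_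
  refine (BObj.Hom.powOn_powMk φ e _).trans ?_
  refine (congrArg _ (funext fun _ => hφ' f e s)).trans ?_
  exact isRoot_rootVal s

/-- As sections of the contraction product, both sides send `s` to `(0, φ s)`, and `rootVal` is
injective. -/
theorem naturality_unit {P Q : BObj (torsion A n)} (φ : P ⟶ Q)
    {ε : P ⟶ (torsionToPowObj A n P).root hn hA} (hb : BObj.Hom.base ε = 𝟙 P.base)
    (hε : ∀ ⦃Y : C⦄ (f : Y ⟶ P.base) (e : f ≫ BObj.Hom.base ε = f) (s : SecAt P.torsor.sheaf f),
      rootVal (P := torsionToPowObj A n P) (hn := hn) (hA := hA) (BObj.Hom.on ε e s) =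
        P.torsor.contractOn (torsionIncl A n) s)
    {δ : Q ⟶ (torsionToPowObj A n Q).root hn hA} (hb' : BObj.Hom.base δ = 𝟙 Q.base)
    (hδ : ∀ ⦃Y : C⦄ (f : Y ⟶ Q.base) (e : f ≫ BObj.Hom.base δ = f) (s : SecAt Q.torsor.sheaf f),
      rootVal (P := torsionToPowObj A n Q) (hn := hn) (hA := hA) (BObj.Hom.on δ e s) =
        Q.torsor.contractOn (torsionIncl A n) s) :
    φ ≫ δ = ε ≫ rootMap hn hA ((torsionToPow A n).map φ) := by
  have hφ : BObj.Hom.base (rootMap hn hA ((torsionToPow A n).map φ)) = BObj.Hom.base φ :=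
    base_rootMap hn hA _
  refine BObj.Hom.ext_on ?_ fun Y f f' e e' s => ?_
  · refine (congrArg (BObj.Hom.base φ ≫ ·) hb').trans ((Category.comp_id _).trans ?_)
    exact (hφ.symm.trans (Category.id_comp _).symm).trans (congrArg (· ≫ _) hb).symm
  · have e1 : f ≫ BObj.Hom.base φ = f' := by
      rw [← e, BObj.Hom.base_comp, hb']
      exact congrArg _ (Category.comp_id _).symm
    have e2 : f' ≫ BObj.Hom.base (P := Q) (Q := (torsionToPowObj A n Q).root hn hA) δ = f' := by
      rw [hb']
      exact Category.comp_id f'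
    have e3 : f ≫ BObj.Hom.base ε = f := by rw [hb]; exact Category.comp_id f
    have e4 : f ≫ BObj.Hom.base (P := (torsionToPowObj A n P).root hn hA)
        (Q := (torsionToPowObj A n Q).root hn hA)
        (rootMap hn hA ((torsionToPow A n).map φ)) = f' := (congrArg (f ≫ ·) hφ).trans e1
    refine rootVal_injective (P := torsionToPowObj A n Q) (hn := hn) (hA := hA) ?_
    refine (congrArg rootVal (BObj.Hom.on_comp φ δ e1 e2 e s)).trans ((hδ f' e2 _).trans ?_)
    refine Eq.trans ?_ (congrArg rootVal (BObj.Hom.on_comp ε _ e3 e4 e' s).symm)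
    refine Eq.trans ?_ (rootVal_rootMap hn hA ((torsionToPow A n).map φ) e4 e1 _).symm
    refine Eq.trans ?_ (congrArg (BObj.Hom.on (BObj.inducedMap (torsionIncl A n) φ) e1)
      (hε f e3 s).symm)
    exact (BObj.on_inducedMap_contractOn (torsionIncl A n) φ e1 e1 s).symm

/-- On the generating sections `(0, s)`, with `s` a root, both sides give `φ s`. -/
theorem naturality_counit {P Q : BPowObj A n} (φ : P ⟶ Q)
    {ε : torsionToPowObj A n (P.root hn hA) ⟶ P} (hb : BObj.Hom.base (Hom.hom ε) = 𝟙 P.base)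
    (hε : ∀ ⦃Y : C⦄ (f : Y ⟶ P.base) (e : f ≫ BObj.Hom.base (P := (torsionToPowObj A n
        (P.root hn hA)).toBObj) (Q := P.toBObj) (Hom.hom ε) = f)
      (s : SecAt (P.rootTorsor hn hA).sheaf f), BObj.Hom.on (Hom.hom ε) e
        ((P.rootTorsor hn hA).contractOn (torsionIncl A n) s) = rootVal s)
    {δ : torsionToPowObj A n (Q.root hn hA) ⟶ Q} (hb' : BObj.Hom.base (Hom.hom δ) = 𝟙 Q.base)
    (hδ : ∀ ⦃Y : C⦄ (f : Y ⟶ Q.base) (e : f ≫ BObj.Hom.base (P := (torsionToPowObj A n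
        (Q.root hn hA)).toBObj) (Q := Q.toBObj) (Hom.hom δ) = f)
      (s : SecAt (Q.rootTorsor hn hA).sheaf f), BObj.Hom.on (Hom.hom δ) e
        ((Q.rootTorsor hn hA).contractOn (torsionIncl A n) s) = rootVal s) :
    (torsionToPow A n).map (rootMap hn hA φ) ≫ δ = ε ≫ φ := by
  have hφ := base_rootMap hn hA φ
  refine ext_hom (BObj.ext_on_contractOn (P := P.root hn hA) (torsionIncl A n) ?_
    fun Y f f' e e' s => ?_)
  · refine (congrArg₂ (· ≫ ·) hφ hb').trans ((Category.comp_id _).trans ?_)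
    exact ((congrArg (· ≫ BObj.Hom.base (Hom.hom φ)) hb).trans (Category.id_comp _)).symm
  · have e3 : f ≫ BObj.Hom.base (P := (torsionToPowObj A n (P.root hn hA)).toBObj)
        (Q := P.toBObj) (Hom.hom ε) = f := by rw [hb]; exact Category.comp_id f
    have e1 : f ≫ BObj.Hom.base (P := P.toBObj) (Q := Q.toBObj) (Hom.hom φ) = f' := by
      have e5 : (f ≫ BObj.Hom.base (P := (torsionToPowObj A n (P.root hn hA)).toBObj)
        (Q := P.toBObj) (Hom.hom ε)) ≫ BObj.Hom.base (P := P.toBObj) (Q := Q.toBObj)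
          (Hom.hom φ) = f' := (Category.assoc _ _ _).trans e'
      rwa [e3] at e5
    have e4 : f ≫ BObj.Hom.base (P := P.root hn hA) (Q := Q.root hn hA) (rootMap hn hA φ) = f' := by
      rw [hφ]; exact e1
    have e2 : f' ≫ BObj.Hom.base (P := (torsionToPowObj A n (Q.root hn hA)).toBObj)
        (Q := Q.toBObj) (Hom.hom δ) = f' := by rw [hb']; exact Category.comp_id f'
    refine (BObj.Hom.on_comp (BObj.inducedMap (torsionIncl A n) (rootMap hn hA φ)) (Hom.hom δ)
      e4 e2 e _).trans ?_
    refine (congrArg _ (BObj.on_inducedMap_contractOn (torsionIncl A n) (rootMap hn hA φ)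
      e4 e4 s)).trans ?_
    refine (hδ f' e2 _).trans ((rootVal_rootMap hn hA φ e4 e1 s).trans ?_)
    refine (congrArg _ (hε f e3 s).symm).trans ?_
    exact (BObj.Hom.on_comp (Hom.hom ε) (Hom.hom φ) e3 e1 e' _).symm

/-! ### The equivalence -/

/-- A natural transformation between functors over the site into a stack, with components over the
identities, is an isomorphism. -/
theorem IsStack.nonempty_iso {𝒳 𝒴 : BasedCategory.{v', u'} C} (h𝒴 : IsStack J 𝒴)
    {F G : BasedFunctor 𝒳 𝒴} (ε : ∀ a, F.obj a ⟶ G.obj a)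
    (hε : ∀ a, 𝒴.p.IsHomLift (𝟙 (𝒳.p.obj a)) (ε a))
    (nat : ∀ ⦃a b : 𝒳.obj⦄ (φ : a ⟶ b), F.map φ ≫ ε b = ε a ≫ G.map φ) : Nonempty (F ≅ G) := by
  have := fun a => h𝒴.isIso_of_isHomLift_id (ε a) (hε a)
  exact ⟨BasedNatIso.mkNatIso (NatIso.ofComponents (fun a => asIso (ε a)) fun φ => nat φ) hε⟩

theorem isEquivalenceOver_naturalMap (hn : 0 < n)
    (hA : Sheaf.IsLocallySurjective (mulBy A n)) : IsEquivalenceOver (naturalMap A n) := by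
  refine ⟨rootBasedFunctor A n hn hA, ?_, ?_⟩
  · choose ε hb hε using exists_unit (A := A) (n := n) hn hA
    obtain ⟨α⟩ := (isStack_classifyingStack (torsion A n)).nonempty_iso
      (F := BasedFunctor.id (classifyingStack (torsion A n)))
      (G := (naturalMap A n).comp (rootBasedFunctor A n hn hA)) ε
      (fun P => IsHomLift.of_fac' (BObj.proj (torsion A n)) _ _ rfl rfl 
        ((hb P).trans ((Category.id_comp _).trans (Category.comp_id _)).symm))
      (fun P Q φ => naturality_unit hn hA φ (hb P) (hε P) (hb Q) (hε Q))
    -- The unit runs from the identity to the composite, opposite to the isomorphism required.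
    exact ⟨α.symm⟩
  · choose ε hb hε using exists_counit (A := A) (n := n) hn hA
    exact (isStack_powClassifyingStack A n).nonempty_iso
      (F := (rootBasedFunctor A n hn hA).comp (naturalMap A n))
      (G := BasedFunctor.id (powClassifyingStack A n)) ε
      (fun P => IsHomLift.of_fac' (BPowObj.proj A n) _ _ rfl rfl 
        ((hb P).trans ((Category.id_comp _).trans (Category.comp_id _)).symm))
      (fun P Q φ => naturality_counit hn hA φ (hb P) (hε P) (hb Q) (hε Q))

end TorsorStack

theorem mainTheorem5 {C : Type u} [Category.{v} C] (J : GrothendieckTopology C)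
    (A : Sheaf J AddCommGrpCat.{max u v}) (n : ℕ) (hn : 0 < n)
    (hA : Sheaf.IsLocallySurjective (TorsorStack.mulBy A n)) :
    TorsorStack.IsStack J (TorsorStack.classifyingStack (TorsorStack.torsion A n)) ∧
      TorsorStack.IsStack J (TorsorStack.powClassifyingStack A n) ∧
        TorsorStack.IsEquivalenceOver (TorsorStack.naturalMap A n) :=
  ⟨TorsorStack.isStack_classifyingStack _, TorsorStack.isStack_powClassifyingStack A n,
    TorsorStack.isEquivalenceOver_naturalMap hn hA⟩
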